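/- Let $X$ be an oriented smooth manifold of dimension $n$ (Hausdorff, second countable, without boundary) and let $Y\subset X$ be a closed submanifold of codimension $m$. Let $\mu\colon X\to\mathbb R_{\ge 0}$ be a nonnegative Morse--Bott function with zero set $Y$: $\mu$ is smooth, vanishes exactly on $Y$, and its Hessian at every point of $Y$ has rank $m$. Two such functions are conformally equivalent if their ratio is an everywhere positive smooth function on $X$. Let $\mathcal A^k_\mu(X)$ be the space of smooth complex-valued differential $k$-forms $\omega$ on $X\smallsetminus Y$ such that $\mu^N\omega$ extends to a smooth form on $X$ for some integer $N\ge 0$. (a) Let $\omega\in\mathcal A^n_\mu(X)$ have support with compact closure in $X$, and let $N\geq 0$ be such that $\mu^N\omega$ extends to a smooth form on $X$. The integral $\int_{X\smallsetminus Y}\mu^{s/2}\omega$ converges absolutely and is holomorphic for $\mathrm{Re}\,s>2N-m$, and it has a meromorphic continuation $\zeta(s;\mu,\omega)$ to $\mathbb C$, with at most simple poles, all of them in the arithmetic progression $s=2N-m,\,2N-m-2,\,2N-m-4,\dots$. For every $\epsilon>0$ the integral $\int_{\mu\ge\epsilon^2}\omega$ converges absolutely, and as $\epsilon\to0^+$ $$\int_{\mu\ge\epsilon^2}\omega=\sum_{k=1}^{2N-m}I_{-k}(\mu,\omega)\,\epsilon^{-k}+I_0(\mu,\omega)\log\frac1\epsilon+I_{\mathrm{finite}}(\mu,\omega)+O(\epsilon)$$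 (the sum is empty if $2N\le m$), which defines the coefficients $I_{-k}$, $I_0$ and $I_{\mathrm{finite}}$ uniquely. For $1\le k\le 2N-m$ one has $I_{-k}(\mu,\omega)=\frac1k\,\mathrm{res}_{s=k}\zeta(s;\mu,\omega)$, and $I_{-k}(\mu,\omega)=0$ unless $k\equiv m \bmod 2$. Moreover $I_0(\mu,\omega)=\mathrm{res}_{s=0}\zeta(s;\mu,\omega)$; it depends on $\mu$ only through its conformal class, and it vanishes if $m$ is odd. (i) For $\omega$ as in (a), $I_{\mathrm{finite}}(\mu,\omega)=\lim_{s\to0}\left(\zeta(s;\mu,\omega)-\frac{I_0(\mu,\omega)}{s}\right)$. (ii) For $\omega$ as in (a) and every smooth function $\varphi\colon X\to\mathbb R$, $I_{\mathrm{finite}}(e^{2\varphi}\mu,\omega)=I_{\mathrm{finite}}(\mu,\omega)+I_0(\mu,\varphi\,\omega)$. (iii) For $n\ge1$ and $\psi\in\mathcal A^{n-1}_\mu(X)$ whose support has compact closure in $X$, $I_{\mathrm{finite}}(\mu,d\psi)=\frac{(-1)^n}2\,I_0\!\left(\mu,\psi\wedge\frac{d\mu}{\mu}\right)$ and $I_0(\mu,d\psi)=0$.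 -/

import Mathlib

open Set Filter Topology MeasureTheory Asymptotics
open scoped Manifold

noncomputable section

namespace HadamardReg

section Forms

/-- Complex-valued differential `k`-forms on `X`, with no regularity. A form on an open subset `U`
is represented by any such function; its values outside `U` are irrelevant. -/
abbrev Form (n : ℕ) (X : Type*) [TopologicalSpace X]
    [ChartedSpace (EuclideanSpace ℝ (Fin n)) X] (k : ℕ) : Type _ :=
  ∀ x : X, (TangentSpace (𝓡 n) x) [⋀^Fin k]→L[ℝ] ℂ

variable {n : ℕ} {X : Type*} [TopologicalSpace X] [ChartedSpace (EuclideanSpace ℝ (Fin n)) X]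

/-- Coordinate expression of a form in the preferred chart at `p`: its pull-back under the inverse
of the chart (meaningful on the target of the chart). -/
def inChart {k : ℕ} (ω : Form n X k) (p : X) (y : EuclideanSpace ℝ (Fin n)) :
    (EuclideanSpace ℝ (Fin n)) [⋀^Fin k]→L[ℝ] ℂ :=
  (ω ((extChartAt (𝓡 n) p).symm y)).compContinuousLinearMap
    (mfderiv 𝓘(ℝ, EuclideanSpace ℝ (Fin n)) (𝓡 n) (extChartAt (𝓡 n) p).symm y)

/-- A form is smooth on the open set `U` if all its coordinate expressions are. -/
def SmoothFormOn {k : ℕ} (ω : Form n X k) (U : Set X) : Prop :=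
  ∀ p : X, ContDiffOn ℝ (⊤ : ℕ∞) (inChart ω p)
    ((extChartAt (𝓡 n) p).target ∩ (extChartAt (𝓡 n) p).symm ⁻¹' U)

/-- The de Rham differential: at `x`, the exterior derivative of the coordinate expression in the
chart at `x`, pulled back by that chart. -/
def extD {k : ℕ} (ω : Form n X k) : Form n X (k + 1) := fun x =>
  (extDeriv (inChart ω x) (extChartAt (𝓡 n) x x)).compContinuousLinearMap
    (mfderiv (𝓡 n) 𝓘(ℝ, EuclideanSpace ℝ (Fin n)) (extChartAt (𝓡 n) x) x)

/-- `α ∧ ψ` for a linear form `α` and an alternating `k`-form `ψ`: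
`(α ∧ ψ)(v₀, …, v_k) = ∑ᵢ (-1)^i α(vᵢ) ψ(v₀, …, v̂ᵢ, …, v_k)`. -/
def oneWedge {E : Type*} [NormedAddCommGroup E] [NormedSpace ℝ E] {k : ℕ} (α : E →L[ℝ] ℝ)
    (ψ : E [⋀^Fin k]→L[ℝ] ℂ) : E [⋀^Fin (k + 1)]→L[ℝ] ℂ :=
  ContinuousAlternatingMap.alternatizeUncurryFin (α.smulRight ψ)

/-- The wedge product `ψ ∧ α = (-1)^k α ∧ ψ` of a `k`-form `ψ` and a real 1-form `α`. -/
def wedgeOne {k : ℕ} (ψ : Form n X k) (α : ∀ x : X, TangentSpace (𝓡 n) x →L[ℝ] ℝ) :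
    Form n X (k + 1) := fun x =>
  (-1 : ℝ) ^ k • oneWedge (E := EuclideanSpace ℝ (Fin n)) (α x) (ψ x)

/-- The real 1-form `dμ / μ` (meaningful where `μ ≠ 0`). -/
def dLog (μ : X → ℝ) (x : X) : TangentSpace (𝓡 n) x →L[ℝ] ℝ :=
  (μ x)⁻¹ • (mfderiv (𝓡 n) 𝓘(ℝ, ℝ) μ x : TangentSpace (𝓡 n) x →L[ℝ] ℝ)

/-- Regard a form of degree `k` as one of degree `l` when `k = l`. -/
def castDeg {k l : ℕ} (h : k = l) (ω : Form n X k) : Form n X l := h ▸ ω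

end Forms

section Orientation

/-- The sign (`1`, `-1`, or `0` for a linearly dependent family) of an `n`-tuple of vectors
with respect to an orientation. -/
def frameSign {V : Type*} [AddCommGroup V] [Module ℝ V] {n : ℕ}
    (o : Orientation ℝ V (Fin n)) (v : Fin n → V) : ℝ :=
  ((SignType.sign ((o.someVector : V [⋀^Fin n]→ₗ[ℝ] ℝ) v) : SignType) : ℝ)

variable {n : ℕ} {X : Type*} [TopologicalSpace X] [ChartedSpace (EuclideanSpace ℝ (Fin n)) X]

/-- The coordinate frame `∂₁, …, ∂ₙ` of the preferred chart at `p`, at the point with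
coordinates `y`. -/
def coordFrame (p : X) (y : EuclideanSpace ℝ (Fin n)) (i : Fin n) :
    TangentSpace (𝓡 n) ((extChartAt (𝓡 n) p).symm y) :=
  mfderiv 𝓘(ℝ, EuclideanSpace ℝ (Fin n)) (𝓡 n) (extChartAt (𝓡 n) p).symm y
    (EuclideanSpace.single i (1 : ℝ))

variable (n X) in
/-- An orientation of the manifold `X`: an orientation of every tangent space, such that the sign
of each coordinate frame is locally constant. -/
structure ManifoldOrientation where
  orient : ∀ x : X, Orientation ℝ (TangentSpace (𝓡 n) x) (Fin n)
  locally_const : ∀ p : X, ContinuousOn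
    (fun y => frameSign (orient ((extChartAt (𝓡 n) p).symm y)) (coordFrame (n := n) p y))
    (extChartAt (𝓡 n) p).target

end Orientation

section Integral

/-- `c` assigns to every point `z` the centre `c z` of a preferred chart containing `z`, using
countably many charts, each on a Borel set. -/
structure IsChartSelection (n : ℕ) {X : Type*} [TopologicalSpace X]
    [ChartedSpace (EuclideanSpace ℝ (Fin n)) X] [MeasurableSpace X] (c : X → X) : Prop where
  countable_range : (range c).Countable
  measurable_fiber : ∀ p : X, MeasurableSet (c ⁻¹' {p})
  mem_source : ∀ z : X, z ∈ (chartAt (EuclideanSpace ℝ (Fin n)) (c z)).source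

variable (n : ℕ) (X : Type*) [TopologicalSpace X] [ChartedSpace (EuclideanSpace ℝ (Fin n)) X]
  [SecondCountableTopology X] [MeasurableSpace X] [BorelSpace X]

theorem exists_chartSelection : ∃ c : X → X, IsChartSelection n c := by
  classical
  rcases isEmpty_or_nonempty X with hX | hX
  · exact ⟨id, ⟨(Set.toFinite _).countable, fun p => isEmptyElim p, fun p => isEmptyElim p⟩⟩
  obtain ⟨s, hs, hcov⟩ := TopologicalSpace.countable_cover_nhds
    (fun x : X => chart_source_mem_nhds (EuclideanSpace ℝ (Fin n)) x)
  have hne : s.Nonempty := by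
    by_contra h
    rw [Set.not_nonempty_iff_eq_empty] at h
    subst h
    simp only [mem_empty_iff_false, iUnion_of_empty, iUnion_empty] at hcov
    exact absurd (hcov ▸ mem_univ (Classical.arbitrary X)) (notMem_empty _)
  obtain ⟨f, rfl⟩ := hs.exists_eq_range hne
  have hz : ∀ z : X, ∃ i, z ∈ (chartAt (EuclideanSpace ℝ (Fin n)) (f i)).source := by
    intro z
    have : z ∈ ⋃ x ∈ range f, (chartAt (EuclideanSpace ℝ (Fin n)) x).source :=
      hcov ▸ mem_univ z
    simpa using this
  have hm : ∀ i, MeasurableSet (chartAt (EuclideanSpace ℝ (Fin n)) (f i)).source :=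
    fun i => (chartAt _ (f i)).open_source.measurableSet
  refine ⟨fun z => f (Nat.find (hz z)), ?_, ?_, ?_⟩
  · exact (countable_range f).mono (by rintro _ ⟨z, rfl⟩; exact ⟨_, rfl⟩)
  · intro p
    have : (fun z => f (Nat.find (hz z))) ⁻¹' {p} = ⋃ i ∈ {i | f i = p},
        ((chartAt (EuclideanSpace ℝ (Fin n)) (f i)).source \
          ⋃ j ∈ {j | j < i}, (chartAt (EuclideanSpace ℝ (Fin n)) (f j)).source) := by
      ext z
      simp only [mem_preimage, mem_singleton_iff, mem_iUnion, mem_ofPred_eq, Set.mem_sdiff,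
        not_exists, exists_prop, not_and]
      constructor
      · intro h
        exact ⟨_, h, Nat.find_spec (hz z), fun j hj => Nat.find_min (hz z) hj⟩
      · rintro ⟨i, hi, h1, h2⟩
        rw [(Nat.find_eq_iff (hz z)).2 ⟨h1, h2⟩, hi]
    rw [this]
    exact MeasurableSet.biUnion (to_countable _) fun i _ =>
      (hm i).diff (MeasurableSet.biUnion (to_countable _) fun j _ => hm j)
  · exact fun z => Nat.find_spec (hz z)

/-- A chosen chart selection; the integral of a form does not depend on it. -/
def chartSel : X → X := (exists_chartSelection n X).choose

/-- The measure on `X` that is, on each piece of the chart selection, Lebesgue measure in the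
coordinates of the selected chart. -/
def chartMeasure : Measure X :=
  Measure.sum fun p : X =>
    (((volume : Measure (EuclideanSpace ℝ (Fin n))).restrict (extChartAt (𝓡 n) p).target).map
      (extChartAt (𝓡 n) p).symm).restrict (chartSel n X ⁻¹' {p})

variable {n X}

/-- The coefficient `± ω(∂₁, …, ∂ₙ)` of a top form in the selected charts, with the sign of the
coordinate frame for the given orientation. -/
def density (o : ManifoldOrientation n X) (ω : Form n X n) (z : X) : ℂ :=
  let p := chartSel n X z
  let y := extChartAt (𝓡 n) p z
  (frameSign (o.orient ((extChartAt (𝓡 n) p).symm y)) (coordFrame (n := n) p y) : ℂ) *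
    inChart ω p y (fun i => EuclideanSpace.single i (1 : ℝ))

/-- Absolute integrability of a top form over `A`. -/
def FormIntegrableOn (o : ManifoldOrientation n X) (ω : Form n X n) (A : Set X) : Prop :=
  IntegrableOn (density o ω) A (chartMeasure n X)

/-- The integral `∫_A ω` of a top form on the oriented manifold `X`. -/
def formIntegral (o : ManifoldOrientation n X) (ω : Form n X n) (A : Set X) : ℂ :=
  ∫ z in A, density o ω z ∂(chartMeasure n X)

end Integral

section MorseBott

variable {n : ℕ} {X : Type*} [TopologicalSpace X] [ChartedSpace (EuclideanSpace ℝ (Fin n)) X]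

variable (n) in
/-- `Y` is a closed (embedded) submanifold of codimension `m`: it is closed, and near each of its
points it is given by the vanishing of the first `m` of `n` smooth coordinates. -/
def IsClosedSubmanifold (m : ℕ) (Y : Set X) : Prop :=
  m ≤ n ∧ IsClosed Y ∧ ∀ x ∈ Y, ∃ e ∈ IsManifold.maximalAtlas (𝓡 n) (⊤ : ℕ∞) X, x ∈ e.source ∧
    ∀ z ∈ e.source, z ∈ Y ↔ ∀ i : Fin n, (i : ℕ) < m → e z i = 0

variable (n) in
/-- The Hessian of `μ` at `x`, in the chart at `x`. -/
def hessian (μ : X → ℝ) (x : X) :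
    EuclideanSpace ℝ (Fin n) →L[ℝ] EuclideanSpace ℝ (Fin n) →L[ℝ] ℝ :=
  fderiv ℝ (fderiv ℝ (μ ∘ (extChartAt (𝓡 n) x).symm)) (extChartAt (𝓡 n) x x)

variable (n) in
/-- Nonnegative Morse--Bott functions with zero set `Y` of codimension `m`. -/
structure IsMorseBott (m : ℕ) (Y : Set X) (μ : X → ℝ) : Prop where
  smooth : ContMDiff (𝓡 n) 𝓘(ℝ, ℝ) (⊤ : ℕ∞) μ
  nonneg : ∀ x, 0 ≤ μ x
  zero_iff : ∀ x, μ x = 0 ↔ x ∈ Y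
  hessian_rank : ∀ x ∈ Y, Module.finrank ℝ (LinearMap.range (hessian n μ x).toLinearMap) = m

variable (n) in
/-- `μ'` is in the conformal class of `μ`: `μ' = f μ` with `f` smooth and everywhere positive. -/
def ConformallyEquivalent (μ μ' : X → ℝ) : Prop :=
  ∃ f : X → ℝ, ContMDiff (𝓡 n) 𝓘(ℝ, ℝ) (⊤ : ℕ∞) f ∧ (∀ x, 0 < f x) ∧ ∀ x, μ' x = f x * μ x

/-- `ω` is a smooth form on `X ∖ Y` such that `μ ^ N ω` extends to a smooth form on `X`. -/
def SingularOfOrder (Y : Set X) (μ : X → ℝ) (N : ℕ) {k : ℕ} (ω : Form n X k) : Prop :=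
  SmoothFormOn ω Yᶜ ∧
    ∃ η : Form n X k, SmoothFormOn η univ ∧ ∀ x ∉ Y, η x = μ x ^ N • ω x

/-- `ω ∈ 𝒜_μ^k(X)`. -/
def IsSingularForm (Y : Set X) (μ : X → ℝ) {k : ℕ} (ω : Form n X k) : Prop :=
  ∃ N : ℕ, SingularOfOrder Y μ N ω

/-- The support of the form `ω` on `X ∖ Y` has compact closure in `X`. -/
def RelCompactSupport (Y : Set X) {k : ℕ} (ω : Form n X k) : Prop :=
  IsCompact (closure {x : X | x ∉ Y ∧ ω x ≠ 0})

/-- The form `μ^{s/2} ω`. -/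
def powForm (μ : X → ℝ) (s : ℂ) {k : ℕ} (ω : Form n X k) : Form n X k :=
  fun x => ((μ x : ℂ) ^ (s / 2)) • ω x

/-- `F ε = ∑_{k=1}^K a_k ε^{-k} + L log (1/ε) + A + O(ε)` as `ε → 0⁺`. -/
def HasHadamardExpansion (F : ℝ → ℂ) (K : ℕ) (a : ℕ → ℂ) (L A : ℂ) : Prop :=
  (fun ε : ℝ => F ε -
    (∑ k ∈ Finset.Icc 1 K, a k * ((ε : ℂ) ^ k)⁻¹ + L * (Real.log (1 / ε) : ℂ) + A))
    =O[𝓝[>] (0 : ℝ)] (fun ε : ℝ => ε)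

variable [SecondCountableTopology X] [MeasurableSpace X] [BorelSpace X]

/-- The integral with cutoff `∫_{μ ≥ ε²} ω`. -/
def cutoffIntegral (o : ManifoldOrientation n X) (μ : X → ℝ) (ω : Form n X n) (ε : ℝ) : ℂ :=
  formIntegral o ω {x | ε ^ 2 ≤ μ x}

/-- `I_{-k}(μ, ω)` for `k ≥ 1`: the (unique) coefficient of `ε^{-k}` in the expansion of the
integral with cutoff. -/
def polarCoeff (o : ManifoldOrientation n X) (μ : X → ℝ) (ω : Form n X n) (k : ℕ) : ℂ :=
  Classical.epsilon fun b => ∃ K a L A,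
    HasHadamardExpansion (cutoffIntegral o μ ω) K a L A ∧ k ≤ K ∧ a k = b

/-- `I_0(μ, ω)`: the (unique) coefficient of `log (1/ε)`. -/
def logCoeff (o : ManifoldOrientation n X) (μ : X → ℝ) (ω : Form n X n) : ℂ :=
  Classical.epsilon fun L => ∃ K a A, HasHadamardExpansion (cutoffIntegral o μ ω) K a L A

/-- `I_finite(μ, ω)`, the Hadamard finite part: the (unique) constant term. -/
def finitePart (o : ManifoldOrientation n X) (μ : X → ℝ) (ω : Form n X n) : ℂ :=
  Classical.epsilon fun A => ∃ K a L, HasHadamardExpansion (cutoffIntegral o μ ω) K a L A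

end MorseBott

end HadamardReg

end

open HadamardReg

/-!
Why the theorem holds. By the Morse–Bott lemma (`exists_morse_chart`), near a point of `Y` there are
coordinates in which `μ` is the squared norm of the first `m` of them. In polar coordinates in these
`m` variables, a form `ω` of order `N` supported in such a chart becomes `r^{-a-1} q(r, v) dr dv` with
`a = 2N - m`, where `v` collects the direction and the remaining coordinates and `q` is smooth up to
`r = 0` (`exists_isPolarModel`). The average `h(r)` of `q(r, v)` over `v` is a smooth *even* function
of `r`, because `(r, θ)` and `(-r, -θ)` are the same point and the sphere is symmetric.

The regularization is now one-dimensional (`exists_hasMellinExpansion_of_even`). The zeta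
integral is the Mellin transform `∫_0^∞ r^{s-a-1} h(r) dr`, the integral with cutoff is
`∫_ε^∞ r^{-a-1} h(r) dr`, and subtracting from `h` its even Taylor polynomial, truncated to `(0, 1]`,
computes both: the Taylor coefficient of `r^{2j}` is the residue of the first at `s = a - 2j` and the
coefficient of `∫_ε^1 r^{2j-a-1} dr` in the second. The structure `HasMellinExpansion` records this
common description. It is additive, so a finite partition of unity on the support of `ω` makes it
global (`isRegularizable_of_singular`); the pieces of `ω` supported away from `Y` have an entire zeta
function. The coefficients of an expansion are unique (`HasHadamardExpansion.unique`), which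
identifies them with `polarCoeff`, `logCoeff` and `finitePart`.

For a conformal change (`finitePart_conformal`), write `(e^{2φ} μ)^{s/2} = e^{sφ} μ^{s/2}` and expand
`e^{sφ} = 1 + sφ + s² φ² ∫_0^1 (1 - τ) e^{τsφ} dτ`. The remainder contributes `s²` times an integral
of the same type with an additional exponential factor; integrating by parts in `r` continues it
past `0` with at most simple poles (`exists_continuation_radial`), so its contribution vanishes at
`s = 0`. There, the terms of order zero and one in `φ` give the invariance of the logarithmic
coefficient and the change of the finite part.

For exact forms (`finitePart_extD`), Stokes' theorem holds for `μ^{s/2} ψ` when `re s` is so large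
that this form is continuously differentiable across `Y`, and gives
`∫ μ^{s/2} dψ = -(s/2) ∫ μ^{s/2} dμ/μ ∧ ψ`. By continuation the same relation holds between the zeta
functions near `s = 0`: the left side is regular there, and its value is `-1/2` times the residue of
the integral on the right.
-/

/-! ### Integrals depending on a parameter -/

section ParamIntegral

set_option linter.unusedSectionVars false

variable {E V G : Type} [NormedAddCommGroup E] [NormedSpace ℝ E] [ProperSpace E]
  [NormedAddCommGroup V] [NormedSpace ℝ V] [MeasurableSpace V] [BorelSpace V]
  [SecondCountableTopology V] [NormedAddCommGroup G] [NormedSpace ℝ G]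
  {ν : Measure V} [IsFiniteMeasure ν] {C : Set V}

theorem integrable_of_continuous_of_compact (hC : IsCompact C) (hν : ∀ᵐ v ∂ν, v ∈ C)
    {f : V → G} (hf : Continuous f) : Integrable f ν := by
  obtain ⟨B, hB⟩ := hC.exists_bound_of_continuousOn hf.continuousOn
  refine Integrable.of_bound hf.aestronglyMeasurable B ?_
  filter_upwards [hν] with v hv using hB v hv

theorem hasFDerivAt_integral_of_contDiff (hC : IsCompact C) (hν : ∀ᵐ v ∂ν, v ∈ C)
    {H : E × V → G} (hH : ContDiff ℝ 1 H) (x : E) :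
    HasFDerivAt (fun x => ∫ v, H (x, v) ∂ν)
      (∫ v, (fderiv ℝ H (x, v)).comp (ContinuousLinearMap.inl ℝ E V) ∂ν) x := by
  have hc : Continuous fun p : E × V =>
      (fderiv ℝ H p).comp (ContinuousLinearMap.inl ℝ E V) :=
    (hH.continuous_fderiv one_ne_zero).clm_comp continuous_const
  obtain ⟨B, hB⟩ := ((isCompact_closedBall x 1).prod hC).exists_bound_of_continuousOn
    hc.continuousOn
  refine hasFDerivAt_integral_of_dominated_of_fderiv_le (s := Metric.ball x 1)
    (bound := fun _ => B) (μ := ν) (F := fun x v => H (x, v))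
    (F' := fun x v => (fderiv ℝ H (x, v)).comp (ContinuousLinearMap.inl ℝ E V))
    (Metric.ball_mem_nhds x one_pos) ?_ ?_ ?_ ?_ (integrable_const B) ?_
  · exact Eventually.of_forall fun y =>
      (hH.continuous.comp (by fun_prop : Continuous fun v : V => (y, v))).aestronglyMeasurable
  · exact integrable_of_continuous_of_compact hC hν
      (hH.continuous.comp (by fun_prop : Continuous fun v : V => (x, v)))
  · exact (hc.comp (by fun_prop : Continuous fun v : V => (x, v))).aestronglyMeasurable
  · filter_upwards [hν] with v hv y hy
    exact hB (y, v) ⟨Metric.ball_subset_closedBall hy, hv⟩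
  · refine Eventually.of_forall fun v y _ => ?_
    have h1 : HasFDerivAt H (fderiv ℝ H (y, v)) (y, v) :=
      (hH.differentiable one_ne_zero _).hasFDerivAt
    exact h1.comp y (hasFDerivAt_prodMk_left y v)

/-- Integrating a smooth function over a compactly supported finite measure in the second variable
gives a smooth function of the first one. -/
theorem contDiff_integral_right (hC : IsCompact C) (hν : ∀ᵐ v ∂ν, v ∈ C)
    {H : E × V → G} (hH : ContDiff ℝ (⊤ : ℕ∞) H) :
    ContDiff ℝ (⊤ : ℕ∞) (fun x => ∫ v, H (x, v) ∂ν) := by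
  rw [contDiff_infty]
  intro k
  induction k generalizing G with
  | zero =>
    have : Differentiable ℝ (fun x => ∫ v, H (x, v) ∂ν) := fun x =>
      (hasFDerivAt_integral_of_contDiff hC hν (hH.of_le (by simp)) x).differentiableAt
    simpa using this.continuous
  | succ k ih =>
    have h1 := hasFDerivAt_integral_of_contDiff hC hν (hH.of_le (by simp : (1 : WithTop ℕ∞) ≤ _))
    push_cast
    rw [contDiff_succ_iff_fderiv]
    refine ⟨fun x => (h1 x).differentiableAt, by simp, ?_⟩
    have h2 : fderiv ℝ (fun x => ∫ v, H (x, v) ∂ν) = fun x =>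
        ∫ v, (fderiv ℝ H (x, v)).comp (ContinuousLinearMap.inl ℝ E V) ∂ν :=
      funext fun x => (h1 x).fderiv
    rw [h2]
    exact ih (H := fun p => (fderiv ℝ H p).comp (ContinuousLinearMap.inl ℝ E V))
      ((hH.fderiv_right (m := (⊤ : ℕ∞)) (by simp)).clm_comp contDiff_const)

theorem hasDerivAt_integral_right (hC : IsCompact C) (hν : ∀ᵐ v ∂ν, v ∈ C)
    {H : ℝ × V → G} (hH : ContDiff ℝ 1 H) (x : ℝ) :
    HasDerivAt (fun x => ∫ v, H (x, v) ∂ν) (∫ v, fderiv ℝ H (x, v) (1, 0) ∂ν) x := by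
  have h := (hasFDerivAt_integral_of_contDiff hC hν hH x).hasDerivAt
  have hc : Continuous fun v : V =>
      (fderiv ℝ H (x, v)).comp (ContinuousLinearMap.inl ℝ ℝ V) :=
    ((hH.continuous_fderiv one_ne_zero).comp
      (by fun_prop : Continuous fun v : V => (x, v))).clm_comp continuous_const
  rw [ContinuousLinearMap.integral_apply (integrable_of_continuous_of_compact hC hν hc)] at h
  simpa using h

end ParamIntegral

section ExpIntegral

/-- A family of integrals `∫ e^{sL} q`, with `L` real-valued, is holomorphic on every open set of
parameters on which it converges absolutely. -/
theorem differentiableOn_integral_exp {Ω : Type*} [MeasurableSpace Ω] {ρ : Measure Ω}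
    {L : Ω → ℝ} {q : Ω → ℂ} (hL : AEMeasurable L ρ) {U : Set ℂ} (hU : IsOpen U)
    (hint : ∀ s ∈ U, Integrable (fun x => Complex.exp (s * L x) * q x) ρ) :
    DifferentiableOn ℂ (fun s => ∫ x, Complex.exp (s * L x) * q x ∂ρ) U := by
  intro s₀ hs₀
  obtain ⟨δ, hδ, hball⟩ := Metric.isOpen_iff.1 hU s₀ hs₀
  set η := δ / 4 with hη
  have hηpos : 0 < η := by positivity
  have hmem : ∀ t : ℝ, |t| < δ → s₀ + t ∈ U := fun t ht => hball (by simpa using ht)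
  have hp := (hint _ (hmem (2 * η) (by rw [abs_of_pos (by positivity)]; linarith))).norm
  have hm := (hint _ (hmem (-(2 * η)) (by rw [abs_neg, abs_of_pos (by positivity)]; linarith))).norm
  have hLc : AEStronglyMeasurable (fun x => (L x : ℂ)) ρ :=
    (Complex.measurable_ofReal.comp_aemeasurable hL).aestronglyMeasurable
  have key := hasDerivAt_integral_of_dominated_loc_of_deriv_le (μ := ρ) (𝕜 := ℂ)
    (F := fun s x => Complex.exp (s * L x) * q x)
    (F' := fun s x => L x * (Complex.exp (s * L x) * q x)) (x₀ := s₀)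
    (s := Metric.ball s₀ η)
    (bound := fun x => η⁻¹ * (‖Complex.exp ((s₀ + (2 * η : ℝ)) * L x) * q x‖ +
      ‖Complex.exp ((s₀ + (-(2 * η) : ℝ)) * L x) * q x‖)) (Metric.ball_mem_nhds s₀ hηpos)
    ?_ (hint s₀ hs₀) (hLc.mul (hint s₀ hs₀).aestronglyMeasurable) ?_
    ((hp.add hm).const_mul _) ?_
  · exact key.2.differentiableAt.differentiableWithinAt
  · filter_upwards [hU.mem_nhds hs₀] with s hs using (hint s hs).aestronglyMeasurable
  -- With `|L| ≤ η⁻¹ e^{η|L|}`, the derivative `L e^{sL} q` is dominated by the two integrands at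
  -- the real translates `s₀ ± 2η` of `s₀`.
  · refine Eventually.of_forall fun x s hs => ?_
    have hre : |(s - s₀).re| < η := (Complex.abs_re_le_norm _).trans_lt (by simpa [dist_eq_norm] using hs)
    simp only [norm_mul, Complex.norm_exp, Complex.norm_real, Real.norm_eq_abs, Complex.mul_re,
      Complex.ofReal_re, Complex.ofReal_im, mul_zero, sub_zero, Complex.add_re]
    rw [← add_mul, ← mul_assoc, ← mul_assoc]
    refine mul_le_mul_of_nonneg_right ?_ (norm_nonneg _)
    rw [Complex.sub_re] at hre
    have h1 : |L x| ≤ η⁻¹ * Real.exp (η * |L x|) := by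
      rw [inv_mul_eq_div, le_div_iff₀ hηpos]
      nlinarith [Real.add_one_le_exp (η * |L x|)]
    have h2 : s.re * L x ≤ s₀.re * L x + η * |L x| := by
      have : (s.re - s₀.re) * L x ≤ |s.re - s₀.re| * |L x| := by
        rw [← abs_mul]; exact le_abs_self _
      nlinarith [abs_nonneg (L x)]
    calc |L x| * Real.exp (s.re * L x)
        ≤ (η⁻¹ * Real.exp (η * |L x|)) * Real.exp (s₀.re * L x + η * |L x|) := by
          gcongr
      _ = η⁻¹ * Real.exp (s₀.re * L x + 2 * η * |L x|) := by
          rw [mul_assoc, ← Real.exp_add]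
          congr 2
          ring
      _ ≤ η⁻¹ * (Real.exp ((s₀.re + 2 * η) * L x) + Real.exp ((s₀.re + -(2 * η)) * L x)) := by
          gcongr
          rcases abs_cases (L x) with ⟨h, _⟩ | ⟨h, _⟩
          · rw [h, ← add_mul]
            linarith [Real.exp_pos ((s₀.re + -(2 * η)) * L x)]
          · rw [h, show s₀.re * L x + 2 * η * -L x = (s₀.re + -(2 * η)) * L x by ring]
            linarith [Real.exp_pos ((s₀.re + 2 * η) * L x)]
  · refine Eventually.of_forall fun x s _ => ?_
    have h1 : HasDerivAt (fun s : ℂ => Complex.exp (s * L x)) (Complex.exp (s * L x) * L x) s := by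
      simpa using ((hasDerivAt_id s).mul_const (L x : ℂ)).cexp
    exact (h1.mul_const (q x)).congr_deriv (by ring)

end ExpIntegral

/-! ### Uniqueness of Hadamard expansions -/

section HadamardUniqueness

theorem tendsto_pow_mul_log_inv (k : ℕ) :
    Tendsto (fun ε : ℝ => ((ε : ℂ) ^ (k + 1)) * (Real.log (1 / ε) : ℂ)) (𝓝[>] 0) (𝓝 0) := by
  have h1 : Tendsto (fun ε : ℝ => -(Real.log ε * ε ^ ((k + 1 : ℕ) : ℝ))) (𝓝[>] 0) (𝓝 0) := by
    simpa using (tendsto_log_mul_rpow_nhdsGT_zero (by positivity : (0 : ℝ) < (k + 1 : ℕ))).neg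
  have h2 := (Complex.continuous_ofReal.tendsto 0).comp h1
  rw [Complex.ofReal_zero] at h2
  refine h2.congr fun ε => ?_
  simp only [Function.comp_apply, Real.rpow_natCast, one_div, Real.log_inv]
  push_cast
  ring

/-- Multiplication by `ε ^ K` isolates the coefficient of the most singular term; the others follow by
induction on `K`, and the logarithm is removed last. -/
theorem hadamard_coeff_eq_zero (K : ℕ) (d : ℕ → ℂ) (l c : ℂ)
    (h : Tendsto (fun ε : ℝ => ∑ k ∈ Finset.Icc 1 K, d k * ((ε : ℂ) ^ k)⁻¹ +
      l * (Real.log (1 / ε) : ℂ) + c) (𝓝[>] 0) (𝓝 0)) :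
    (∀ k ∈ Finset.Icc 1 K, d k = 0) ∧ l = 0 ∧ c = 0 := by
  induction K with
  | zero =>
    simp only [Finset.Icc_eq_empty_of_lt (zero_lt_one' ℕ), Finset.sum_empty, zero_add] at h
    have hlog : Tendsto (fun ε : ℝ => Real.log (1 / ε)) (𝓝[>] 0) atTop := by
      refine (tendsto_neg_atBot_atTop.comp Real.tendsto_log_nhdsGT_zero).congr fun ε => ?_
      simp
    have hinv : Tendsto (fun ε : ℝ => ((Real.log (1 / ε))⁻¹ : ℂ)) (𝓝[>] 0) (𝓝 0) := by
      have := (Complex.continuous_ofReal.tendsto 0).comp (tendsto_inv_atTop_zero.comp hlog)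
      simpa [Function.comp_def] using this
    have hl : l = 0 := by
      have h3 : Tendsto (fun ε : ℝ => (l * (Real.log (1 / ε) : ℂ) + c) *
          ((Real.log (1 / ε))⁻¹ : ℂ) - c * ((Real.log (1 / ε))⁻¹ : ℂ)) (𝓝[>] 0) (𝓝 l) := by
        refine tendsto_const_nhds.congr' ?_
        filter_upwards [hlog.eventually_gt_atTop 0] with ε hε
        have : ((Real.log (1 / ε) : ℝ) : ℂ) ≠ 0 := by exact_mod_cast hε.ne'
        field_simp
        ring
      have h4 := (h.mul hinv).sub (hinv.const_mul c)
      simp only [mul_zero, sub_zero] at h4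
      exact tendsto_nhds_unique h3 h4
    refine ⟨by simp, hl, ?_⟩
    subst hl
    simp only [zero_mul, zero_add] at h
    exact tendsto_nhds_unique tendsto_const_nhds h
  | succ K ih =>
    have hpow : ∀ j : ℕ, Tendsto (fun ε : ℝ => (ε : ℂ) ^ (j + 1)) (𝓝[>] 0) (𝓝 0) := fun j => by
      have : Continuous fun ε : ℝ => (ε : ℂ) ^ (j + 1) := by fun_prop
      simpa using (this.tendsto 0).mono_left nhdsWithin_le_nhds
    have hd : d (K + 1) = 0 := by
      have h1 := (hpow K).mul h
      have h2 : Tendsto (fun ε : ℝ => ∑ k ∈ Finset.Icc 1 K, d k * (ε : ℂ) ^ (K - k + 1) + d (K + 1) +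
          l * ((ε : ℂ) ^ (K + 1) * (Real.log (1 / ε) : ℂ)) + (ε : ℂ) ^ (K + 1) * c)
          (𝓝[>] 0) (𝓝 (∑ k ∈ Finset.Icc 1 K, d k * 0 + d (K + 1) + l * 0 + 0 * c)) := by
        refine (((tendsto_finsetSum _ fun k _ => (hpow _).const_mul _).add
          tendsto_const_nhds).add ((tendsto_pow_mul_log_inv K).const_mul l)).add
          ((hpow K).mul_const c)
      simp only [mul_zero, Finset.sum_const_zero, zero_add, add_zero, zero_mul] at h1 h2
      refine tendsto_nhds_unique h2 (h1.congr' ?_)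
      filter_upwards [self_mem_nhdsWithin] with ε hε
      have hε' : (ε : ℂ) ≠ 0 := by exact_mod_cast (mem_Ioi.1 hε).ne'
      rw [Finset.sum_Icc_succ_top (by omega), mul_add, mul_add, mul_add, Finset.mul_sum]
      congr 1; congr 1; congr 1
      · refine Finset.sum_congr rfl fun k hk => ?_
        rw [Finset.mem_Icc] at hk
        rw [show K + 1 = (K - k + 1) + k by omega, pow_add]
        field_simp
      · field_simp
      · ring
    have h' := ih (h.congr fun ε => by
      rw [Finset.sum_Icc_succ_top (by omega), hd, zero_mul, add_zero])
    refine ⟨fun k hk => ?_, h'.2⟩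
    rw [Finset.mem_Icc] at hk
    rcases Nat.lt_or_ge K k with hlt | hge
    · rwa [show k = K + 1 by omega]
    · exact h'.1 k (Finset.mem_Icc.2 ⟨hk.1, hge⟩)

theorem sum_Icc_extend (K M : ℕ) (hKM : K ≤ M) (a g : ℕ → ℂ) :
    ∑ k ∈ Finset.Icc 1 K, a k * g k = ∑ k ∈ Finset.Icc 1 M, (if k ≤ K then a k else 0) * g k := by
  rw [← Finset.sum_subset (Finset.Icc_subset_Icc_right hKM)]
  · refine Finset.sum_congr rfl fun k hk => ?_
    rw [if_pos (Finset.mem_Icc.1 hk).2]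
  · intro k hk hk'
    rw [if_neg, zero_mul]
    intro h
    exact hk' (Finset.mem_Icc.2 ⟨(Finset.mem_Icc.1 hk).1, h⟩)

/-- The coefficients of a Hadamard expansion are determined by the function. -/
theorem HadamardReg.HasHadamardExpansion.unique {F : ℝ → ℂ} {K K' : ℕ} {a a' : ℕ → ℂ}
    {L L' A A' : ℂ} (h : HasHadamardExpansion F K a L A)
    (h' : HasHadamardExpansion F K' a' L' A') :
    L = L' ∧ A = A' ∧ ∀ k, 1 ≤ k → (if k ≤ K then a k else 0) = if k ≤ K' then a' k else 0 := by
  have hsub := h'.sub h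
  have hid : Tendsto (fun ε : ℝ => ε) (𝓝[>] 0) (𝓝 0) :=
    (continuous_id.tendsto (0 : ℝ)).mono_left nhdsWithin_le_nhds
  have ht := hsub.trans_tendsto hid
  have key := hadamard_coeff_eq_zero (max K K')
    (fun k => (if k ≤ K then a k else 0) - if k ≤ K' then a' k else 0) (L - L') (A - A')
    (ht.congr fun ε => by
      rw [sum_Icc_extend K (max K K') (le_max_left _ _) a,
        sum_Icc_extend K' (max K K') (le_max_right _ _) a']
      simp only [sub_mul, Finset.sum_sub_distrib]
      ring)
  refine ⟨sub_eq_zero.1 key.2.1, sub_eq_zero.1 key.2.2, fun k hk => ?_⟩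
  by_cases hkm : k ≤ max K K'
  · exact sub_eq_zero.1 (key.1 k (Finset.mem_Icc.2 ⟨hk, hkm⟩))
  · rw [if_neg (fun h => hkm (h.trans (le_max_left _ _))),
      if_neg (fun h => hkm (h.trans (le_max_right _ _)))]

variable {n : ℕ} {X : Type*} [TopologicalSpace X] [ChartedSpace (EuclideanSpace ℝ (Fin n)) X]
  [SecondCountableTopology X] [MeasurableSpace X] [BorelSpace X] {o : ManifoldOrientation n X}
  {μ : X → ℝ} {ω : Form n X n} {K : ℕ} {a : ℕ → ℂ} {L A : ℂ}

theorem HadamardReg.HasHadamardExpansion.logCoeff_eq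
    (h : HasHadamardExpansion (cutoffIntegral o μ ω) K a L A) : logCoeff o μ ω = L := by
  have hex : ∃ L K a A, HasHadamardExpansion (cutoffIntegral o μ ω) K a L A := ⟨L, K, a, A, h⟩
  obtain ⟨K', a', A', h'⟩ := Classical.epsilon_spec hex
  exact (h'.unique h).1

theorem HadamardReg.HasHadamardExpansion.finitePart_eq
    (h : HasHadamardExpansion (cutoffIntegral o μ ω) K a L A) : finitePart o μ ω = A := by
  have hex : ∃ A K a L, HasHadamardExpansion (cutoffIntegral o μ ω) K a L A := ⟨A, K, a, L, h⟩
  obtain ⟨K', a', A', h'⟩ := Classical.epsilon_spec hex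
  exact (h'.unique h).2.1

theorem HadamardReg.HasHadamardExpansion.polarCoeff_eq
    (h : HasHadamardExpansion (cutoffIntegral o μ ω) K a L A) {k : ℕ}
    (hk : k ∈ Finset.Icc 1 K) : polarCoeff o μ ω k = a k := by
  rw [Finset.mem_Icc] at hk
  have hex : ∃ b, ∃ K a L A, HasHadamardExpansion (cutoffIntegral o μ ω) K a L A ∧ k ≤ K ∧
    a k = b := ⟨a k, K, a, L, A, h, hk.2, rfl⟩
  obtain ⟨K', a', L', A', h', hk', hb⟩ := Classical.epsilon_spec hex
  have := (h'.unique h).2.2 k hk.1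
  rw [if_pos hk', if_pos hk.2] at this
  exact hb.symm.trans this

end HadamardUniqueness

/-! ### Even functions -/

section Division

/-- Hadamard's lemma on the line. -/
theorem exists_contDiff_eq_add_mul {h : ℝ → ℂ} (hh : ContDiff ℝ (⊤ : ℕ∞) h) :
    ∃ g : ℝ → ℂ, ContDiff ℝ (⊤ : ℕ∞) g ∧ (∀ r, h r = h 0 + r * g r) ∧ g 0 = deriv h 0 := by
  have hd : ContDiff ℝ (⊤ : ℕ∞) (deriv h) := (contDiff_infty_iff_deriv.1 hh).2
  refine ⟨fun r => ∫ t in Icc (0 : ℝ) 1, deriv h (r * t), ?_, fun r => ?_, ?_⟩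
  · exact contDiff_integral_right (E := ℝ) (V := ℝ) (H := fun p : ℝ × ℝ => deriv h (p.1 * p.2))
      (isCompact_Icc (a := (0 : ℝ)) (b := 1)) (ae_restrict_mem measurableSet_Icc)
      (hd.comp (contDiff_fst.mul contDiff_snd))
  · have := intervalIntegral.integral_unitInterval_deriv_eq_sub (𝕜 := ℝ) (f := h) (f' := deriv h) (z₀ := 0) (z₁ := r)
      (hd.continuous.comp (by fun_prop)).continuousOn
      (fun t _ => (hh.differentiable (by simp) _).hasDerivAt)
    simp only [zero_add, smul_eq_mul] at this
    beta_reduce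
    rw [integral_Icc_eq_integral_Ioc, ← intervalIntegral.integral_of_le zero_le_one]
    rw [Complex.real_smul] at this
    simp only [mul_comm r]
    rw [this]
    ring
  · simp

/-- Hadamard's lemma is applied twice; the linear term vanishes because `h` is even, and the quotient
is even again, so that the step can be iterated. -/
theorem exists_even_contDiff_eq_add_sq_mul {h : ℝ → ℂ} (hh : ContDiff ℝ (⊤ : ℕ∞) h)
    (heven : ∀ r, h (-r) = h r) :
    ∃ k : ℝ → ℂ, ContDiff ℝ (⊤ : ℕ∞) k ∧ (∀ r, k (-r) = k r) ∧
      ∀ r, h r = h 0 + (r : ℂ) ^ 2 * k r := by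
  obtain ⟨g, hg, hgh, hg0⟩ := exists_contDiff_eq_add_mul hh
  obtain ⟨k, hk, hkg, -⟩ := exists_contDiff_eq_add_mul hg
  have h0 : g 0 = 0 := by
    have h1 : deriv (fun r => h (-r)) 0 = -deriv h 0 := by
      rw [deriv_comp_neg, neg_zero]
    rw [funext heven, self_eq_neg] at h1
    rw [hg0, h1]
  have hr : ∀ r, h r = h 0 + (r : ℂ) ^ 2 * k r := fun r => by
    rw [hgh r, hkg r, h0]; ring
  refine ⟨k, hk, fun r => ?_, hr⟩
  rcases eq_or_ne r 0 with rfl | hne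
  · simp
  · have h1 := hr (-r)
    rw [heven, hr r] at h1
    have : (r : ℂ) ^ 2 ≠ 0 := by simpa using hne
    push_cast at h1
    rw [neg_sq] at h1
    exact (mul_left_cancel₀ this (add_left_cancel h1)).symm

/-- A smooth even function has an expansion in even powers with smooth remainders. -/
theorem exists_even_taylor {h : ℝ → ℂ} (hh : ContDiff ℝ (⊤ : ℕ∞) h) (heven : ∀ r, h (-r) = h r) :
    ∃ (c : ℕ → ℂ) (k : ℕ → ℝ → ℂ), (∀ K, Continuous (k K)) ∧
      ∀ K r, h r = ∑ j ∈ Finset.range K, c j * (r : ℂ) ^ (2 * j) + (r : ℂ) ^ (2 * K) * k K r := by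
  let S := {h : ℝ → ℂ // ContDiff ℝ (⊤ : ℕ∞) h ∧ ∀ r, h (-r) = h r}
  have hex : ∀ f : S, ∃ g : S, ∀ r, f.1 r = f.1 0 + (r : ℂ) ^ 2 * g.1 r := fun f => by
    obtain ⟨k, h1, h2, h3⟩ := exists_even_contDiff_eq_add_sq_mul f.2.1 f.2.2
    exact ⟨⟨k, h1, h2⟩, h3⟩
  choose next hnext using hex
  let k : ℕ → S := fun K => next^[K] ⟨h, hh, heven⟩
  refine ⟨fun j => (k j).1 0, fun K => (k K).1, fun K => (k K).2.1.continuous, fun K r => ?_⟩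
  induction K with
  | zero => simp [k]
  | succ K ih =>
    have h1 : k (K + 1) = next (k K) := Function.iterate_succ_apply' _ _ _
    have h2 : (k K).1 r = (k K).1 0 + (r : ℂ) ^ 2 * (k (K + 1)).1 r := by rw [h1]; exact hnext (k K) r
    beta_reduce at ih ⊢
    rw [Finset.sum_range_succ, ih, h2]
    ring

end Division

/-! ### Sums of Hadamard expansions -/

section HadamardAlgebra

theorem HadamardReg.HasHadamardExpansion.add {F F' : ℝ → ℂ} {K : ℕ} {a a' : ℕ → ℂ} {L L' A A' : ℂ}
    (h : HasHadamardExpansion F K a L A) (h' : HasHadamardExpansion F' K a' L' A') :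
    HasHadamardExpansion (fun ε => F ε + F' ε) K (fun k => a k + a' k) (L + L') (A + A') := by
  refine (IsBigO.add h h').congr_left fun ε => ?_
  simp only [add_mul, Finset.sum_add_distrib]
  ring

theorem HadamardReg.HasHadamardExpansion.congr {F F' : ℝ → ℂ} {K : ℕ} {a a' : ℕ → ℂ} {L A : ℂ}
    (h : HasHadamardExpansion F K a L A) (hF : F =ᶠ[𝓝[>] 0] F') (ha : ∀ k ∈ Finset.Icc 1 K, a k = a' k) :
    HasHadamardExpansion F' K a' L A := by
  refine IsBigO.congr' h ?_ EventuallyEq.rfl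
  filter_upwards [hF] with ε hε
  rw [hε, Finset.sum_congr rfl fun k hk => by rw [ha k hk]]

theorem hasHadamardExpansion_sum {ι : Type*} (t : Finset ι) {F : ι → ℝ → ℂ} {K : ℕ}
    {a : ι → ℕ → ℂ} {L A : ι → ℂ} (h : ∀ i ∈ t, HasHadamardExpansion (F i) K (a i) (L i) (A i)) :
    HasHadamardExpansion (fun ε => ∑ i ∈ t, F i ε) K (fun k => ∑ i ∈ t, a i k) (∑ i ∈ t, L i)
      (∑ i ∈ t, A i) := by
  classical
  induction t using Finset.induction_on with
  | empty => 
    refine IsBigO.congr_left (isBigO_zero _ _) fun ε => ?_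
    simp
  | insert i t hi ih =>
    simp only [Finset.sum_insert hi]
    exact (h i (Finset.mem_insert_self _ _)).add (ih fun j hj => h j (Finset.mem_insert_of_mem hj))

/-- The expansion of `c ∫_ε^1 r^{-k-1} dr`. -/
theorem hasHadamardExpansion_power (c : ℂ) (k : ℤ) (K : ℕ) (hk : k ≤ K) :
    HasHadamardExpansion (fun ε => c * ((∫ r in ε..1, r ^ (-k - 1) : ℝ) : ℂ)) K
      (fun i => if (i : ℤ) = k then c / i else 0) (if k = 0 then c else 0) (c / (0 - k)) := by
  have hpos : ∀ᶠ ε : ℝ in 𝓝[>] 0, ε ∈ Ioo (0 : ℝ) 1 := Ioo_mem_nhdsGT one_pos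
  rcases lt_trichotomy k 0 with hneg | rfl | hkpos
  · have h1 : (fun ε : ℝ => c / k * ((ε ^ (-k) : ℝ) : ℂ)) =O[𝓝[>] (0 : ℝ)] fun ε : ℝ => ε := by
      refine IsBigO.of_bound ‖c / k‖ ?_
      filter_upwards [hpos] with ε hε
      rw [norm_mul, Complex.norm_real, Real.norm_eq_abs, Real.norm_eq_abs]
      refine mul_le_mul_of_nonneg_left ?_ (norm_nonneg _)
      rw [abs_of_pos (zpow_pos hε.1 _), abs_of_pos hε.1]
      calc ε ^ (-k) ≤ ε ^ (1 : ℤ) := zpow_le_zpow_right_of_le_one₀ hε.1 hε.2.le (by omega)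
        _ = ε := zpow_one _
    refine h1.congr' ?_ EventuallyEq.rfl
    filter_upwards [hpos] with ε hε
    have hk0 : (k : ℂ) ≠ 0 := by exact_mod_cast hneg.ne
    rw [integral_zpow (Or.inl (by omega)), Finset.sum_eq_zero, if_neg hneg.ne]
    · push_cast
      rw [show -k - 1 + 1 = -k by ring, one_zpow]
      have : (-(k : ℂ) - 1 + 1) ≠ 0 := by simpa using hk0
      field_simp
      ring
    · intro i _
      rw [if_neg (by omega), zero_mul]
  · refine (isBigO_zero _ _).congr' ?_ EventuallyEq.rfl
    filter_upwards [hpos] with ε hε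
    have : ∫ r in ε..1, r ^ (-(0 : ℤ) - 1) = Real.log (1 / ε) := by
      rw [← integral_one_div_of_pos hε.1 one_pos]
      simp
    rw [this, Finset.sum_eq_zero]
    · simp
    · intro i hi
      rw [Finset.mem_Icc] at hi
      rw [if_neg (by omega), zero_mul]
  · refine (isBigO_zero _ _).congr' ?_ EventuallyEq.rfl
    filter_upwards [hpos] with ε hε
    lift k to ℕ using hkpos.le
    have hε' : (ε : ℂ) ≠ 0 := by exact_mod_cast hε.1.ne'
    have hk0 : (k : ℂ) ≠ 0 := by exact_mod_cast hkpos.ne'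
    rw [integral_zpow (Or.inr ⟨by omega, by simp [uIcc_of_le hε.2.le, hε.1]⟩),
      Finset.sum_eq_single k, if_pos rfl, if_neg hkpos.ne']
    · push_cast
      rw [show -(k : ℤ) - 1 + 1 = -k by ring, one_zpow, zpow_neg, zpow_natCast]
      have : (-(k : ℂ) - 1 + 1) ≠ 0 := by simpa using hk0
      field_simp
      ring
    · intro i _ hi
      rw [if_neg (by exact_mod_cast hi), zero_mul]
    · intro h
      exact absurd (Finset.mem_Icc.2 ⟨by omega, by omega⟩) h

end HadamardAlgebra

/-! ### Hadamard expansions and Mellin transforms -/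

section MellinExpansion

/-- The common analytic content of the two regularizations of `∫ ω`. The zeta integral `J`,
holomorphic for `re s > a`, continues with at most simple poles at `a - 2j`, of residue `b (a - 2j)`,
and the integral with cutoff `F` has the Hadamard expansion with coefficients `b k / k`, `b 0` and
`A`, where `A` is the value at `0` of the continuation of `J`, deprived of its polar term there.
In the formula for `A` the term with `a - 2j = 0` is a division by zero and hence drops out. -/
structure HasMellinExpansion (a : ℤ) (b : ℤ → ℂ) (A : ℂ) (J : ℂ → ℂ) (F : ℝ → ℂ) : Prop where
  supp : ∀ k, b k ≠ 0 → ∃ j : ℕ, k = a - 2 * j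
  cont : ∀ K : ℕ, ∃ G : ℂ → ℂ, DifferentiableOn ℂ G {s | (a : ℝ) - 2 * K < s.re} ∧
    (∀ s : ℂ, (a : ℝ) < s.re →
      J s = ∑ j ∈ Finset.range K, b (a - 2 * j) / (s - (a - 2 * j : ℤ)) + G s) ∧
    (a - 2 * K < 0 → A = ∑ j ∈ Finset.range K, b (a - 2 * j) / (0 - (a - 2 * j : ℤ)) + G 0)
  expansion : HasHadamardExpansion F a.toNat (fun k => b k / k) (b 0) A

theorem HasMellinExpansion.add {a : ℤ} {b b' : ℤ → ℂ} {A A' : ℂ} {J J' : ℂ → ℂ} {F F' : ℝ → ℂ}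
    (h : HasMellinExpansion a b A J F) (h' : HasMellinExpansion a b' A' J' F') :
    HasMellinExpansion a (fun k => b k + b' k) (A + A') (fun s => J s + J' s)
      (fun ε => F ε + F' ε) where
  supp k hk := by
    by_cases hb : b k = 0
    · exact h'.supp k fun hb' => hk (by simp [hb, hb'])
    · exact h.supp k hb
  cont K := by
    obtain ⟨G, hG, hJ, hA⟩ := h.cont K
    obtain ⟨G', hG', hJ', hA'⟩ := h'.cont K
    refine ⟨fun s => G s + G' s, hG.add hG', fun s hs => ?_, fun hK => ?_⟩
    · rw [hJ s hs, hJ' s hs]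
      simp only [add_div, Finset.sum_add_distrib]
      ring
    · rw [hA hK, hA' hK]
      simp only [add_div, Finset.sum_add_distrib]
      ring
  expansion := (h.expansion.add h'.expansion).congr EventuallyEq.rfl fun k _ => by ring

theorem HasMellinExpansion.zero (a : ℤ) : HasMellinExpansion a 0 0 0 0 where
  supp k hk := absurd rfl hk
  cont K := ⟨0, differentiableOn_const 0, fun s _ => by simp, fun _ => by simp⟩
  expansion := (isBigO_zero _ _).congr_left fun ε => by simp

theorem HasMellinExpansion.congr {a : ℤ} {b : ℤ → ℂ} {A : ℂ} {J J' : ℂ → ℂ} {F F' : ℝ → ℂ}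
    (h : HasMellinExpansion a b A J F) (hJ : ∀ s : ℂ, (a : ℝ) < s.re → J' s = J s)
    (hF : F =ᶠ[𝓝[>] 0] F') : HasMellinExpansion a b A J' F' where
  supp := h.supp
  cont K := by
    obtain ⟨G, hG, hJG, hA⟩ := h.cont K
    exact ⟨G, hG, fun s hs => by rw [hJ s hs, hJG s hs], hA⟩
  expansion := h.expansion.congr hF fun _ _ => rfl

/-- An entire zeta integral whose value at `0` is the eventual value of the integral with cutoff. -/
theorem HasMellinExpansion.of_entire {a : ℤ} {J : ℂ → ℂ} {F : ℝ → ℂ} (hJ : Differentiable ℂ J)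
    (hF : ∀ᶠ ε in 𝓝[>] 0, F ε = J 0) : HasMellinExpansion a 0 (J 0) J F where
  supp k hk := absurd rfl hk
  cont K := ⟨J, hJ.differentiableOn, fun s _ => by simp, fun _ => by simp⟩
  expansion := (isBigO_zero _ _).congr' (by
    filter_upwards [hF] with ε hε
    simp [hε]) EventuallyEq.rfl

theorem exists_hasMellinExpansion_sum {ι : Type*} (t : Finset ι) {a : ℤ} {J : ι → ℂ → ℂ}
    {F : ι → ℝ → ℂ} (h : ∀ i ∈ t, ∃ b A, HasMellinExpansion a b A (J i) (F i)) :
    ∃ b A, HasMellinExpansion a b A (fun s => ∑ i ∈ t, J i s) (fun ε => ∑ i ∈ t, F i ε) := by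
  classical
  induction t using Finset.induction_on with
  | empty => exact ⟨0, 0, by simpa using! HasMellinExpansion.zero a⟩
  | insert i t hi ih =>
    obtain ⟨b, A, h1⟩ := h i (Finset.mem_insert_self _ _)
    obtain ⟨b', A', h2⟩ := ih fun j hj => h j (Finset.mem_insert_of_mem hj)
    simp only [Finset.sum_insert hi]
    exact ⟨_, _, h1.add h2⟩

theorem indicator_pow_eq (p : ℕ) : (indicator (Ioc 0 1) (fun t : ℝ => (t : ℂ) ^ p)) =
    indicator (Ioc 0 1) (fun t : ℝ => (t : ℂ) ^ (p : ℂ)) := by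
  simp

/-- Subtracting from `h` its even Taylor polynomial, truncated to `(0, 1]`, leaves a remainder `g` whose
Mellin transform is holomorphic for `re z > -2K`; the subtracted terms contribute the simple
fractions `c j / (z + 2j)`. -/
theorem mellin_taylor_remainder {h : ℝ → ℂ} (hh : Continuous h) {R : ℝ} (hR : ∀ r, R ≤ r → h r = 0)
    {c : ℕ → ℂ} {k : ℕ → ℝ → ℂ} (hk : ∀ K, Continuous (k K))
    (hc : ∀ K r, h r = ∑ j ∈ Finset.range K, c j * (r : ℂ) ^ (2 * j) + (r : ℂ) ^ (2 * K) * k K r)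
    (K : ℕ) (g : ℝ → ℂ) (hg : g = fun r => h r - ∑ j ∈ Finset.range K,
      c j * indicator (Ioc 0 1) (fun t : ℝ => (t : ℂ) ^ (2 * j)) r) :
    (∀ z : ℂ, -(2 * K : ℝ) < z.re → MellinConvergent g z ∧ DifferentiableAt ℂ (mellin g) z) ∧
    (∀ z : ℂ, 0 < z.re → mellin h z = ∑ j ∈ Finset.range K, c j / (z + 2 * j) + mellin g z) ∧
    ∃ B : ℝ, ∀ r ∈ Ioc (0 : ℝ) 1, ‖g r‖ ≤ B * r ^ (2 * K) := by
  have hmain : ∀ K : ℕ, ∀ g : ℝ → ℂ, (g = fun r => h r - ∑ j ∈ Finset.range K,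
      c j * indicator (Ioc 0 1) (fun t : ℝ => (t : ℂ) ^ (2 * j)) r) →
      (∃ B : ℝ, ∀ r ∈ Ioc (0 : ℝ) 1, ‖g r‖ ≤ B * r ^ (2 * K)) ∧
      (∀ z : ℂ, -(2 * K : ℝ) < z.re → MellinConvergent g z ∧ DifferentiableAt ℂ (mellin g) z) := by
    intro K g hg
    have hbound : ∃ B : ℝ, ∀ r ∈ Ioc (0 : ℝ) 1, ‖g r‖ ≤ B * r ^ (2 * K) := by
      obtain ⟨B, hB⟩ := (isCompact_Icc (a := (0 : ℝ)) (b := 1)).exists_bound_of_continuousOn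
        (hk K).continuousOn
      refine ⟨B, fun r hr => ?_⟩
      have : g r = (r : ℂ) ^ (2 * K) * k K r := by
        rw [hg]
        simp only [indicator_of_mem hr]
        rw [hc K r]
        ring
      rw [this, norm_mul, norm_pow, Complex.norm_real, Real.norm_of_nonneg hr.1.le, mul_comm]
      exact mul_le_mul_of_nonneg_right (hB r ⟨hr.1.le, hr.2⟩) (pow_nonneg hr.1.le _)
    refine ⟨hbound, fun z hz => ?_⟩
    obtain ⟨B, hB⟩ := hbound
    have hloc : LocallyIntegrableOn g (Ioi 0) := by
      rw [hg]
      refine LocallyIntegrable.locallyIntegrableOn ?_ _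
      refine hh.locallyIntegrable.sub (locallyIntegrable_finsetSum _ fun j _ => ?_)
      refine Integrable.locallyIntegrable (Integrable.const_mul ?_ _)
      rw [integrable_indicator_iff measurableSet_Ioc]
      exact (Continuous.integrableOn_Icc (by fun_prop)).mono_set Ioc_subset_Icc_self
    have htop : g =O[atTop] fun r : ℝ => r ^ (-(z.re + 1)) := by
      refine (isBigO_zero _ _).congr' ?_ EventuallyEq.rfl
      filter_upwards [eventually_ge_atTop R, eventually_gt_atTop 1] with r hr hr1
      rw [hg]
      simp only
      rw [hR r hr, Finset.sum_eq_zero, sub_zero]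
      intro j _
      rw [indicator_of_notMem (fun h => absurd h.2 (not_le.2 hr1)), mul_zero]
    have hbot : g =O[𝓝[>] 0] fun r : ℝ => r ^ (-(-(2 * K : ℝ))) := by
      refine IsBigO.of_bound B ?_
      filter_upwards [Ioc_mem_nhdsGT one_pos] with r hr
      rw [neg_neg, show (2 * K : ℝ) = ((2 * K : ℕ) : ℝ) by push_cast; ring, Real.rpow_natCast,
        Real.norm_of_nonneg (pow_nonneg hr.1.le _)]
      exact hB r hr
    exact ⟨mellinConvergent_of_isBigO_rpow hloc htop (lt_add_one _) hbot hz,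
      mellin_differentiableAt_of_isBigO_rpow hloc htop (lt_add_one _) hbot hz⟩
  refine ⟨(hmain K g hg).2, ?_, (hmain K g hg).1⟩
  induction K generalizing g with
  | zero =>
    intro z _
    have : g = h := by rw [hg]; simp
    simp [this]
  | succ K ih =>
    intro z hz
    set g' : ℝ → ℂ := fun r => h r - ∑ j ∈ Finset.range K,
      c j * indicator (Ioc 0 1) (fun t : ℝ => (t : ℂ) ^ (2 * j)) r with hg'
    rw [ih g' rfl z hz, Finset.sum_range_succ, add_assoc]
    congr 1
    have hp := hasMellin_cpow_Ioc ((2 * K : ℕ) : ℂ) (s := z) (by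
      rw [Complex.natCast_re]; positivity)
    rw [← indicator_pow_eq] at hp
    have hz' : -(2 * K : ℝ) < z.re := by
      have : (0 : ℝ) ≤ 2 * K := by positivity
      linarith
    have h3 := (hasMellin_sub ((hmain K g' rfl).2 z hz').1 (hp.1.const_smul (c K))).2
    rw [mellin_const_smul, hp.2] at h3
    have h4 : g = fun t => g' t - c K • indicator (Ioc 0 1) (fun t : ℝ => (t : ℂ) ^ (2 * K)) t := by
      rw [hg, hg']
      funext r
      simp only [Finset.sum_range_succ, smul_eq_mul]
      ring
    rw [h4, h3, smul_eq_mul]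
    push_cast
    ring

end MellinExpansion

/-! ### The radial model -/

section MellinEven

/-- The part of the Mellin integral of the Taylor remainder that the cutoff `ε` removes is `O(ε)`, as
soon as the remainder compensates the singularity `r^{-a-1}`. -/
theorem norm_setIntegral_mellin_le {a : ℤ} {K : ℕ} (hK : a - 2 * K < 0) {g : ℝ → ℂ} {B : ℝ}
    (hB : ∀ r ∈ Ioc (0 : ℝ) 1, ‖g r‖ ≤ B * r ^ (2 * K)) {ε : ℝ} (hε : ε ∈ Ioo (0 : ℝ) 1) :
    ‖∫ r in Ioc 0 ε, (r : ℂ) ^ (-(a : ℂ) - 1) * g r‖ ≤ B * ε := by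
  have hB0 : 0 ≤ B := by
    have := (norm_nonneg _).trans (hB 1 ⟨one_pos, le_rfl⟩)
    simpa using this
  have hb : ∀ r ∈ Ioc 0 ε, ‖(r : ℂ) ^ (-(a : ℂ) - 1) * g r‖ ≤ B := by
    intro r hr
    have hr1 : r ≤ 1 := hr.2.trans hε.2.le
    have e1 : (-(a : ℂ) - 1) = ((-a - 1 : ℤ) : ℂ) := by push_cast; ring
    rw [norm_mul, e1, Complex.cpow_intCast, norm_zpow, Complex.norm_real,
      Real.norm_of_nonneg hr.1.le]
    calc r ^ (-a - 1) * ‖g r‖ ≤ r ^ (-a - 1) * (B * r ^ (2 * K)) :=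
          mul_le_mul_of_nonneg_left (hB r ⟨hr.1, hr1⟩) (zpow_nonneg hr.1.le _)
      _ = B * (r ^ (-a - 1) * r ^ ((2 * K : ℕ) : ℤ)) := by rw [zpow_natCast]; ring
      _ = B * r ^ (-a - 1 + (2 * K : ℕ) : ℤ) := by rw [zpow_add₀ hr.1.ne']
      _ ≤ B * 1 := by
          obtain ⟨i, hi⟩ := Int.eq_ofNat_of_zero_le
            (show 0 ≤ -a - 1 + ((2 * K : ℕ) : ℤ) by push_cast; omega)
          rw [hi, zpow_natCast]
          exact mul_le_mul_of_nonneg_left (pow_le_one₀ hr.1.le hr1) hB0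
      _ = B := mul_one B
  refine (norm_setIntegral_le_of_norm_le_const (by simp) hb).trans_eq ?_
  simp [hε.1.le]

theorem setIntegral_cpow_mul_indicator (a : ℤ) (j : ℕ) {ε : ℝ} (hε : ε ∈ Ioo (0 : ℝ) 1) :
    IntegrableOn (fun r : ℝ => (r : ℂ) ^ (-(a : ℂ) - 1) *
      indicator (Ioc 0 1) (fun t : ℝ => (t : ℂ) ^ (2 * j)) r) (Ioi ε) ∧
    ∫ r in Ioi ε, (r : ℂ) ^ (-(a : ℂ) - 1) *
      indicator (Ioc 0 1) (fun t : ℝ => (t : ℂ) ^ (2 * j)) r =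
      ((∫ r in ε..1, r ^ (-(a - 2 * j) - 1) : ℝ) : ℂ) := by
  have h1 : EqOn (fun r : ℝ => (r : ℂ) ^ (-(a : ℂ) - 1) *
      indicator (Ioc 0 1) (fun t : ℝ => (t : ℂ) ^ (2 * j)) r)
      (indicator (Ioc ε 1) fun r : ℝ => ((r ^ (-(a - 2 * j) - 1) : ℝ) : ℂ)) (Ioi ε) := by
    intro r hr
    have hr' : ε < r := hr
    have hr0 : 0 < r := hε.1.trans hr
    have e1 : (-(a : ℂ) - 1) = ((-a - 1 : ℤ) : ℂ) := by push_cast; ring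
    by_cases h : r ≤ 1
    · beta_reduce
      rw [indicator_of_mem (show r ∈ Ioc (0 : ℝ) 1 from ⟨hr0, h⟩),
        indicator_of_mem (show r ∈ Ioc ε 1 from ⟨hr', h⟩), e1, Complex.cpow_intCast,
        show -(a - 2 * j) - 1 = (-a - 1) + ((2 * j : ℕ) : ℤ) by push_cast; ring,
        zpow_add₀ hr0.ne', zpow_natCast]
      push_cast
      rfl
    · beta_reduce
      rw [indicator_of_notMem (fun hh => h hh.2), indicator_of_notMem (fun hh => h hh.2), mul_zero]
  have hint : IntegrableOn (fun r : ℝ => ((r ^ (-(a - 2 * j) - 1) : ℝ) : ℂ)) (Ioc ε 1) := by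
    refine IntegrableOn.mono_set (ContinuousOn.integrableOn_Icc (a := ε) (b := 1) ?_)
      Ioc_subset_Icc_self
    refine Complex.continuous_ofReal.comp_continuousOn (continuousOn_id.zpow₀ _ fun r hr => ?_)
    exact Or.inl (hε.1.trans_le hr.1).ne'
  constructor
  · refine IntegrableOn.congr_fun ?_ h1.symm measurableSet_Ioi
    exact ((integrable_indicator_iff measurableSet_Ioc).2 hint).integrableOn
  · rw [setIntegral_congr_fun measurableSet_Ioi h1, setIntegral_indicator measurableSet_Ioc,
      inter_eq_right.2 Ioc_subset_Ioi_self, integral_complex_ofReal,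
      intervalIntegral.integral_of_le hε.2.le]

/-- The Mellin transform and the truncated integrals of a smooth even function: the radial model
of the regularization. -/
theorem exists_hasMellinExpansion_of_even {h : ℝ → ℂ} (hh : ContDiff ℝ (⊤ : ℕ∞) h)
    (heven : ∀ r, h (-r) = h r) {R : ℝ} (hR : ∀ r, R ≤ r → h r = 0) (a : ℤ) :
    ∃ b A, HasMellinExpansion a b A (fun s => ∫ r in Ioi (0 : ℝ), (r : ℂ) ^ (s - a - 1) * h r)
      (fun ε => ∫ r in Ioi ε, (r : ℂ) ^ (-(a : ℂ) - 1) * h r) := by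
  classical
  obtain ⟨c, k, hk, hc⟩ := exists_even_taylor hh heven
  set g : ℕ → ℝ → ℂ := fun K r => h r - ∑ j ∈ Finset.range K,
      c j * indicator (Ioc 0 1) (fun t : ℝ => (t : ℂ) ^ (2 * j)) r with hg
  have hrem := fun K => mellin_taylor_remainder hh.continuous hR hk hc K (g K) rfl
  set b : ℤ → ℂ := fun i => if ∃ j : ℕ, i = a - 2 * j then c ((a - i) / 2).toNat else 0 with hb
  have hbj : ∀ j : ℕ, b (a - 2 * j) = c j := fun j => by
    simp only [hb]
    rw [if_pos ⟨j, rfl⟩]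
    congr 1
    omega
  have hexp : ∀ K : ℕ, a - 2 * K < 0 → HasHadamardExpansion
      (fun ε => ∫ r in Ioi ε, (r : ℂ) ^ (-(a : ℂ) - 1) * h r) a.toNat (fun k => b k / k) (b 0)
      (∑ j ∈ Finset.range K, b (a - 2 * j) / (0 - (a - 2 * j : ℤ)) + mellin (g K) (0 - a)) := by
    intro K hK
    obtain ⟨hconv, -, B, hB⟩ := hrem K
    have hz : -(2 * K : ℝ) < ((0 : ℂ) - a).re := by
      have : (a : ℝ) < 2 * K := by exact_mod_cast (by omega : a < 2 * K)
      simp only [Complex.sub_re, Complex.zero_re, Complex.intCast_re]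
      linarith
    have hmel : IntegrableOn (fun r : ℝ => (r : ℂ) ^ (-(a : ℂ) - 1) * g K r) (Ioi 0) := by
      have := (hconv _ hz).1
      rw [zero_sub] at this
      exact this
    have h1 : HasHadamardExpansion (fun ε => ∫ r in Ioi ε, (r : ℂ) ^ (-(a : ℂ) - 1) * g K r)
        a.toNat (fun _ => 0) 0 (mellin (g K) (0 - a)) := by
      refine IsBigO.of_bound B ?_
      filter_upwards [Ioo_mem_nhdsGT one_pos] with ε hε
      have hsplit : mellin (g K) (0 - a) = (∫ r in Ioc 0 ε, (r : ℂ) ^ (-(a : ℂ) - 1) * g K r) +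
          ∫ r in Ioi ε, (r : ℂ) ^ (-(a : ℂ) - 1) * g K r := by
        rw [← setIntegral_union (Ioc_disjoint_Ioi le_rfl) measurableSet_Ioi
          (hmel.mono_set Ioc_subset_Ioi_self) (hmel.mono_set (Ioi_subset_Ioi hε.1.le)),
          Ioc_union_Ioi_eq_Ioi hε.1.le, mellin, zero_sub]
        rfl
      rw [hsplit]
      simp only [zero_mul, Finset.sum_const_zero, zero_add, sub_add_cancel_right, norm_neg]
      rw [Real.norm_of_nonneg hε.1.le]
      exact norm_setIntegral_mellin_le hK hB hε
    have h2 := hasHadamardExpansion_sum (Finset.range K) (K := a.toNat) fun j _ =>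
      hasHadamardExpansion_power (c j) (a - 2 * j) a.toNat (by omega)
    have h3 := h1.add h2
    have hL : 0 + ∑ j ∈ Finset.range K, (if a - 2 * (j : ℤ) = 0 then c j else 0) = b 0 := by
      rw [zero_add]
      by_cases hex : ∃ j : ℕ, (0 : ℤ) = a - 2 * j
      · obtain ⟨j, hj⟩ := hex
        rw [Finset.sum_eq_single j, if_pos hj.symm, hj, hbj]
        · intro i _ hi
          rw [if_neg (by omega)]
        · intro hj'
          rw [Finset.mem_range] at hj'
          omega
      · have : b 0 = 0 := by simp only [hb]; rw [if_neg hex]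
        rw [this]
        refine Finset.sum_eq_zero fun j _ => if_neg fun hj => hex ⟨j, hj.symm⟩
    rw [hL] at h3
    have hA : mellin (g K) (0 - a) + ∑ j ∈ Finset.range K, c j / (0 - (a - 2 * (j : ℤ) : ℤ)) =
        ∑ j ∈ Finset.range K, b (a - 2 * j) / (0 - (a - 2 * j : ℤ)) + mellin (g K) (0 - a) := by
      rw [add_comm]
      simp only [hbj]
    rw [hA] at h3
    refine h3.congr ?_ ?_
    · filter_upwards [Ioo_mem_nhdsGT one_pos] with ε hε
      have e1 : ∀ j, c j * ((∫ r in ε..1, r ^ (-(a - 2 * (j : ℤ)) - 1) : ℝ) : ℂ) =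
          ∫ r in Ioi ε, c j * ((r : ℂ) ^ (-(a : ℂ) - 1) *
            indicator (Ioc 0 1) (fun t : ℝ => (t : ℂ) ^ (2 * j)) r) := fun j => by
        rw [← (setIntegral_cpow_mul_indicator a j hε).2, integral_const_mul]
      simp only [e1]
      rw [← integral_finsetSum _ fun j _ =>
          ((setIntegral_cpow_mul_indicator a j hε).1.integrable.const_mul _),
        ← integral_add (hmel.mono_set (Ioi_subset_Ioi hε.1.le)).integrable
          (integrable_finsetSum _ fun j _ =>
          ((setIntegral_cpow_mul_indicator a j hε).1.integrable.const_mul _))]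
      congr 1
      funext r
      simp only [hg, mul_sub, Finset.mul_sum, mul_left_comm (c _)]
      ring
    · intro i hi
      rw [Finset.mem_Icc] at hi
      rw [zero_add]
      by_cases hex : ∃ j : ℕ, (i : ℤ) = a - 2 * j
      · obtain ⟨j, hj⟩ := hex
        rw [Finset.sum_eq_single j, if_pos hj, hj, hbj]
        · intro i' _ hi'
          rw [if_neg (by omega)]
        · intro hj'
          rw [Finset.mem_range] at hj'
          omega
      · have : b i = 0 := by simp only [hb]; rw [if_neg hex]
        rw [this, zero_div]
        refine Finset.sum_eq_zero fun j _ => if_neg fun hj => hex ⟨j, hj⟩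
  have hK₀ : a - 2 * ((a.toNat + 1 : ℕ) : ℤ) < 0 := by omega
  refine ⟨b, _, ⟨fun i hi => ?_, fun K => ?_, hexp _ hK₀⟩⟩
  · by_contra hcon
    exact hi (by simp only [hb]; rw [if_neg hcon])
  · refine ⟨fun s => mellin (g K) (s - a), ?_, ?_, fun hK => ?_⟩
    · intro s hs
      have hs' : (a : ℝ) - 2 * K < s.re := hs
      have := ((hrem K).1 (s - a) (by
        simp only [Complex.sub_re, Complex.intCast_re]; linarith)).2
      exact (DifferentiableAt.comp (g := mellin (g K)) (f := fun s : ℂ => s - a) s this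
        (by fun_prop)).differentiableWithinAt
    · intro s hs
      have := (hrem K).2.1 (s - a) (by
        simp only [Complex.sub_re, Complex.intCast_re]; linarith)
      refine Eq.trans ?_ (this.trans ?_)
      · rfl
      · congr 1
        refine Finset.sum_congr rfl fun j _ => ?_
        rw [hbj]
        push_cast
        congr 1
        ring
    -- The constant term does not depend on `K`: every `K` with `a - 2K < 0` gives an expansion of the
    -- same function.
    · exact ((hexp _ hK₀).unique (hexp K hK)).2.1

end MellinEven

/-! ### Continuation by integration by parts -/

section IntegrationByParts

set_option linter.unusedSectionVars false

variable {V : Type} [NormedAddCommGroup V] [NormedSpace ℝ V] [MeasurableSpace V] [BorelSpace V]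
  [SecondCountableTopology V] {ν : Measure V} [IsFiniteMeasure ν] {C : Set V}

theorem ae_radial_prod (hν : ∀ᵐ v ∂ν, v ∈ C) :
    ∀ᵐ p ∂((volume.restrict (Ioi (0 : ℝ))).prod ν), 0 < p.1 ∧ p.2 ∈ C := by
  have h1 : ∀ᵐ p ∂((volume.restrict (Ioi (0 : ℝ))).prod ν), 0 < p.1 :=
    Measure.quasiMeasurePreserving_fst.ae (ae_restrict_mem measurableSet_Ioi)
  have h2 : ∀ᵐ p ∂((volume.restrict (Ioi (0 : ℝ))).prod ν), p.2 ∈ C :=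
    Measure.quasiMeasurePreserving_snd.ae hν
  filter_upwards [h1, h2] with p hp1 hp2 using ⟨hp1, hp2⟩

theorem integrable_cpow_mul (hC : IsCompact C) (hν : ∀ᵐ v ∂ν, v ∈ C) {f : ℝ × V → ℂ}
    (hf : Continuous f) {R : ℝ} (hR : ∀ r v, R < r → v ∈ C → f (r, v) = 0) {z : ℂ}
    (hz : 0 < z.re) :
    Integrable (fun p : ℝ × V => (p.1 : ℂ) ^ (z - 1) * f p)
      ((volume.restrict (Ioi (0 : ℝ))).prod ν) := by
  obtain ⟨B, hB⟩ := ((isCompact_Icc (a := (0 : ℝ)) (b := R)).prod hC).exists_bound_of_continuousOn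
    hf.continuousOn
  have hpow : Integrable ((Ioc 0 R).indicator fun r : ℝ => r ^ (z.re - 1))
      (volume.restrict (Ioi (0 : ℝ))) := by
    refine ((integrable_indicator_iff measurableSet_Ioc).2 ?_).restrict
    rcases le_or_gt R 0 with h | h
    · simp [Ioc_eq_empty_of_le h]
    · rw [← intervalIntegrable_iff_integrableOn_Ioc_of_le h.le]
      exact intervalIntegral.intervalIntegrable_rpow' (by linarith)
  refine Integrable.mono' (hpow.mul_prod (integrable_const (μ := ν) B)) ?_ ?_
  · refine AEStronglyMeasurable.mul ?_ hf.aestronglyMeasurable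
    exact (Measurable.pow_const (by fun_prop) _).aestronglyMeasurable
  · filter_upwards [ae_radial_prod hν] with p hp
    rw [norm_mul, Complex.norm_cpow_eq_rpow_re_of_pos hp.1, Complex.sub_re, Complex.one_re]
    by_cases h : p.1 ≤ R
    · rw [indicator_of_mem (show p.1 ∈ Ioc 0 R from ⟨hp.1, h⟩)]
      exact mul_le_mul_of_nonneg_left (hB p ⟨⟨hp.1.le, h⟩, hp.2⟩) (Real.rpow_nonneg hp.1.le _)
    · rw [show f p = 0 from hR p.1 p.2 (not_le.1 h) hp.2, norm_zero, mul_zero,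
        indicator_of_notMem (fun hh => h hh.2), zero_mul]

theorem radial_fubini (hC : IsCompact C) (hν : ∀ᵐ v ∂ν, v ∈ C) {f : ℝ × V → ℂ}
    (hf : Continuous f) {R : ℝ} (hR : ∀ r v, R < r → v ∈ C → f (r, v) = 0) {z : ℂ}
    (hz : 0 < z.re) :
    IntegrableOn (fun r : ℝ => (r : ℂ) ^ (z - 1) * ∫ v, f (r, v) ∂ν) (Ioi 0) ∧
    ∫ p : ℝ × V, (p.1 : ℂ) ^ (z - 1) * f p ∂((volume.restrict (Ioi (0 : ℝ))).prod ν) =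
      ∫ r in Ioi (0 : ℝ), (r : ℂ) ^ (z - 1) * ∫ v, f (r, v) ∂ν := by
  have hint := integrable_cpow_mul hC hν hf hR hz
  constructor
  · have := hint.integral_prod_left
    simp only [integral_const_mul] at this
    exact this
  · rw [integral_prod _ hint]
    simp only [integral_const_mul]

/-- Integration by parts for the Mellin transform; there is no boundary term at `0` since `re z > 0`. -/
theorem mul_integral_cpow_mul {h h' : ℝ → ℂ} (hd : ∀ r, HasDerivAt h (h' r) r) {R : ℝ}
    (hR : ∀ r, R < r → h r = 0) {z : ℂ} (hz : 0 < z.re)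
    (h1 : IntegrableOn (fun r : ℝ => (r : ℂ) ^ (z - 1) * h r) (Ioi 0))
    (h2 : IntegrableOn (fun r : ℝ => (r : ℂ) ^ z * h' r) (Ioi 0)) :
    z * ∫ r in Ioi (0 : ℝ), (r : ℂ) ^ (z - 1) * h r = -∫ r in Ioi (0 : ℝ), (r : ℂ) ^ z * h' r := by
  have hz0 : z ≠ 0 := fun h => by simp [h] at hz
  have hlim : Tendsto (fun r : ℝ => (r : ℂ) ^ z) (𝓝[>] 0) (𝓝 0) := by
    have := (Complex.continuousAt_ofReal_cpow_const 0 z (Or.inl hz)).tendsto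
    rw [Complex.ofReal_zero, Complex.zero_cpow hz0] at this
    exact this.mono_left nhdsWithin_le_nhds
  have key := integral_Ioi_mul_deriv_eq_deriv_mul (a := (0 : ℝ)) (a' := (0 : ℂ)) (b' := (0 : ℂ))
    (u := fun r : ℝ => (r : ℂ) ^ z) (u' := fun r : ℝ => z * (r : ℂ) ^ (z - 1)) (v := h) (v' := h')
    (fun r hr => hasDerivAt_ofReal_cpow_const (ne_of_gt hr) hz0)
    (fun r _ => hd r) h2 ?_ ?_ ?_
  · rw [key, sub_self, zero_sub, neg_neg, ← integral_const_mul]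
    simp only [mul_assoc]
  · have := h1.const_mul z
    simp only [← mul_assoc] at this
    exact this
  · have h0 := (hd 0).continuousAt.tendsto.mono_left (nhdsWithin_le_nhds (s := Ioi 0))
    have h3 := hlim.mul h0
    rwa [zero_mul] at h3
  · refine tendsto_const_nhds.congr' ?_
    filter_upwards [eventually_gt_atTop R] with r hr
    simp [hR r hr]

/-- Integrals over `(0, ∞) × V` continue meromorphically past their abscissa of convergence, also
when the integrand contains a factor `e^{sφ}`; one step to the left is one integration by parts in
the radial variable. -/
theorem exists_continuation_radial (hC : IsCompact C) (hν : ∀ᵐ v ∂ν, v ∈ C) {φ : ℝ × V → ℝ}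
    (hφ : ContDiff ℝ (⊤ : ℕ∞) φ) {R : ℝ} (K : ℕ) (a : ℤ) {q : ℝ × V → ℂ}
    (hq : ContDiff ℝ (⊤ : ℕ∞) q) (hR : ∀ r v, R < r → v ∈ C → q (r, v) = 0) :
    ∃ G : ℂ → ℂ, DifferentiableOn ℂ G {s | (a : ℝ) - K < s.re} ∧ ∀ s : ℂ, (a : ℝ) < s.re →
      G s = (∏ j ∈ Finset.range K, (s - a + j)) *
        ∫ r in Ioi (0 : ℝ), (r : ℂ) ^ (s - a - 1) * ∫ v, Complex.exp (s * φ (r, v)) * q (r, v) ∂ν := by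
  have hE : ∀ s : ℂ, ContDiff ℝ (⊤ : ℕ∞) fun p => Complex.exp (s * φ p) := fun s =>
    (contDiff_const.mul (Complex.ofRealCLM.contDiff.comp hφ)).cexp
  have hint : ∀ (a : ℤ) (q : ℝ × V → ℂ), Continuous q →
      (∀ r v, R < r → v ∈ C → q (r, v) = 0) → ∀ s : ℂ, (a : ℝ) < s.re →
      Integrable (fun p : ℝ × V => (p.1 : ℂ) ^ (s - a - 1) * (Complex.exp (s * φ p) * q p))
      ((volume.restrict (Ioi (0 : ℝ))).prod ν) := fun a q hq hR s hs =>
    integrable_cpow_mul hC hν ((hE s).continuous.mul hq) (R := R)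
      (fun r v hr hv => by simp [hR r v hr hv])
      (by simp only [Complex.sub_re, Complex.intCast_re]; linarith)
  have hz0 : ∀ (a : ℤ) (s : ℂ), (a : ℝ) < s.re → 0 < (s - a).re := fun a s hs => by
    simp only [Complex.sub_re, Complex.intCast_re]; linarith
  have hfub := fun (a : ℤ) (q : ℝ × V → ℂ) (hq : Continuous q)
    (hR : ∀ r v, R < r → v ∈ C → q (r, v) = 0) (s : ℂ) (hs : (a : ℝ) < s.re) =>
    (radial_fubini hC hν ((hE s).continuous.mul hq) (R := R)
      (fun r v hr hv => by simp [hR r v hr hv]) (hz0 a s hs)).2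
  have hfub' := fun (a : ℤ) (q : ℝ × V → ℂ) (hq : Continuous q)
    (hR : ∀ r v, R < r → v ∈ C → q (r, v) = 0) (s : ℂ) (hs : (a : ℝ) < s.re) =>
    (radial_fubini hC hν ((hE s).continuous.mul hq) (R := R)
      (fun r v hr hv => by simp [hR r v hr hv]) (hz0 a s hs)).1
  simp only [Pi.mul_apply] at hfub hfub'
  have hexp : ∀ (a : ℤ) (q : ℝ × V → ℂ) (s : ℂ) (p : ℝ × V), 0 < p.1 →
      (p.1 : ℂ) ^ (s - a - 1) * (Complex.exp (s * φ p) * q p) =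
      Complex.exp (s * (Real.log p.1 + φ p : ℝ)) * ((p.1 : ℂ) ^ (-(a : ℂ) - 1) * q p) := by
    intro a q s p hp
    have hp' : (p.1 : ℂ) ≠ 0 := by exact_mod_cast hp.ne'
    rw [Complex.cpow_def_of_ne_zero hp', Complex.cpow_def_of_ne_zero hp', ← mul_assoc, ← mul_assoc,
      ← Complex.exp_add, ← Complex.exp_add, ← Complex.ofReal_log hp.le]
    congr 2
    push_cast
    ring
  induction K generalizing a q with
  | zero =>
    refine ⟨fun s => ∫ r in Ioi (0 : ℝ), (r : ℂ) ^ (s - a - 1) *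
      ∫ v, Complex.exp (s * φ (r, v)) * q (r, v) ∂ν, ?_, fun s _ => by simp⟩
    rw [Nat.cast_zero, sub_zero]
    -- `rˢ e^{sφ} = e^{sL}` with `L = log r + φ` real
    have h1 : DifferentiableOn ℂ (fun s : ℂ => ∫ p, Complex.exp (s * (Real.log p.1 + φ p : ℝ)) *
        ((p.1 : ℂ) ^ (-(a : ℂ) - 1) * q p) ∂((volume.restrict (Ioi (0 : ℝ))).prod ν))
        {s : ℂ | (a : ℝ) < s.re} := by
      refine differentiableOn_integral_exp ?_ (isOpen_lt continuous_const Complex.continuous_re) ?_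
      · exact ((Real.measurable_log.comp measurable_fst).add hφ.continuous.measurable).aemeasurable
      · intro s hs
        refine (hint a q hq.continuous hR s hs).congr ?_
        filter_upwards [ae_radial_prod hν] with p hp
        exact hexp a q s p hp.1
    refine h1.congr fun s hs => ?_
    rw [← hfub a q hq.continuous hR s hs]
    refine integral_congr_ae ?_
    filter_upwards [ae_radial_prod hν] with p hp
    exact hexp a q s p hp.1
  | succ K ih =>
    -- The radial derivative of `e^{sφ} q` is `e^{sφ} (q₁ + s q₂)`, with `q₁` and `q₂` as smooth as `q`;
    -- the induction hypothesis applies to both, with `a - 1` for `a`.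
    set q₁ : ℝ × V → ℂ := fun p => fderiv ℝ q p (1, 0) with hq₁
    set q₂ : ℝ × V → ℂ := fun p => (fderiv ℝ φ p (1, 0) : ℝ) * q p with hq₂
    have hq₁s : ContDiff ℝ (⊤ : ℕ∞) q₁ :=
      (hq.fderiv_right (m := (⊤ : ℕ∞)) (by simp)).clm_apply contDiff_const
    have hq₂s : ContDiff ℝ (⊤ : ℕ∞) q₂ :=
      (Complex.ofRealCLM.contDiff.comp
        ((hφ.fderiv_right (m := (⊤ : ℕ∞)) (by simp)).clm_apply contDiff_const)).mul hq
    have hR₁ : ∀ r v, R < r → v ∈ C → q₁ (r, v) = 0 := by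
      intro r v hr hv
      have hd1 : HasDerivAt (fun t : ℝ => q (t, v)) (q₁ (r, v)) r := by
        have h1 := (hq.differentiable (by simp) (r, v)).hasFDerivAt
        exact h1.comp_hasDerivAt r ((hasDerivAt_id r).prodMk (hasDerivAt_const r v))
      have hd2 : HasDerivAt (fun t : ℝ => q (t, v)) 0 r := by
        refine (hasDerivAt_const r (0 : ℂ)).congr_of_eventuallyEq ?_
        filter_upwards [lt_mem_nhds hr] with t ht using hR t v ht hv
      exact hd1.unique hd2
    have hR₂ : ∀ r v, R < r → v ∈ C → q₂ (r, v) = 0 := fun r v hr hv => by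
      simp [hq₂, hR r v hr hv]
    obtain ⟨G₁, hG₁, hJ₁⟩ := ih (a - 1) hq₁s hR₁
    obtain ⟨G₂, hG₂, hJ₂⟩ := ih (a - 1) hq₂s hR₂
    have hset : {s : ℂ | (a : ℝ) - (K + 1 : ℕ) < s.re} = {s : ℂ | ((a - 1 : ℤ) : ℝ) - K < s.re} := by
      ext s
      push_cast
      simp only [mem_ofPred_eq]
      constructor <;> intro h <;> linarith
    refine ⟨fun s => -(G₁ s + s * G₂ s), ?_, fun s hs => ?_⟩
    · rw [hset]
      exact (hG₁.add (differentiableOn_id.mul hG₂)).neg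
    · have hs' : ((a - 1 : ℤ) : ℝ) < s.re := by push_cast; linarith
      have hderiv : ∀ r, HasDerivAt (fun r => ∫ v, Complex.exp (s * φ (r, v)) * q (r, v) ∂ν)
          ((∫ v, Complex.exp (s * φ (r, v)) * q₁ (r, v) ∂ν) +
            s * ∫ v, Complex.exp (s * φ (r, v)) * q₂ (r, v) ∂ν) r := by
        intro r
        have h1 := hasDerivAt_integral_right hC hν
          (((hE s).mul hq).of_le (by simp : (1 : WithTop ℕ∞) ≤ (⊤ : ℕ∞))) r
        refine h1.congr_deriv (Eq.symm ?_)
        rw [← integral_const_mul, ← integral_add]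
        · refine integral_congr_ae (Eventually.of_forall fun v => ?_)
          have e1 : HasFDerivAt q (fderiv ℝ q (r, v)) (r, v) :=
            (hq.differentiable (by simp) _).hasFDerivAt
          have e2 : HasFDerivAt φ (fderiv ℝ φ (r, v)) (r, v) :=
            (hφ.differentiable (by simp) _).hasFDerivAt
          have e3 : HasFDerivAt (fun p => ((φ p : ℝ) : ℂ))
            (Complex.ofRealCLM.comp (fderiv ℝ φ (r, v))) (r, v) := Complex.ofRealCLM.hasFDerivAt.comp _ e2
          have e4 : fderiv ℝ (fun x => Complex.exp (s * φ x) * q x) (r, v) = _ := ((e3.const_mul s).cexp.mul e1).fderiv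
          beta_reduce
          rw [e4]
          simp [hq₁, hq₂]
          ring
        · exact integrable_of_continuous_of_compact hC hν
            (((hE s).continuous.mul hq₁s.continuous).comp (by fun_prop : Continuous fun v => (r, v)))
        · exact (integrable_of_continuous_of_compact hC hν
            (((hE s).continuous.mul hq₂s.continuous).comp
              (by fun_prop : Continuous fun v => (r, v)))).const_mul s
      have hz : 0 < (s - a).re := by simp only [Complex.sub_re, Complex.intCast_re]; linarith
      have e0 : s - ((a - 1 : ℤ) : ℂ) - 1 = s - a := by push_cast; ring
      have i₁ := (hfub' (a - 1) q₁ hq₁s.continuous hR₁ s hs')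
      have i₂ := (hfub' (a - 1) q₂ hq₂s.continuous hR₂ s hs')
      rw [e0] at i₁ i₂
      have hsum : IntegrableOn (fun r : ℝ => (r : ℂ) ^ (s - a) *
          ((∫ v, Complex.exp (s * φ (r, v)) * q₁ (r, v) ∂ν) +
            s * ∫ v, Complex.exp (s * φ (r, v)) * q₂ (r, v) ∂ν)) (Ioi 0) := by
        refine (i₁.add (i₂.const_mul s)).congr (Eventually.of_forall fun r => ?_)
        simp only [Pi.add_apply]
        ring
      have hvan : ∀ r, R < r → ∫ v, Complex.exp (s * φ (r, v)) * q (r, v) ∂ν = 0 := by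
        intro r hr
        refine integral_eq_zero_of_ae ?_
        filter_upwards [hν] with v hv
        simp [hR r v hr hv]
      have hibp := mul_integral_cpow_mul hderiv hvan hz (hfub' a q hq.continuous hR s hs) hsum
      beta_reduce
      rw [Finset.prod_range_succ', hJ₁ s hs', hJ₂ s hs', e0]
      have e5 : ∏ j ∈ Finset.range K, (s - a + ((j + 1 : ℕ) : ℂ)) =
          ∏ j ∈ Finset.range K, (s - ((a - 1 : ℤ) : ℂ) + j) :=
        Finset.prod_congr rfl fun j _ => by push_cast; ring
      rw [e5, Nat.cast_zero, add_zero, mul_assoc, hibp]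
      have e6 : ∫ r in Ioi (0 : ℝ), (r : ℂ) ^ (s - a) *
          ((∫ v, Complex.exp (s * φ (r, v)) * q₁ (r, v) ∂ν) +
            s * ∫ v, Complex.exp (s * φ (r, v)) * q₂ (r, v) ∂ν) =
          (∫ r in Ioi (0 : ℝ), (r : ℂ) ^ (s - a) * ∫ v, Complex.exp (s * φ (r, v)) * q₁ (r, v) ∂ν) +
          s * ∫ r in Ioi (0 : ℝ), (r : ℂ) ^ (s - a) *
            ∫ v, Complex.exp (s * φ (r, v)) * q₂ (r, v) ∂ν := by
        rw [← integral_const_mul, ← integral_add i₁ (i₂.const_mul s)]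
        refine integral_congr_ae (Eventually.of_forall fun r => ?_)
        beta_reduce
        ring
      rw [e6]
      ring

end IntegrationByParts

/-! ### The continued zeta function -/

section Continuation

theorem eqOn_halfPlane {f g : ℂ → ℂ} {c d : ℝ} (hf : DifferentiableOn ℂ f {s | c < s.re})
    (hg : DifferentiableOn ℂ g {s | c < s.re}) (h : ∀ s : ℂ, d < s.re → f s = g s) :
    ∀ s : ℂ, c < s.re → f s = g s := by
  have ho : IsOpen {s : ℂ | c < s.re} := isOpen_lt continuous_const Complex.continuous_re
  have hp : IsPreconnected {s : ℂ | c < s.re} := (convex_halfSpace_re_gt c).isPreconnected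
  refine (hf.analyticOnNhd ho).eqOn_of_preconnected_of_eventuallyEq (hg.analyticOnNhd ho) hp
    (z₀ := ((max c d + 1 : ℝ) : ℂ)) ?_ ?_
  · simp only [mem_ofPred_eq, Complex.ofReal_re]
    linarith [le_max_left c d]
  · have : {s : ℂ | d < s.re} ∈ 𝓝 ((max c d + 1 : ℝ) : ℂ) :=
      (isOpen_lt continuous_const Complex.continuous_re).mem_nhds (by
        simp only [mem_ofPred_eq, Complex.ofReal_re]
        linarith [le_max_right c d])
    filter_upwards [this] with s hs using h s hs

theorem differentiableAt_const_div_sub {b p s : ℂ} (h : s - p ≠ 0) :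
    DifferentiableAt ℂ (fun s => b / (s - p)) s :=
  DifferentiableAt.fun_div (differentiableAt_const _) (differentiableAt_fun_id.sub_const p) h

theorem meromorphicAt_const_div_sub {b p s : ℂ} : MeromorphicAt (fun s => b / (s - p)) s := by
  fun_prop

/-- `ζ` continues `J`, with principal parts `b (a - 2j) / (s - (a - 2j))` and constant term `A` at
`0`. -/
structure IsZetaContinuation (a : ℤ) (b : ℤ → ℂ) (A : ℂ) (J ζ : ℂ → ℂ) : Prop where
  supp : ∀ k, b k ≠ 0 → ∃ j : ℕ, k = a - 2 * j
  eq : ∀ s : ℂ, (a : ℝ) < s.re → ζ s = J s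
  cont : ∀ K : ℕ, ∃ G : ℂ → ℂ, DifferentiableOn ℂ G {s | (a : ℝ) - 2 * K < s.re} ∧
    (∀ s : ℂ, (a : ℝ) - 2 * K < s.re →
      ζ s = ∑ j ∈ Finset.range K, b (a - 2 * j) / (s - (a - 2 * j : ℤ)) + G s) ∧
    (a - 2 * K < 0 → A = ∑ j ∈ Finset.range K, b (a - 2 * j) / (0 - (a - 2 * j : ℤ)) + G 0)

/-- The continuations to the half-planes `re s > a - 2K` agree where two of them are defined, hence
glue to a function on `ℂ`. -/
theorem HasMellinExpansion.exists_zeta {a : ℤ} {b : ℤ → ℂ} {A : ℂ} {J : ℂ → ℂ} {F : ℝ → ℂ}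
    (h : HasMellinExpansion a b A J F) : ∃ ζ, IsZetaContinuation a b A J ζ := by
  choose G hG hJ hA using h.cont
  have hK : ∀ s : ℂ, ∃ K : ℕ, (a : ℝ) - 2 * K < s.re := fun s => by
    obtain ⟨K, hK⟩ := exists_nat_gt (((a : ℝ) - s.re) / 2)
    exact ⟨K, by linarith⟩
  -- At `s`, the continuation to any half-plane containing `s` is used. At a pole its value is a
  -- junk value, the same for all of them.
  choose κ hκ using hK
  set Z : ℕ → ℂ → ℂ := fun K s =>
    ∑ j ∈ Finset.range K, b (a - 2 * j) / (s - (a - 2 * j : ℤ)) + G K s with hZ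
  have hcons : ∀ K K' : ℕ, K ≤ K' → ∀ s : ℂ, (a : ℝ) - 2 * K < s.re → Z K s = Z K' s := by
    intro K K' hKK' s hs
    have hle : (K : ℝ) ≤ K' := by exact_mod_cast hKK'
    have key := eqOn_halfPlane (c := (a : ℝ) - 2 * K) (d := a) (f := G K)
      (g := fun s => ∑ j ∈ Finset.Ico K K', b (a - 2 * j) / (s - (a - 2 * j : ℤ)) + G K' s)
      (hG K) ?_ ?_ s hs
    · simp only [hZ]
      rw [key, ← add_assoc, Finset.sum_range_add_sum_Ico _ hKK']
    · refine DifferentiableOn.add ?_ ((hG K').mono fun s hs => ?_)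
      · refine DifferentiableOn.fun_sum fun j hj s hs => ?_
        have hj' : (K : ℝ) ≤ j := by exact_mod_cast (Finset.mem_Ico.1 hj).1
        have hne : s - ((a - 2 * j : ℤ) : ℂ) ≠ 0 := by
          intro h0
          have h1 := congrArg Complex.re h0
          simp only [Complex.sub_re, Complex.intCast_re, Complex.zero_re] at h1
          push_cast at h1
          have hs' : (a : ℝ) - 2 * K < s.re := hs
          linarith
        exact (differentiableAt_const_div_sub hne).differentiableWithinAt
      · have hs' : (a : ℝ) - 2 * K < s.re := hs
        simp only [mem_ofPred_eq]
        linarith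
    · intro s hs
      have h1 := (hJ K s hs).symm.trans (hJ K' s hs)
      rw [← Finset.sum_range_add_sum_Ico _ hKK', add_assoc] at h1
      exact add_left_cancel h1
  have hall : ∀ (K : ℕ) (s : ℂ), (a : ℝ) - 2 * K < s.re → Z (κ s) s = Z K s := by
    intro K s hs
    rcases le_total K (κ s) with hle | hle
    · exact (hcons K (κ s) hle s hs).symm
    · exact hcons (κ s) K hle s (hκ s)
  refine ⟨fun s => Z (κ s) s, h.supp, fun s hs => ?_, fun K => ⟨G K, hG K, fun s hs => hall K s hs, hA K⟩⟩
  exact (hJ _ s hs).symm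

variable {a : ℤ} {b : ℤ → ℂ} {A : ℂ} {J ζ : ℂ → ℂ}

theorem intPole_ne {s : ℂ} {a : ℤ} {j : ℕ} (h : s ≠ (a : ℂ) - 2 * j) :
    s - ((a - 2 * j : ℤ) : ℂ) ≠ 0 := by
  push_cast
  exact sub_ne_zero.2 h

theorem IsZetaContinuation.analyticAt (h : IsZetaContinuation a b A J ζ) {s₀ : ℂ}
    (hs₀ : ∀ j : ℕ, s₀ ≠ (a : ℂ) - 2 * j) : AnalyticAt ℂ ζ s₀ := by
  obtain ⟨K, hK⟩ := exists_nat_gt (((a : ℝ) - s₀.re) / 2)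
  have hK' : (a : ℝ) - 2 * K < s₀.re := by linarith
  obtain ⟨G, hG, hζ, -⟩ := h.cont K
  have ho : IsOpen {s : ℂ | (a : ℝ) - 2 * K < s.re} :=
    isOpen_lt continuous_const Complex.continuous_re
  have h1 : AnalyticAt ℂ (fun s : ℂ =>
      ∑ j ∈ Finset.range K, b (a - 2 * j) / (s - (a - 2 * j : ℤ)) + G s) s₀ := by
    refine AnalyticAt.add (Finset.analyticAt_fun_sum _ fun j _ => ?_) (hG.analyticAt (ho.mem_nhds hK'))
    exact analyticAt_const.div (analyticAt_id.sub analyticAt_const) (intPole_ne (hs₀ j))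
  refine h1.congr ?_
  filter_upwards [ho.mem_nhds hK'] with s hs using (hζ s hs).symm

theorem IsZetaContinuation.meromorphicAt (h : IsZetaContinuation a b A J ζ) (s₀ : ℂ) :
    MeromorphicAt ζ s₀ := by
  obtain ⟨K, hK⟩ := exists_nat_gt (((a : ℝ) - s₀.re) / 2)
  have hK' : (a : ℝ) - 2 * K < s₀.re := by linarith
  obtain ⟨G, hG, hζ, -⟩ := h.cont K
  have ho : IsOpen {s : ℂ | (a : ℝ) - 2 * K < s.re} :=
    isOpen_lt continuous_const Complex.continuous_re
  have h1 : MeromorphicAt (fun s : ℂ =>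
      ∑ j ∈ Finset.range K, b (a - 2 * j) / (s - (a - 2 * j : ℤ)) + G s) s₀ := by
    refine MeromorphicAt.add (MeromorphicAt.fun_sum fun j _ => ?_)
      (hG.analyticAt (ho.mem_nhds hK')).meromorphicAt
    exact meromorphicAt_const_div_sub
  refine h1.congr (Filter.Eventually.filter_mono nhdsWithin_le_nhds ?_)
  filter_upwards [ho.mem_nhds hK'] with s hs using (hζ s hs).symm

theorem IsZetaContinuation.tendsto_residue (h : IsZetaContinuation a b A J ζ) (k : ℤ) :
    Tendsto (fun s : ℂ => (s - k) * ζ s) (𝓝[≠] (k : ℂ)) (𝓝 (b k)) := by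
  obtain ⟨K, hK⟩ := exists_nat_gt (((a : ℝ) - k) / 2)
  have hK' : (a : ℝ) - 2 * K < (k : ℂ).re := by
    rw [Complex.intCast_re]; linarith
  obtain ⟨G, hG, hζ, -⟩ := h.cont K
  have ho : IsOpen {s : ℂ | (a : ℝ) - 2 * K < s.re} :=
    isOpen_lt continuous_const Complex.continuous_re
  have hid : Tendsto (fun s : ℂ => s - k) (𝓝[≠] (k : ℂ)) (𝓝 0) := by
    have : Continuous fun s : ℂ => s - k := by fun_prop
    simpa using (this.tendsto (k : ℂ)).mono_left nhdsWithin_le_nhds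
  have hterm : ∀ j ∈ Finset.range K, Tendsto (fun s : ℂ => (s - k) * (b (a - 2 * j) / (s - (a - 2 * j : ℤ))))
      (𝓝[≠] (k : ℂ)) (𝓝 (if a - 2 * (j : ℤ) = k then b k else 0)) := by
    intro j _
    split_ifs with hj
    · rw [hj]
      refine tendsto_const_nhds.congr' ?_
      filter_upwards [self_mem_nhdsWithin] with s hs
      have : s - k ≠ 0 := sub_ne_zero.2 hs
      field_simp
    · have hc : ContinuousAt (fun s : ℂ => b (a - 2 * j) / (s - (a - 2 * j : ℤ))) k := by
        refine ContinuousAt.div (by fun_prop) (by fun_prop) ?_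
        rw [sub_ne_zero]
        exact fun h => hj (by exact_mod_cast h.symm)
      simpa using hid.mul (hc.tendsto.mono_left nhdsWithin_le_nhds)
  have hG' : Tendsto (fun s : ℂ => (s - k) * G s) (𝓝[≠] (k : ℂ)) (𝓝 0) := by
    have := ((hG _ hK').differentiableAt (ho.mem_nhds hK')).continuousAt.tendsto
    simpa using hid.mul (this.mono_left nhdsWithin_le_nhds)
  have hsum : ∑ j ∈ Finset.range K, (if a - 2 * (j : ℤ) = k then b k else 0) = b k := by
    by_cases hb : b k = 0
    · simp [hb]
    · obtain ⟨j, hj⟩ := h.supp k hb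
      rw [Finset.sum_eq_single j, if_pos hj.symm]
      · intro i _ hi
        rw [if_neg (by omega)]
      · intro hj'
        have h1 : (K : ℝ) ≤ j := by exact_mod_cast (not_lt.1 fun h => hj' (Finset.mem_range.2 h))
        have h2 : (k : ℝ) = a - 2 * j := by exact_mod_cast hj
        linarith
  have := (tendsto_finsetSum _ hterm).add hG'
  rw [hsum, add_zero] at this
  refine this.congr' (Filter.Eventually.filter_mono nhdsWithin_le_nhds ?_)
  filter_upwards [ho.mem_nhds hK'] with s hs
  rw [hζ s hs, mul_add, Finset.mul_sum]

theorem IsZetaContinuation.neg_one_le_order (h : IsZetaContinuation a b A J ζ) (k : ℤ) :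
    ((-1 : ℤ) : WithTop ℤ) ≤ meromorphicOrderAt ζ (k : ℂ) := by
  have hm := h.meromorphicAt (k : ℂ)
  have hl : MeromorphicAt (fun s : ℂ => s - k) (k : ℂ) := by fun_prop
  have h1 := (tendsto_nhds_iff_meromorphicOrderAt_nonneg (hl.mul hm)).1 ⟨_, h.tendsto_residue k⟩
  rw [meromorphicOrderAt_mul hl hm] at h1
  have h2 : meromorphicOrderAt (fun s : ℂ => s - k) (k : ℂ) = ((1 : ℤ) : WithTop ℤ) := by
    rw [meromorphicOrderAt_eq_int_iff hl]
    exact ⟨fun _ => 1, analyticAt_const, one_ne_zero, by simp⟩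
  rw [h2] at h1
  cases h3 : meromorphicOrderAt ζ (k : ℂ) with
  | top => exact le_top
  | coe i =>
    rw [h3] at h1
    norm_cast at h1 ⊢
    omega

theorem IsZetaContinuation.tendsto_constant (h : IsZetaContinuation a b A J ζ) :
    Tendsto (fun s : ℂ => ζ s - b 0 / s) (𝓝[≠] 0) (𝓝 A) := by
  set K : ℕ := a.toNat + 1 with hK
  have hKa : a - 2 * K < 0 := by omega
  have hK' : (a : ℝ) - 2 * K < (0 : ℂ).re := by
    rw [Complex.zero_re]; exact_mod_cast hKa
  obtain ⟨G, hG, hζ, hA⟩ := h.cont K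
  have ho : IsOpen {s : ℂ | (a : ℝ) - 2 * K < s.re} :=
    isOpen_lt continuous_const Complex.continuous_re
  have hterm : ∀ j ∈ Finset.range K, Tendsto (fun s : ℂ => b (a - 2 * j) / (s - (a - 2 * j : ℤ)) -
      if a - 2 * (j : ℤ) = 0 then b 0 / s else 0)
      (𝓝[≠] 0) (𝓝 (b (a - 2 * j) / (0 - (a - 2 * j : ℤ)))) := by
    intro j _
    split_ifs with hj
    · rw [hj]
      simp
    · have hc : ContinuousAt (fun s : ℂ => b (a - 2 * j) / (s - (a - 2 * j : ℤ))) 0 := by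
        refine ContinuousAt.div (by fun_prop) (by fun_prop) ?_
        rw [sub_ne_zero]
        exact fun h => hj (by exact_mod_cast h.symm)
      simpa using (hc.tendsto.mono_left nhdsWithin_le_nhds)
  have hG' : Tendsto G (𝓝[≠] 0) (𝓝 (G 0)) :=
    ((hG _ hK').differentiableAt (ho.mem_nhds hK')).continuousAt.tendsto.mono_left
      nhdsWithin_le_nhds
  have hsum : ∀ s : ℂ, ∑ j ∈ Finset.range K, (if a - 2 * (j : ℤ) = 0 then b 0 / s else 0) = b 0 / s := by
    intro s
    by_cases hb : b 0 = 0
    · simp [hb]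
    · obtain ⟨j, hj⟩ := h.supp 0 hb
      rw [Finset.sum_eq_single j, if_pos hj.symm]
      · intro i _ hi
        rw [if_neg (by omega)]
      · intro hj'
        rw [Finset.mem_range] at hj'
        omega
  have := (tendsto_finsetSum _ hterm).add hG'
  rw [← hA hKa] at this
  refine this.congr' (Filter.Eventually.filter_mono nhdsWithin_le_nhds ?_)
  filter_upwards [ho.mem_nhds hK'] with s hs
  rw [hζ s hs, Finset.sum_sub_distrib, hsum]
  ring

/-- Clearing the poles of the continuation in the half-plane `re s > a - K`. -/
theorem IsZetaContinuation.exists_entire_mul (h : IsZetaContinuation a b A J ζ) (K : ℕ) :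
    ∃ H : ℂ → ℂ, DifferentiableOn ℂ H {s | (a : ℝ) - K < s.re} ∧
      ∀ s : ℂ, (a : ℝ) - K < s.re → (∀ j : ℕ, s ≠ a - j) →
        H s = (∏ j ∈ Finset.range K, (s - a + j)) * ζ s := by
  obtain ⟨G, hG, hζ, -⟩ := h.cont K
  have hsub : {s : ℂ | (a : ℝ) - K < s.re} ⊆ {s : ℂ | (a : ℝ) - 2 * K < s.re} := by
    intro s hs
    have hs' : (a : ℝ) - K < s.re := hs
    have : (0 : ℝ) ≤ K := by positivity
    simp only [mem_ofPred_eq]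
    linarith
  have hQ : ∀ j : ℕ, ∃ Q : ℂ → ℂ, DifferentiableOn ℂ Q {s | (a : ℝ) - K < s.re} ∧
      ∀ s : ℂ, (a : ℝ) - K < s.re → (∀ j : ℕ, s ≠ a - j) →
        Q s = (∏ j ∈ Finset.range K, (s - a + j)) * (1 / (s - (a - 2 * j : ℤ))) := by
    intro j
    by_cases hj : 2 * j < K
    · refine ⟨fun s => ∏ i ∈ (Finset.range K).erase (2 * j), (s - a + i), ?_, fun s _ hs => ?_⟩
      · exact (Differentiable.fun_finsetProd fun i _ => by fun_prop).differentiableOn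
      · rw [← Finset.mul_prod_erase _ _ (Finset.mem_range.2 hj)]
        have h0 : s - ((a - 2 * j : ℤ) : ℂ) ≠ 0 := intPole_ne (by exact_mod_cast hs (2 * j))
        have e1 : s - a + ((2 * j : ℕ) : ℂ) = s - ((a - 2 * j : ℤ) : ℂ) := by push_cast; ring
        rw [e1]
        field_simp
    · refine ⟨fun s => (∏ j ∈ Finset.range K, (s - a + j)) * (1 / (s - (a - 2 * j : ℤ))), ?_,
        fun s _ _ => rfl⟩
      refine DifferentiableOn.mul
        (Differentiable.fun_finsetProd fun i _ => by fun_prop).differentiableOn fun s hs => ?_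
      have hne : s - ((a - 2 * j : ℤ) : ℂ) ≠ 0 := by
        intro h0
        have h1 := congrArg Complex.re h0
        simp only [Complex.sub_re, Complex.intCast_re, Complex.zero_re] at h1
        push_cast at h1
        have hs' : (a : ℝ) - K < s.re := hs
        have : (K : ℝ) ≤ 2 * j := by exact_mod_cast not_lt.1 hj
        linarith
      exact (differentiableAt_const_div_sub hne).differentiableWithinAt
  choose Q hQd hQ using hQ
  refine ⟨fun s => ∑ j ∈ Finset.range K, b (a - 2 * j) * Q j s +
    (∏ j ∈ Finset.range K, (s - a + j)) * G s, ?_, fun s hs hne => ?_⟩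
  · refine DifferentiableOn.add (DifferentiableOn.fun_sum fun j _ => (hQd j).const_mul _) ?_
    exact DifferentiableOn.mul
      (Differentiable.fun_finsetProd fun i _ => by fun_prop).differentiableOn (hG.mono hsub)
  · beta_reduce
    rw [hζ s (hsub hs), mul_add, Finset.mul_sum]
    congr 1
    refine Finset.sum_congr rfl fun j _ => ?_
    rw [hQ j s hs hne]
    ring

theorem eventually_ne_int : ∀ᶠ s : ℂ in 𝓝[≠] 0, ∀ k : ℤ, s ≠ k := by
  have h1 : Metric.ball (0 : ℂ) 1 ∈ 𝓝[≠] (0 : ℂ) :=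
    mem_nhdsWithin_of_mem_nhds (Metric.ball_mem_nhds 0 one_pos)
  filter_upwards [h1, self_mem_nhdsWithin] with s hs hs0 k hk
  rw [mem_ball_zero_iff, hk, Complex.norm_intCast] at hs
  have : k = 0 := by
    by_contra hk0
    have : (1 : ℝ) ≤ |(k : ℝ)| := by exact_mod_cast Int.one_le_abs hk0
    linarith
  exact hs0 (by rw [hk, this]; simp)

/-- The product has at most a simple zero at `0`, so that a remainder `s²` times a function with at most
simple poles does not contribute at `0`. -/
theorem tendsto_sq_div_prod (a : ℤ) (K : ℕ) :
    Tendsto (fun s : ℂ => s ^ 2 / ∏ j ∈ Finset.range K, (s - a + j)) (𝓝[≠] 0) (𝓝 0) := by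
  have hid : Tendsto (fun s : ℂ => s) (𝓝[≠] (0 : ℂ)) (𝓝 0) := nhdsWithin_le_nhds
  have hQ : ∀ t : Finset ℕ, (∀ j ∈ t, (a : ℤ) ≠ j) →
      ContinuousAt (fun s : ℂ => 1 / ∏ j ∈ t, (s - a + j)) 0 := by
    intro t ht
    refine ContinuousAt.div continuousAt_const (by fun_prop) ?_
    refine Finset.prod_ne_zero_iff.2 fun j hj h0 => ht j hj ?_
    have : ((a : ℤ) : ℂ) = ((j : ℤ) : ℂ) := by
      push_cast
      linear_combination -h0
    exact_mod_cast this
  by_cases hK : ∃ j ∈ Finset.range K, a = j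
  · obtain ⟨i, hi, rfl⟩ := hK
    have h1 := hQ ((Finset.range K).erase i) fun j hj => by
      have := Finset.ne_of_mem_erase hj
      omega
    have h2 := hid.mul (h1.tendsto.mono_left (nhdsWithin_le_nhds (s := {0}ᶜ)))
    rw [zero_mul] at h2
    refine h2.congr' ?_
    filter_upwards [self_mem_nhdsWithin] with s hs
    have hs0 : s ≠ 0 := hs
    rw [← Finset.mul_prod_erase _ _ hi]
    have e1 : s - ((i : ℤ) : ℂ) + i = s := by push_cast; ring
    rw [e1]
    field_simp
  · push Not at hK
    have h2 := (hid.pow 2).mul ((hQ (Finset.range K) hK).tendsto.mono_left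
      (nhdsWithin_le_nhds (s := {0}ᶜ)))
    rw [zero_pow two_ne_zero, zero_mul] at h2
    exact h2.congr fun s => by ring

/-- The effect on the residue and the constant term at `0` of replacing `μ` by `e^{2φ} μ`. Here `J`,
`J'` and `Jφ` are the zeta integrals for `(μ, ω)`, `(e^{2φ} μ, ω)` and `(μ, φ ω)`, and `Q` is the
second order remainder in `φ`, whose continuation has at most simple poles. -/
theorem HasMellinExpansion.conformal_change {a : ℤ} {b b' bφ : ℤ → ℂ} {A A' Aφ : ℂ}
    {J J' Jφ Q : ℂ → ℂ} {F F' Fφ : ℝ → ℂ} (h : HasMellinExpansion a b A J F)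
    (h' : HasMellinExpansion a b' A' J' F') (hφ : HasMellinExpansion a bφ Aφ Jφ Fφ) {K : ℕ}
    (hK : a < K) {G : ℂ → ℂ} (hG : DifferentiableOn ℂ G {s | (a : ℝ) - K < s.re})
    (hGQ : ∀ s : ℂ, (a : ℝ) < s.re → G s = (∏ j ∈ Finset.range K, (s - a + j)) * Q s)
    (hJ : ∀ s : ℂ, (a : ℝ) < s.re → J' s = J s + s * Jφ s + s ^ 2 * Q s) :
    b' 0 = b 0 ∧ A' = A + bφ 0 := by
  obtain ⟨ζ, hζ⟩ := h.exists_zeta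
  obtain ⟨ζ', hζ'⟩ := h'.exists_zeta
  obtain ⟨ζφ, hζφ⟩ := hφ.exists_zeta
  obtain ⟨H, hH, hHζ⟩ := hζ.exists_entire_mul K
  obtain ⟨H', hH', hHζ'⟩ := hζ'.exists_entire_mul K
  obtain ⟨Hφ, hHφ, hHζφ⟩ := hζφ.exists_entire_mul K
  have hne : ∀ s : ℂ, (a : ℝ) < s.re → ∀ j : ℕ, s ≠ a - j := fun s hs j h0 => by
    rw [h0] at hs
    simp only [Complex.sub_re, Complex.intCast_re, Complex.natCast_re] at hs
    have : (0 : ℝ) ≤ j := by positivity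
    linarith
  have hle : ∀ s : ℂ, (a : ℝ) < s.re → (a : ℝ) - K < s.re := fun s hs => by
    have : (0 : ℝ) ≤ K := by positivity
    linarith
  -- After clearing the poles, the identity between the zeta integrals holds between holomorphic
  -- functions on a half-plane containing `0`.
  have key := eqOn_halfPlane (d := (a : ℝ)) (hH'.sub (hH.add (differentiableOn_id.mul hHφ)))
    ((differentiableOn_id.pow 2).mul hG) fun s hs => by
      simp only [Pi.sub_apply, Pi.add_apply, Pi.mul_apply, Pi.pow_apply, id]
      rw [hHζ s (hle s hs) (hne s hs), hHζ' s (hle s hs) (hne s hs),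
        hHζφ s (hle s hs) (hne s hs), hGQ s hs, hζ.eq s hs, hζ'.eq s hs, hζφ.eq s hs, hJ s hs]
      ring
  have h0 : (a : ℝ) - K < (0 : ℂ).re := by
    have : (a : ℝ) < K := by exact_mod_cast hK
    rw [Complex.zero_re]; linarith
  have ho : IsOpen {s : ℂ | (a : ℝ) - K < s.re} := isOpen_lt continuous_const Complex.continuous_re
  have hGc : Tendsto G (𝓝[≠] 0) (𝓝 (G 0)) :=
    ((hG _ h0).differentiableAt (ho.mem_nhds h0)).continuousAt.tendsto.mono_left nhdsWithin_le_nhds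
  have hD : Tendsto (fun s => ζ' s - ζ s - s * ζφ s) (𝓝[≠] 0) (𝓝 0) := by
    have h1 := (tendsto_sq_div_prod a K).mul hGc
    rw [zero_mul] at h1
    refine h1.congr' ?_
    filter_upwards [eventually_ne_int, mem_nhdsWithin_of_mem_nhds (ho.mem_nhds h0)] with s hs hsa
    have hs1 : ∀ j : ℕ, s ≠ a - j := fun j => by exact_mod_cast hs (a - j)
    have k1 := key s hsa
    simp only [Pi.sub_apply, Pi.add_apply, Pi.mul_apply, Pi.pow_apply, id] at k1
    rw [hHζ s hsa hs1, hHζ' s hsa hs1, hHζφ s hsa hs1] at k1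
    have hP : ∏ j ∈ Finset.range K, (s - a + j) ≠ 0 :=
      Finset.prod_ne_zero_iff.2 fun j _ h0 => hs1 j (by linear_combination h0)
    field_simp
    linear_combination -k1
  have hid : Tendsto (fun s : ℂ => s) (𝓝[≠] (0 : ℂ)) (𝓝 0) := nhdsWithin_le_nhds
  have r := hζ.tendsto_residue 0
  have r' := hζ'.tendsto_residue 0
  have rφ := hζφ.tendsto_residue 0
  simp only [Int.cast_zero, sub_zero] at r r' rφ
  have hb : b' 0 = b 0 := by
    have h1 := (hid.mul hD).add (r.add (hid.mul rφ))
    rw [zero_mul, zero_mul, add_zero, zero_add] at h1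
    exact tendsto_nhds_unique r' (h1.congr fun s => by ring)
  refine ⟨hb, ?_⟩
  have h2 := hD.add (hζ.tendsto_constant.add rφ)
  rw [zero_add] at h2
  refine tendsto_nhds_unique hζ'.tendsto_constant (h2.congr fun s => ?_)
  rw [hb]
  ring

/-- If the zeta integral is `c s` times another one, it is regular at `0`, and its value there is `c`
times the residue of the other one. -/
theorem HasMellinExpansion.eq_zero_of_eq_mul {a : ℤ} {b b' : ℤ → ℂ} {A A' : ℂ}
    {J J' : ℂ → ℂ} {F F' : ℝ → ℂ} (h : HasMellinExpansion a b A J F)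
    (h' : HasMellinExpansion a b' A' J' F') {c : ℂ} {d : ℝ}
    (hJ : ∀ s : ℂ, d < s.re → J' s = c * s * J s) : b' 0 = 0 ∧ A' = c * b 0 := by
  obtain ⟨ζ, hζ⟩ := h.exists_zeta
  obtain ⟨ζ', hζ'⟩ := h'.exists_zeta
  set K := a.toNat + 1 with hKdef
  have hK : a < K := by omega
  obtain ⟨H, hH, hHζ⟩ := hζ.exists_entire_mul K
  obtain ⟨H', hH', hHζ'⟩ := hζ'.exists_entire_mul K
  have hne : ∀ s : ℂ, (a : ℝ) < s.re → ∀ j : ℕ, s ≠ a - j := fun s hs j h0 => by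
    rw [h0] at hs
    simp only [Complex.sub_re, Complex.intCast_re, Complex.natCast_re] at hs
    have : (0 : ℝ) ≤ j := by positivity
    linarith
  have hle : ∀ s : ℂ, (a : ℝ) < s.re → (a : ℝ) - K < s.re := fun s hs => by
    have : (0 : ℝ) ≤ K := by positivity
    linarith
  have key := eqOn_halfPlane (d := max (a : ℝ) d) hH'
    (((differentiableOn_const c).mul differentiableOn_id).mul hH) fun s hs => by
      have hs1 := (le_max_left _ _).trans_lt hs
      simp only [Pi.mul_apply, id]
      rw [hHζ s (hle s hs1) (hne s hs1), hHζ' s (hle s hs1) (hne s hs1), hζ.eq s hs1,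
        hζ'.eq s hs1, hJ s ((le_max_right _ _).trans_lt hs)]
      ring
  have h0 : (a : ℝ) - K < (0 : ℂ).re := by
    have : (a : ℝ) < K := by exact_mod_cast hK
    rw [Complex.zero_re]; linarith
  have ho : IsOpen {s : ℂ | (a : ℝ) - K < s.re} := isOpen_lt continuous_const Complex.continuous_re
  have heq : ∀ᶠ s in 𝓝[≠] 0, c * (s * ζ s) = ζ' s := by
    filter_upwards [eventually_ne_int, mem_nhdsWithin_of_mem_nhds (ho.mem_nhds h0)] with s hs hsa
    have hs1 : ∀ j : ℕ, s ≠ a - j := fun j => by exact_mod_cast hs (a - j)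
    have k1 := key s hsa
    simp only [Pi.mul_apply, id] at k1
    rw [hHζ s hsa hs1, hHζ' s hsa hs1] at k1
    have hP : ∏ j ∈ Finset.range K, (s - a + j) ≠ 0 :=
      Finset.prod_ne_zero_iff.2 fun j _ h0 => hs1 j (by linear_combination h0)
    refine mul_left_cancel₀ hP ?_
    linear_combination -k1
  have hid : Tendsto (fun s : ℂ => s) (𝓝[≠] (0 : ℂ)) (𝓝 0) := nhdsWithin_le_nhds
  have r := hζ.tendsto_residue 0
  have r' := hζ'.tendsto_residue 0
  simp only [Int.cast_zero, sub_zero] at r r'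
  have hζ0 : Tendsto ζ' (𝓝[≠] 0) (𝓝 (c * b 0)) := (r.const_mul c).congr' heq
  have hb : b' 0 = 0 := by
    have h1 := hid.mul hζ0
    rw [zero_mul] at h1
    exact tendsto_nhds_unique r' h1
  refine ⟨hb, ?_⟩
  have h2 := hζ'.tendsto_constant
  simp only [hb, zero_div, sub_zero] at h2
  exact tendsto_nhds_unique h2 hζ0

end Continuation

/-! ### The Morse–Bott lemma -/

section InverseFunction

variable {E F : Type*} [NormedAddCommGroup E] [NormedSpace ℝ E] [CompleteSpace E]
  [NormedAddCommGroup F] [NormedSpace ℝ F]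

/-- The inverse function theorem for smooth maps, with both directions smooth on the whole of
the domains. -/
theorem exists_openPartialHomeomorph_of_fderiv {f : E → F} {O : Set E} (hO : IsOpen O)
    (hf : ContDiffOn ℝ (⊤ : ℕ∞) f O) {p : E} (hp : p ∈ O) {f' : E ≃L[ℝ] F}
    (hf' : HasFDerivAt f (f' : E →L[ℝ] F) p) :
    ∃ Φ : OpenPartialHomeomorph E F, p ∈ Φ.source ∧ Φ.source ⊆ O ∧ (∀ x, Φ x = f x) ∧
      ContDiffOn ℝ (⊤ : ℕ∞) Φ Φ.source ∧ ContDiffOn ℝ (⊤ : ℕ∞) Φ.symm Φ.target := by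
  have hfp : ContDiffAt ℝ (⊤ : ℕ∞) f p := hf.contDiffAt (hO.mem_nhds hp)
  set e := hfp.toOpenPartialHomeomorph f hf' (by simp) with he
  have hcoe : ∀ x, e x = f x := fun x => rfl
  set D : Set E := O ∩ fderiv ℝ f ⁻¹' range ((↑) : (E ≃L[ℝ] F) → E →L[ℝ] F) with hD
  have hDo : IsOpen D := by
    refine ContinuousOn.isOpen_inter_preimage ?_ hO ContinuousLinearEquiv.isOpen
    exact hf.continuousOn_fderiv_of_isOpen hO (by simp)
  have hpe : p ∈ e.source := hfp.mem_toOpenPartialHomeomorph_source hf' (by simp)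
  have hpD : p ∈ D := ⟨hp, f', hf'.fderiv.symm⟩
  refine ⟨e.restrOpen D hDo, ⟨hpe, hpD⟩, fun x hx => hx.2.1, hcoe, ?_, ?_⟩
  · exact (hf.mono fun x hx => hx.2.1)
  · intro y hy
    have hy1 : y ∈ e.target := hy.1
    have hy2 : e.symm y ∈ D := by
      have := (e.restrOpen D hDo).map_target hy
      exact this.2
    obtain ⟨g, hg⟩ := hy2.2
    have hd : HasFDerivAt e (g : E →L[ℝ] F) (e.symm y) := by
      rw [hg]
      exact ((hf.contDiffAt (hO.mem_nhds hy2.1)).differentiableAt (by simp)).hasFDerivAt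
    exact (e.contDiffAt_symm hy1 hd (hf.contDiffAt (hO.mem_nhds hy2.1))).contDiffWithinAt

end InverseFunction

section SquareRoot

variable {R : Type*} [NormedRing R] [NormedAlgebra ℝ R] [CompleteSpace R]

/-- Near `1`, squaring in a Banach algebra has a smooth inverse. -/
theorem exists_smooth_sqrt : ∃ (O : Set R) (σ : R → R), IsOpen O ∧ (1 : R) ∈ O ∧ σ 1 = 1 ∧
    ContDiffOn ℝ (⊤ : ℕ∞) σ O ∧ (∀ x ∈ O, σ x * σ x = x) ∧ ∀ᶠ y in 𝓝 (1 : R), σ (y * y) = y := by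
  have hf : ContDiff ℝ (⊤ : ℕ∞) fun x : R => x * x := contDiff_id.mul contDiff_id
  have hd : HasFDerivAt (fun x : R => x * x)
      ((ContinuousLinearEquiv.smulLeft (Units.mk0 (2 : ℝ) two_ne_zero) : R ≃L[ℝ] R) : R →L[ℝ] R) 1 := by
    have := (hasFDerivAt_id (𝕜 := ℝ) (1 : R)).mul' (hasFDerivAt_id (𝕜 := ℝ) (1 : R))
    refine this.congr_fderiv ?_
    ext x
    simp [two_smul, Units.smul_def]
  obtain ⟨Φ, h1, -, hΦ, -, hs⟩ := exists_openPartialHomeomorph_of_fderiv isOpen_univ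
    hf.contDiffOn (mem_univ 1) hd
  refine ⟨Φ.target, Φ.symm, Φ.open_target, ?_, ?_, hs, fun x hx => ?_, ?_⟩
  · have := Φ.map_source h1
    rwa [hΦ, one_mul] at this
  · have := Φ.left_inv h1
    rwa [hΦ, one_mul] at this
  · rw [← hΦ, Φ.right_inv hx]
  · filter_upwards [Φ.open_source.mem_nhds h1] with y hy
    rw [← hΦ, Φ.left_inv hy]

end SquareRoot

section PositiveForms

variable {m : ℕ}

local notation "𝕌" => EuclideanSpace ℝ (Fin m)

/-- A positive definite quadratic form is the square of a norm, by diagonalization in an orthonormal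
eigenbasis. -/
theorem exists_factor_of_pos {A : 𝕌 →L[ℝ] 𝕌} (hsymm : ∀ u v, inner ℝ (A u) v = inner ℝ u (A v))
    (hpos : ∀ u, u ≠ 0 → 0 < inner ℝ (A u) u) :
    ∃ T : 𝕌 ≃L[ℝ] 𝕌, ∀ u, inner ℝ (A u) u = ‖T u‖ ^ 2 := by
  have hT : (A : 𝕌 →ₗ[ℝ] 𝕌).IsSymmetric := hsymm
  have hn : Module.finrank ℝ 𝕌 = m := by simp
  set b := hT.eigenvectorBasis hn
  set l := hT.eigenvalues hn
  have hl : ∀ i, 0 < l i := by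
    intro i
    have h1 := hpos (b i) (fun h0 => by simpa [h0] using b.norm_eq_one i)
    have h2 : A (b i) = l i • b i := by
      have := hT.apply_eigenvectorBasis hn i
      exact this
    rw [h2, real_inner_smul_left, real_inner_self_eq_norm_sq, b.norm_eq_one] at h1
    simpa using h1
  let T : 𝕌 →ₗ[ℝ] 𝕌 :=
    { toFun := fun u => WithLp.toLp 2 fun i => √(l i) * b.repr u i
      map_add' := fun u v => by
        ext i
        simp [mul_add]
      map_smul' := fun c u => by
        ext i
        simp
        ring }
  have hTn : ∀ u, inner ℝ (A u) u = ‖T u‖ ^ 2 := by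
    intro u
    have h1 : inner ℝ (A u) u = inner ℝ (b.repr (A u)) (b.repr u) := (b.repr.inner_map_map _ _).symm
    rw [h1, EuclideanSpace.norm_sq_eq, PiLp.inner_apply]
    refine Finset.sum_congr rfl fun i _ => ?_
    have h2 : b.repr (A u) i = l i * b.repr u i := by
      have := hT.eigenvectorBasis_apply_self_apply hn u i
      exact this
    rw [h2]
    simp only [T, LinearMap.coe_mk, AddHom.coe_mk, Real.norm_eq_abs, sq_abs, mul_pow,
      Real.sq_sqrt (hl i).le, RCLike.inner_apply, conj_trivial]
    ring
  have hinj : Function.Injective T := by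
    rw [← LinearMap.ker_eq_bot, LinearMap.ker_eq_bot']
    intro u hu
    by_contra hne
    have := hpos u hne
    rw [hTn, hu] at this
    simp at this
  refine ⟨(LinearEquiv.ofInjectiveEndo T hinj).toContinuousLinearEquiv, fun u => ?_⟩
  rw [hTn]
  rfl

end PositiveForms

section MorseBott

variable {m : ℕ} {W : Type} [NormedAddCommGroup W] [NormedSpace ℝ W] [FiniteDimensional ℝ W]

local notation "𝕌" => EuclideanSpace ℝ (Fin m)

/-- A nonnegative function vanishing on `{u = 0}` is a quadratic form in `u` with smooth
coefficients. -/
theorem exists_quadratic_form {f : 𝕌 × W → ℝ} (hf : ContDiff ℝ (⊤ : ℕ∞) f) (hf0 : ∀ p, 0 ≤ f p)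
    (hfz : ∀ w, f (0, w) = 0) :
    ∃ A : 𝕌 × W → 𝕌 →L[ℝ] 𝕌, ContDiff ℝ (⊤ : ℕ∞) A ∧
      (∀ p u v, inner ℝ (A p u) v = inner ℝ u (A p v)) ∧
      (∀ u w, f (u, w) = inner ℝ (A (u, w) u) u) ∧
      ∀ w u v, inner ℝ (A (0, w) u) v = (1 / 2) * fderiv ℝ (fderiv ℝ f) (0, w) (u, 0) (v, 0) := by
  set D : 𝕌 × W → (𝕌 × W) →L[ℝ] (𝕌 × W) →L[ℝ] ℝ := fderiv ℝ (fderiv ℝ f) with hD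
  have hf1 : ContDiff ℝ (⊤ : ℕ∞) (fderiv ℝ f) := hf.fderiv_right (m := (⊤ : ℕ∞)) (by simp)
  have hDs : ContDiff ℝ (⊤ : ℕ∞) D := hf1.fderiv_right (m := (⊤ : ℕ∞)) (by simp)
  have hsym : ∀ p x y, D p x y = D p y x := fun p x y =>
    (hf.contDiffAt.isSymmSndFDerivAt (by simp; norm_cast) : IsSymmSndFDerivAt ℝ f p).eq x y
  let ι : Fin m → 𝕌 × W := fun i => (EuclideanSpace.single i (1 : ℝ), 0)
  have hDij : ∀ x y, ContDiff ℝ (⊤ : ℕ∞) fun p => D p x y := fun x y =>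
    (hDs.clm_apply contDiff_const).clm_apply contDiff_const
  have hH : ∀ x y, ContDiff ℝ (⊤ : ℕ∞) fun q : (𝕌 × W) × ℝ =>
      (1 - q.2) * D (q.2 • q.1.1, q.1.2) x y := fun x y =>
    (contDiff_const.sub contDiff_snd).mul ((hDij x y).comp
      ((contDiff_snd.smul (contDiff_fst.comp contDiff_fst)).prodMk (contDiff_snd.comp contDiff_fst)))
  -- Taylor's formula of order two along `t ↦ (t u, w)`, with integral remainder
  let B : (𝕌 × W) → (𝕌 × W) → 𝕌 × W → ℝ := fun x y p =>
    ∫ t in Icc (0 : ℝ) 1, (1 - t) * D (t • p.1, p.2) x y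
  have hB : ∀ x y, ContDiff ℝ (⊤ : ℕ∞) (B x y) := fun x y =>
    contDiff_integral_right (isCompact_Icc (a := (0 : ℝ)) (b := 1))
      (ae_restrict_mem measurableSet_Icc) (hH x y)
  have hBint : ∀ x y p : 𝕌 × W, Integrable (fun t : ℝ => (1 - t) * D (t • p.1, p.2) x y)
      (volume.restrict (Icc (0 : ℝ) 1)) := fun x y p =>
    integrable_of_continuous_of_compact (isCompact_Icc (a := (0 : ℝ)) (b := 1))
      (ae_restrict_mem measurableSet_Icc)
      ((hH x y).continuous.comp (continuous_const.prodMk continuous_id : Continuous fun t => (p, t)))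
  let E : Fin m → Fin m → 𝕌 →L[ℝ] 𝕌 := fun i j =>
    (EuclideanSpace.proj i : 𝕌 →L[ℝ] ℝ).smulRight (EuclideanSpace.single j (1 : ℝ))
  let A : 𝕌 × W → 𝕌 →L[ℝ] 𝕌 := fun p => ∑ i, ∑ j, B (ι i) (ι j) p • E i j
  have hA : ContDiff ℝ (⊤ : ℕ∞) A :=
    ContDiff.sum fun i _ => ContDiff.sum fun j _ => (hB (ι i) (ι j)).smul contDiff_const
  have hexp : ∀ u : 𝕌, ((u, 0) : 𝕌 × W) = ∑ i, u i • ι i := by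
    intro u
    have h1 : u = ∑ i, u i • EuclideanSpace.single i (1 : ℝ) := by
      ext j
      simp [Finset.sum_apply, Pi.single_apply]
    conv_lhs => rw [h1]
    ext j <;> simp [ι, Prod.fst_sum, Prod.snd_sum]
  have hAin : ∀ p u v, inner ℝ (A p u) v = B (u, 0) (v, 0) p := by
    intro p u v
    have h1 : ∀ t : ℝ, (1 - t) * D (t • p.1, p.2) (u, 0) (v, 0) =
        ∑ i, ∑ j, (u i * v j) * ((1 - t) * D (t • p.1, p.2) (ι i) (ι j)) := by
      intro t
      rw [hexp u, hexp v]
      simp only [map_sum, map_smul, sum_apply, smul_apply,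
        smul_eq_mul, Finset.mul_sum]
      rw [Finset.sum_comm]
      refine Finset.sum_congr rfl fun i _ => Finset.sum_congr rfl fun j _ => by ring
    have h2 : B (u, 0) (v, 0) p = ∑ i, ∑ j, (u i * v j) * B (ι i) (ι j) p := by
      simp only [B, h1]
      rw [integral_finsetSum _ fun i _ => integrable_finsetSum _ fun j _ => (hBint _ _ p).const_mul _]
      refine Finset.sum_congr rfl fun i _ => ?_
      rw [integral_finsetSum _ fun j _ => (hBint _ _ p).const_mul _]
      refine Finset.sum_congr rfl fun j _ => integral_const_mul _ _
    rw [h2]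
    simp only [A, sum_apply, sum_inner]
    refine Finset.sum_congr rfl fun i _ => Finset.sum_congr rfl fun j _ => ?_
    simp [E, real_inner_smul_left, EuclideanSpace.inner_single_left]
    ring
  have hBapp : ∀ p x y, B x y p = ∫ t in Icc (0 : ℝ) 1, (1 - t) * D (t • p.1, p.2) x y :=
    fun p x y => rfl
  refine ⟨A, hA, fun p u v => ?_, fun u w => ?_, fun w u v => ?_⟩
  · rw [real_inner_comm _ u, hAin, hAin, hBapp, hBapp]
    simp only [hsym _ (u, 0)]
  · rw [hAin, hBapp]
    have hfd : fderiv ℝ f (0, w) = 0 := by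
      have : IsLocalMin f (0, w) := Eventually.of_forall fun p => by rw [hfz]; exact hf0 p
      exact this.fderiv_eq_zero
    have hline : ∀ t : ℝ, HasDerivAt (fun t : ℝ => ((t • u, w) : 𝕌 × W)) (u, 0) t := fun t => by
      simpa using ((hasDerivAt_id t).smul_const u).prodMk (hasDerivAt_const t w)
    have hg : ∀ t : ℝ, HasDerivAt (fun t : ℝ => f (t • u, w)) (fderiv ℝ f (t • u, w) (u, 0)) t :=
      fun t => ((hf.differentiable (by simp) _).hasFDerivAt).comp_hasDerivAt t (hline t)
    have hg' : ∀ t : ℝ, HasDerivAt (fun t : ℝ => fderiv ℝ f (t • u, w) (u, 0))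
        (D (t • u, w) (u, 0) (u, 0)) t := fun t => by
      have h1 := ((hf1.differentiable (by simp) _).hasFDerivAt).comp_hasDerivAt t (hline t)
      simpa using h1.clm_apply (hasDerivAt_const t ((u, 0) : 𝕌 × W))
    have hmain := intervalIntegral.integral_eq_sub_of_hasDerivAt (a := (0 : ℝ)) (b := 1)
      (f := fun t => (1 - t) * fderiv ℝ f (t • u, w) (u, 0) + f (t • u, w))
      (f' := fun t => (1 - t) * D (t • u, w) (u, 0) (u, 0)) (fun t _ => by
        refine ((((hasDerivAt_id t).const_sub 1).mul (hg' t)).add (hg t)).congr_deriv ?_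
        simp) (by
        refine Continuous.intervalIntegrable ?_ _ _
        have h1 : Continuous fun t : ℝ => D (t • u, w) := hDs.continuous.comp (by fun_prop)
        exact (by fun_prop : Continuous fun t : ℝ => 1 - t).mul
          ((h1.clm_apply continuous_const).clm_apply continuous_const))
    rw [integral_Icc_eq_integral_Ioc, ← intervalIntegral.integral_of_le zero_le_one, hmain]
    simp [hfd, hfz]
  · rw [hAin, hBapp]
    simp only [smul_zero]
    rw [integral_mul_const, integral_Icc_eq_integral_Ioc, ← intervalIntegral.integral_of_le zero_le_one]
    congr 1
    rw [intervalIntegral.integral_sub (by simp) (by simp)]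
    norm_num

/-- The Morse–Bott lemma: near a zero where the Hessian is positive transversally to `{u = 0}`, a
nonnegative function vanishing on `{u = 0}` is the squared norm of the first component of a smooth
coordinate system. If `f = ⟨A u, u⟩` with `A` symmetric and `A₀ = A p₀`, then `A = A₀ S²` with `S`
the square root of `A₀⁻¹ A` near `1`; by uniqueness of the root `A₀ S = Sᵀ A₀`, hence
`f = ⟨A₀ S u, S u⟩`. -/
theorem exists_morseBott_coordinates {f : 𝕌 × W → ℝ} (hf : ContDiff ℝ (⊤ : ℕ∞) f)
    (hf0 : ∀ p, 0 ≤ f p) (hfz : ∀ w, f (0, w) = 0) (w₀ : W)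
    (hpos : ∀ u : 𝕌, u ≠ 0 → 0 < fderiv ℝ (fderiv ℝ f) (0, w₀) (u, 0) (u, 0)) :
    ∃ Φ : OpenPartialHomeomorph (𝕌 × W) (𝕌 × W), (0, w₀) ∈ Φ.source ∧
      ContDiffOn ℝ (⊤ : ℕ∞) Φ Φ.source ∧ ContDiffOn ℝ (⊤ : ℕ∞) Φ.symm Φ.target ∧
      ∀ p ∈ Φ.source, f p = ‖(Φ p).1‖ ^ 2 := by
  obtain ⟨A, hA, hAs, hAf, hA0⟩ := exists_quadratic_form hf hf0 hfz
  set p₀ : 𝕌 × W := (0, w₀) with hp₀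
  have hAp : ∀ u, u ≠ 0 → 0 < inner ℝ (A p₀ u) u := fun u hu => by
    rw [hA0]
    have := hpos u hu
    positivity
  obtain ⟨T, hT⟩ := exists_factor_of_pos (hAs p₀) hAp
  have hinj : Function.Injective (A p₀ : 𝕌 →ₗ[ℝ] 𝕌) := by
    rw [← LinearMap.ker_eq_bot, LinearMap.ker_eq_bot']
    intro u hu
    by_contra hne
    have h1 := hAp u hne
    have h2 : A p₀ u = 0 := hu
    simp [h2] at h1
  set I₀ : 𝕌 ≃L[ℝ] 𝕌 := (LinearEquiv.ofInjectiveEndo _ hinj).toContinuousLinearEquiv with hI₀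
  have hI₀a : ∀ u, I₀ u = A p₀ u := fun u => rfl
  set B : 𝕌 →L[ℝ] 𝕌 := (I₀.symm : 𝕌 →L[ℝ] 𝕌) with hB
  have hBA : B * A p₀ = 1 := by
    ext1 u
    exact I₀.symm_apply_apply u
  have hAB : A p₀ * B = 1 := by
    ext1 u
    exact I₀.apply_symm_apply u
  have hAstar : ∀ p, star (A p) = A p := fun p => by
    rw [ContinuousLinearMap.star_eq_adjoint]
    refine ((ContinuousLinearMap.eq_adjoint_iff _ _).2 (hAs p)).symm
  have hBstar : star B = B := by
    have h1 : star B * A p₀ = 1 := by rw [← hAstar, ← star_mul, hAB, star_one]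
    calc star B = star B * (A p₀ * B) := by rw [hAB, mul_one]
      _ = B := by rw [← mul_assoc, h1, one_mul]
  obtain ⟨O, σ, hO, h1O, hσ1, hσ, hσO, hσu⟩ := exists_smooth_sqrt (R := 𝕌 →L[ℝ] 𝕌)
  have hC : ContDiff ℝ (⊤ : ℕ∞) fun p => B * A p := contDiff_const.mul hA
  set O' : Set (𝕌 × W) := (fun p => B * A p) ⁻¹' O with hO'
  have hO'o : IsOpen O' := hO.preimage hC.continuous
  have hp₀O : p₀ ∈ O' := by
    change B * A p₀ ∈ O
    rwa [hBA]
  set S : 𝕌 × W → 𝕌 →L[ℝ] 𝕌 := fun p => σ (B * A p) with hS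
  have hSs : ContDiffOn ℝ (⊤ : ℕ∞) S O' := hσ.comp hC.contDiffOn fun _ h => h
  have hS0 : S p₀ = 1 := by simp only [hS, hBA, hσ1]
  have hSS : ∀ p ∈ O', S p * S p = B * A p := fun p hp => hσO _ hp
  -- `S' = A₀⁻¹ Sᵀ A₀` is another square root of `A₀⁻¹ A` close to `1`, so `S' = S` near `p₀`.
  set S' : 𝕌 × W → 𝕌 →L[ℝ] 𝕌 := fun p => B * star (S p) * A p₀ with hS'
  have hS'S' : ∀ p ∈ O', S' p * S' p = B * A p := fun p hp => by
    calc S' p * S' p = B * star (S p) * (A p₀ * B) * star (S p) * A p₀ := by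
          simp only [hS', mul_assoc]
      _ = B * star (S p * S p) * A p₀ := by
          rw [hAB, mul_one, star_mul]
          simp only [mul_assoc]
      _ = B * A p * (B * A p₀) := by
          rw [hSS p hp, star_mul, hAstar, hBstar]
          simp only [mul_assoc]
      _ = B * A p := by rw [hBA, mul_one]
  have hS'1 : S' p₀ = 1 := by simp only [hS', hS0, star_one, mul_one, hBA]
  have hSc : ContinuousAt S p₀ := (hSs.contDiffAt (hO'o.mem_nhds hp₀O)).continuousAt
  have hS'c : Tendsto S' (𝓝 p₀) (𝓝 1) := by
    rw [← hS'1]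
    have hstar : ContinuousAt (fun p => star (S p)) p₀ := by
      simp only [ContinuousLinearMap.star_eq_adjoint]
      exact (ContinuousLinearMap.adjoint (𝕜 := ℝ) (E := 𝕌) (F := 𝕌)).continuous.continuousAt.comp hSc
    exact (continuousAt_const.mul hstar).mul continuousAt_const
  have hev : ∀ᶠ p in 𝓝 p₀, p ∈ O' ∧ S p = S' p := by
    filter_upwards [hO'o.mem_nhds hp₀O, hS'c.eventually hσu] with p hp hp'
    refine ⟨hp, ?_⟩
    rw [hS'S' p hp] at hp'
    exact hp'
  obtain ⟨O₁, hO₁, hO₁o, hp₀1⟩ := _root_.mem_nhds_iff.1 hev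
  have hfS : ∀ p ∈ O₁, f p = ‖T (S p p.1)‖ ^ 2 := by
    rintro ⟨u, w⟩ hp
    obtain ⟨hpO, hpS⟩ := hO₁ hp
    have h1 : A p₀ * S (u, w) = star (S (u, w)) * A p₀ := by
      rw [hpS]
      calc A p₀ * S' (u, w) = (A p₀ * B) * star (S (u, w)) * A p₀ := by
            simp only [hS', mul_assoc]
        _ = star (S (u, w)) * A p₀ := by rw [hAB, one_mul]
        _ = _ := by rw [hpS]
    have h2 : A (u, w) = star (S (u, w)) * (A p₀ * S (u, w)) := by
      rw [← mul_assoc, ← h1, mul_assoc, hSS _ hpO, ← mul_assoc, hAB, one_mul]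
    rw [← hT, hAf, h2, ContinuousLinearMap.star_eq_adjoint]
    change inner ℝ (ContinuousLinearMap.adjoint (S (u, w)) (A p₀ (S (u, w) u))) u = _
    rw [ContinuousLinearMap.adjoint_inner_left]
  have hΦs : ContDiffOn ℝ (⊤ : ℕ∞) (fun p : 𝕌 × W => (T (S p p.1), p.2)) O₁ := by
    have h1 : ContDiffOn ℝ (⊤ : ℕ∞) (fun p : 𝕌 × W => S p p.1) O₁ :=
      (hSs.mono fun p hp => (hO₁ hp).1).clm_apply contDiff_fst.contDiffOn
    exact (T.contDiff.comp_contDiffOn h1).prodMk contDiff_snd.contDiffOn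
  have hΦd : HasFDerivAt (fun p : 𝕌 × W => (T (S p p.1), p.2))
      ((T.prodCongr (ContinuousLinearEquiv.refl ℝ W) : (𝕌 × W) ≃L[ℝ] (𝕌 × W)) :
        (𝕌 × W) →L[ℝ] (𝕌 × W)) p₀ := by
    have h1 := ((hSs.contDiffAt (hO'o.mem_nhds hp₀O)).differentiableAt (by simp)).hasFDerivAt
    have h2 := (T.hasFDerivAt (x := S p₀ p₀.1)).comp p₀ (h1.clm_apply (hasFDerivAt_fst (𝕜 := ℝ)))
    refine (h2.prodMk (hasFDerivAt_snd (𝕜 := ℝ))).congr_fderiv ?_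
    have hS0' : S (0, w₀) = 1 := hS0
    ext p <;> simp [hS0', hp₀]
  obtain ⟨Φ, hs, hsub, hΦ, hΦ1, hΦ2⟩ := exists_openPartialHomeomorph_of_fderiv hO₁o hΦs hp₀1 hΦd
  exact ⟨Φ, hs, hΦ1, hΦ2, fun p hp => by rw [hfS p (hsub hp), hΦ]⟩

end MorseBott

/-! ### Forms in charts -/

section TopForms

variable {n : ℕ}

local notation "𝔼" => EuclideanSpace ℝ (Fin n)

theorem coe_sign_ne_zero {x : ℝ} (hx : x ≠ 0) : ((SignType.sign x : SignType) : ℝ) ≠ 0 := by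
  rcases lt_or_gt_of_ne hx with h | h <;> simp [h]

theorem det_clm_comp (A B : 𝔼 →L[ℝ] 𝔼) : (A.comp B).det = A.det * B.det :=
  LinearMap.det_comp _ _

theorem contDiff_clm_det : ContDiff ℝ (⊤ : ℕ∞) fun L : 𝔼 →L[ℝ] 𝔼 => L.det := by
  have h1 : ∀ L : 𝔼 →L[ℝ] 𝔼, L.det = ∑ σ : Equiv.Perm (Fin n), (Equiv.Perm.sign σ : ℤ) •
      ∏ i, L (EuclideanSpace.single i (1 : ℝ)) (σ i) := by
    intro L
    rw [ContinuousLinearMap.det, ← LinearMap.det_toMatrix (EuclideanSpace.basisFun (Fin n) ℝ).toBasis,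
      Matrix.det_apply]
    refine Finset.sum_congr rfl fun σ _ => ?_
    rw [Units.smul_def]
    refine congrArg _ ?_
    refine Finset.prod_congr rfl fun i _ => ?_
    simp [LinearMap.toMatrix_apply]
  simp only [h1]
  refine ContDiff.sum fun σ _ => ContDiff.const_smul _ (contDiff_prod fun i _ => ?_)
  exact ((EuclideanSpace.proj (σ i) : 𝔼 →L[ℝ] ℝ).comp
    (ContinuousLinearMap.apply ℝ 𝔼 (EuclideanSpace.single i (1 : ℝ)))).contDiff

theorem alternating_real_comp_det (f : 𝔼 [⋀^Fin n]→ₗ[ℝ] ℝ) (L : 𝔼 →L[ℝ] 𝔼) (v : Fin n → 𝔼) :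
    f (fun i => L (v i)) = L.det * f v := by
  set e := (EuclideanSpace.basisFun (Fin n) ℝ).toBasis
  rw [f.eq_smul_basis_det e]
  have := e.det_comp (L : 𝔼 →ₗ[ℝ] 𝔼) v
  simp only [AlternatingMap.smul_apply, smul_eq_mul]
  change f e * e.det ((L : 𝔼 →ₗ[ℝ] 𝔼) ∘ v) = _
  rw [this, ContinuousLinearMap.det]
  ring

theorem alternating_complex_comp_det (f : 𝔼 [⋀^Fin n]→L[ℝ] ℂ) (L : 𝔼 →L[ℝ] 𝔼) (v : Fin n → 𝔼) :
    f (fun i => L (v i)) = (L.det : ℂ) * f v := by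
  apply Complex.ext
  · have := alternating_real_comp_det (Complex.reLm.compAlternatingMap f.toAlternatingMap) L v
    simpa using this
  · have := alternating_real_comp_det (Complex.imLm.compAlternatingMap f.toAlternatingMap) L v
    simpa using this

theorem frameSign_comp (o : Orientation ℝ 𝔼 (Fin n)) (L : 𝔼 →L[ℝ] 𝔼) (v : Fin n → 𝔼) :
    frameSign o (fun i => L (v i)) = ((SignType.sign L.det : SignType) : ℝ) * frameSign o v := by
  unfold frameSign
  rw [alternating_real_comp_det, sign_mul, SignType.coe_mul]

theorem frameSign_basis_ne_zero (o : Orientation ℝ 𝔼 (Fin n)) :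
    frameSign o (fun i => EuclideanSpace.single i (1 : ℝ)) ≠ 0 := by
  unfold frameSign
  have h1 := o.someVector_ne_zero
  have h2 : o.someVector (fun i => EuclideanSpace.single i (1 : ℝ)) ≠ 0 := by
    have := (AlternatingMap.map_basis_ne_zero_iff
      (EuclideanSpace.basisFun (Fin n) ℝ).toBasis o.someVector).2 h1
    rw [OrthonormalBasis.coe_toBasis] at this
    convert this using 2
    ext1 i
    simp
  exact coe_sign_ne_zero h2

end TopForms

section Charts

variable {n : ℕ} {X : Type*} [TopologicalSpace X] [ChartedSpace (EuclideanSpace ℝ (Fin n)) X]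

local notation "𝔼" => EuclideanSpace ℝ (Fin n)

/-- The derivative of the inverse of a chart, as an endomorphism of the model space (which is
also, by definition, every tangent space of the manifold). -/
noncomputable def chartFrame (e : OpenPartialHomeomorph X (EuclideanSpace ℝ (Fin n)))
    (y : EuclideanSpace ℝ (Fin n)) : EuclideanSpace ℝ (Fin n) →L[ℝ] EuclideanSpace ℝ (Fin n) :=
  mfderiv 𝓘(ℝ, EuclideanSpace ℝ (Fin n)) (𝓡 n) e.symm y

/-- The value of a form, on the model space. -/
def formAt {k : ℕ} (ω : Form n X k) (x : X) : EuclideanSpace ℝ (Fin n) [⋀^Fin k]→L[ℝ] ℂ := ω x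

/-- The orientation of a tangent space, as one of the model space. -/
def orientAt (o : ManifoldOrientation n X) (x : X) :
    Orientation ℝ (EuclideanSpace ℝ (Fin n)) (Fin n) := o.orient x

/-- The coordinate expression of a form in an arbitrary chart. -/
noncomputable def formIn {k : ℕ} (e : OpenPartialHomeomorph X (EuclideanSpace ℝ (Fin n))) (ω : Form n X k)
    (y : EuclideanSpace ℝ (Fin n)) : EuclideanSpace ℝ (Fin n) [⋀^Fin k]→L[ℝ] ℂ :=
  (formAt ω (e.symm y)).compContinuousLinearMap (chartFrame e y)

/-- The coefficient `ω(∂₁, …, ∂ₙ)` of a top form in an arbitrary chart. -/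
noncomputable def coeffIn (e : OpenPartialHomeomorph X (EuclideanSpace ℝ (Fin n))) (ω : Form n X n)
    (y : EuclideanSpace ℝ (Fin n)) : ℂ :=
  formIn e ω y fun i => EuclideanSpace.single i (1 : ℝ)

/-- The sign of the coordinate frame of an arbitrary chart. -/
noncomputable def chartSign (o : ManifoldOrientation n X)
    (e : OpenPartialHomeomorph X (EuclideanSpace ℝ (Fin n))) (y : EuclideanSpace ℝ (Fin n)) : ℝ :=
  frameSign (orientAt o (e.symm y)) fun i => chartFrame e y (EuclideanSpace.single i (1 : ℝ))

theorem formIn_chartAt {k : ℕ} (ω : Form n X k) (p : X) :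
    formIn (chartAt (EuclideanSpace ℝ (Fin n)) p) ω = inChart ω p := rfl

theorem extChartAt_symm_eq (p : X) :
    ((extChartAt (𝓡 n) p).symm : 𝔼 → X) = (chartAt (EuclideanSpace ℝ (Fin n)) p).symm := rfl

theorem extChartAt_target_eq (p : X) :
    (extChartAt (𝓡 n) p).target = (chartAt (EuclideanSpace ℝ (Fin n)) p).target := by
  simp [mfld_simps]

variable [IsManifold (𝓡 n) (⊤ : ℕ∞) X]

variable {e e' : OpenPartialHomeomorph X (EuclideanSpace ℝ (Fin n))}

theorem mdifferentiableAt_chart_symm (he : e ∈ IsManifold.maximalAtlas (𝓡 n) (⊤ : ℕ∞) X) {y : 𝔼}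
    (hy : y ∈ e.target) : MDifferentiableAt 𝓘(ℝ, 𝔼) (𝓡 n) e.symm y :=
  ((contMDiffOn_symm_of_mem_maximalAtlas he).contMDiffAt
    (e.open_target.mem_nhds hy)).mdifferentiableAt (by simp)

theorem mdifferentiableAt_chart (he : e ∈ IsManifold.maximalAtlas (𝓡 n) (⊤ : ℕ∞) X) {x : X}
    (hx : x ∈ e.source) : MDifferentiableAt (𝓡 n) 𝓘(ℝ, 𝔼) e x :=
  ((contMDiffOn_of_mem_maximalAtlas he).contMDiffAt
    (e.open_source.mem_nhds hx)).mdifferentiableAt (by simp)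

theorem contDiffOn_transition (he : e ∈ IsManifold.maximalAtlas (𝓡 n) (⊤ : ℕ∞) X)
    (he' : e' ∈ IsManifold.maximalAtlas (𝓡 n) (⊤ : ℕ∞) X) :
    ContDiffOn ℝ (⊤ : ℕ∞) (e' ∘ e.symm) (e.target ∩ e.symm ⁻¹' e'.source) := by
  have h1 : ContMDiffOn 𝓘(ℝ, 𝔼) 𝓘(ℝ, 𝔼) (⊤ : ℕ∞) (e' ∘ e.symm) (e.target ∩ e.symm ⁻¹' e'.source) :=
    (contMDiffOn_of_mem_maximalAtlas he').comp
      ((contMDiffOn_symm_of_mem_maximalAtlas he).mono inter_subset_left) inter_subset_right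
  exact contMDiffOn_iff_contDiffOn.1 h1

theorem contDiffAt_transition (he : e ∈ IsManifold.maximalAtlas (𝓡 n) (⊤ : ℕ∞) X)
    (he' : e' ∈ IsManifold.maximalAtlas (𝓡 n) (⊤ : ℕ∞) X) {y : 𝔼}
    (hy : y ∈ e.target ∩ e.symm ⁻¹' e'.source) : ContDiffAt ℝ (⊤ : ℕ∞) (e' ∘ e.symm) y :=
  (contDiffOn_transition he he').contDiffAt
    ((e.isOpen_inter_preimage_symm e'.open_source).mem_nhds hy)

theorem chartFrame_eq (he : e ∈ IsManifold.maximalAtlas (𝓡 n) (⊤ : ℕ∞) X)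
    (he' : e' ∈ IsManifold.maximalAtlas (𝓡 n) (⊤ : ℕ∞) X) {y : 𝔼}
    (hy : y ∈ e.target ∩ e.symm ⁻¹' e'.source) :
    chartFrame e y = (chartFrame e' (e' (e.symm y))).comp (fderiv ℝ (e' ∘ e.symm) y) := by
  have h1 : e.symm =ᶠ[𝓝 y] e'.symm ∘ (e' ∘ e.symm) := by
    filter_upwards [(e.isOpen_inter_preimage_symm e'.open_source).mem_nhds hy] with z hz
    exact (e'.left_inv hz.2).symm
  have h2 : MDifferentiableAt 𝓘(ℝ, 𝔼) 𝓘(ℝ, 𝔼) (e' ∘ e.symm) y :=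
    ((contDiffAt_transition he he' hy).differentiableAt (by simp)).mdifferentiableAt
  have h3 := mfderiv_comp y (mdifferentiableAt_chart_symm he' (e'.map_source hy.2)) h2
  unfold chartFrame
  rw [← mfderiv_eq_fderiv]
  exact (h1.mfderiv_eq).trans h3

theorem exists_comp_chartFrame (he : e ∈ IsManifold.maximalAtlas (𝓡 n) (⊤ : ℕ∞) X) {y : 𝔼}
    (hy : y ∈ e.target) :
    ∃ L : 𝔼 →L[ℝ] 𝔼, L.comp (chartFrame e y) = ContinuousLinearMap.id ℝ 𝔼 := by
  have h1 : e ∘ e.symm =ᶠ[𝓝 y] id := by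
    filter_upwards [e.open_target.mem_nhds hy] with z hz
    exact e.right_inv hz
  have h3 := mfderiv_comp y (mdifferentiableAt_chart he (e.map_target hy))
    (mdifferentiableAt_chart_symm he hy)
  have h4 := h1.mfderiv_eq (I := 𝓘(ℝ, 𝔼)) (I' := 𝓘(ℝ, 𝔼))
  rw [mfderiv_id] at h4
  exact ⟨mfderiv (𝓡 n) 𝓘(ℝ, 𝔼) e (e.symm y), h3.symm.trans h4⟩

theorem det_chartFrame_ne_zero (he : e ∈ IsManifold.maximalAtlas (𝓡 n) (⊤ : ℕ∞) X) {y : 𝔼}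
    (hy : y ∈ e.target) : (chartFrame e y).det ≠ 0 := by
  obtain ⟨L, hL⟩ := exists_comp_chartFrame he hy
  have h := congrArg ContinuousLinearMap.det hL
  rw [det_clm_comp] at h
  have h1 : (ContinuousLinearMap.id ℝ 𝔼).det = 1 := LinearMap.det_id
  rw [h1] at h
  exact right_ne_zero_of_mul_eq_one h

theorem det_transition_ne_zero (he : e ∈ IsManifold.maximalAtlas (𝓡 n) (⊤ : ℕ∞) X)
    (he' : e' ∈ IsManifold.maximalAtlas (𝓡 n) (⊤ : ℕ∞) X) {y : 𝔼}
    (hy : y ∈ e.target ∩ e.symm ⁻¹' e'.source) : (fderiv ℝ (e' ∘ e.symm) y).det ≠ 0 := by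
  have h := det_chartFrame_ne_zero he hy.1
  rw [chartFrame_eq he he' hy, det_clm_comp] at h
  exact right_ne_zero_of_mul h

theorem formIn_eq {k : ℕ} (he : e ∈ IsManifold.maximalAtlas (𝓡 n) (⊤ : ℕ∞) X)
    (he' : e' ∈ IsManifold.maximalAtlas (𝓡 n) (⊤ : ℕ∞) X) (ω : Form n X k) {y : 𝔼}
    (hy : y ∈ e.target ∩ e.symm ⁻¹' e'.source) :
    formIn e ω y = (formIn e' ω (e' (e.symm y))).compContinuousLinearMap
      (fderiv ℝ (e' ∘ e.symm) y) := by
  have h2 : e'.symm (e' (e.symm y)) = e.symm y := e'.left_inv hy.2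
  ext v
  unfold formIn
  rw [chartFrame_eq he he' hy, h2]
  rfl

theorem coeffIn_eq (he : e ∈ IsManifold.maximalAtlas (𝓡 n) (⊤ : ℕ∞) X)
    (he' : e' ∈ IsManifold.maximalAtlas (𝓡 n) (⊤ : ℕ∞) X) (ω : Form n X n) {y : 𝔼}
    (hy : y ∈ e.target ∩ e.symm ⁻¹' e'.source) :
    coeffIn e ω y = ((fderiv ℝ (e' ∘ e.symm) y).det : ℂ) * coeffIn e' ω (e' (e.symm y)) := by
  unfold coeffIn
  rw [formIn_eq he he' ω hy]
  exact alternating_complex_comp_det (formIn e' ω (e' (e.symm y))) (fderiv ℝ (e' ∘ e.symm) y) _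

theorem chartSign_eq (o : ManifoldOrientation n X)
    (he : e ∈ IsManifold.maximalAtlas (𝓡 n) (⊤ : ℕ∞) X)
    (he' : e' ∈ IsManifold.maximalAtlas (𝓡 n) (⊤ : ℕ∞) X) {y : 𝔼}
    (hy : y ∈ e.target ∩ e.symm ⁻¹' e'.source) :
    chartSign o e y = ((SignType.sign (fderiv ℝ (e' ∘ e.symm) y).det : SignType) : ℝ) *
      chartSign o e' (e' (e.symm y)) := by
  have h2 : e'.symm (e' (e.symm y)) = e.symm y := e'.left_inv hy.2
  unfold chartSign
  rw [frameSign_comp, frameSign_comp, chartFrame_eq he he' hy, h2, ← mul_assoc, ← SignType.coe_mul,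
    ← sign_mul]
  rw [det_clm_comp, mul_comm (ContinuousLinearMap.det _)]

theorem chartSign_ne_zero (o : ManifoldOrientation n X)
    (he : e ∈ IsManifold.maximalAtlas (𝓡 n) (⊤ : ℕ∞) X) {y : 𝔼} (hy : y ∈ e.target) :
    chartSign o e y ≠ 0 := by
  unfold chartSign
  rw [frameSign_comp]
  refine mul_ne_zero ?_ (frameSign_basis_ne_zero _)
  exact coe_sign_ne_zero (det_chartFrame_ne_zero he hy)

/-- The coordinate expression of a smooth form is smooth in every chart; for top forms. -/
theorem contDiffOn_coeffIn (he : e ∈ IsManifold.maximalAtlas (𝓡 n) (⊤ : ℕ∞) X) {ω : Form n X n}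
    {U : Set X} (hU : IsOpen U) (hω : SmoothFormOn ω U) :
    ContDiffOn ℝ (⊤ : ℕ∞) (coeffIn e ω) (e.target ∩ e.symm ⁻¹' U) := by
  intro y hy
  set e' := chartAt (EuclideanSpace ℝ (Fin n)) (e.symm y) with he'd
  have he' : e' ∈ IsManifold.maximalAtlas (𝓡 n) (⊤ : ℕ∞) X :=
    IsManifold.chart_mem_maximalAtlas (e.symm y)
  have hy' : y ∈ e.target ∩ e.symm ⁻¹' e'.source := ⟨hy.1, mem_chart_source _ _⟩
  have ht := contDiffAt_transition he he' hy'
  have h1 : coeffIn e ω =ᶠ[𝓝 y] fun z => ((fderiv ℝ (e' ∘ e.symm) z).det : ℂ) *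
      coeffIn e' ω ((e' ∘ e.symm) z) := by
    filter_upwards [(e.isOpen_inter_preimage_symm e'.open_source).mem_nhds hy'] with z hz
    exact coeffIn_eq he he' ω hz
  have h2 : ContDiffAt ℝ (⊤ : ℕ∞) (coeffIn e' ω) (e' (e.symm y)) := by
    have h3 := hω (e.symm y)
    have h4 : ContDiffAt ℝ (⊤ : ℕ∞) (inChart ω (e.symm y)) (e' (e.symm y)) := by
      refine h3.contDiffAt (IsOpen.mem_nhds ?_ ⟨?_, ?_⟩)
      · rw [extChartAt_target_eq]
        exact e'.isOpen_inter_preimage_symm hU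
      · rw [extChartAt_target_eq]
        exact e'.map_source hy'.2
      · change e'.symm (e' (e.symm y)) ∈ U
        rw [e'.left_inv hy'.2]
        exact hy.2
    exact ((ContinuousAlternatingMap.apply ℝ _ ℂ
      (fun i => (EuclideanSpace.single i (1 : ℝ) : 𝔼))).contDiff.contDiffAt).comp _ h4
  refine ContDiffAt.contDiffWithinAt ((ContDiffAt.mul ?_ (h2.comp y ht)).congr_of_eventuallyEq h1)
  have h5 : ContDiffAt ℝ (⊤ : ℕ∞) (fderiv ℝ (e' ∘ e.symm)) y :=
    ht.fderiv_right (m := (⊤ : ℕ∞)) (by simp)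
  have h6 : ContDiff ℝ (⊤ : ℕ∞) (fun L : 𝔼 →L[ℝ] 𝔼 => L.det) := by
    exact contDiff_clm_det
  exact Complex.ofRealCLM.contDiff.contDiffAt.comp y (h6.contDiffAt.comp y h5)

end Charts

/-! ### Integration in charts -/

section ChartMeasure

variable {n : ℕ} {X : Type*} [TopologicalSpace X] [ChartedSpace (EuclideanSpace ℝ (Fin n)) X]
  [SecondCountableTopology X] [MeasurableSpace X] [BorelSpace X]

local notation "𝔼" => EuclideanSpace ℝ (Fin n)

variable (n X) in
theorem isChartSelection_chartSel : IsChartSelection n (chartSel n X) :=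
  (exists_chartSelection n X).choose_spec

/-- Lebesgue measure in the coordinates of the chart `e`, as a measure on `X`. -/
noncomputable def chartVolume (e : OpenPartialHomeomorph X (EuclideanSpace ℝ (Fin n))) : Measure X :=
  (Measure.comap Subtype.val (volume : Measure (EuclideanSpace ℝ (Fin n)))).map
    (e.target.domRestrict e.symm)

theorem measurableEmbedding_chart_symm (e : OpenPartialHomeomorph X (EuclideanSpace ℝ (Fin n))) :
    MeasurableEmbedding (e.target.domRestrict e.symm) :=
  (e.symm.isOpenEmbedding_restrict).measurableEmbedding

theorem map_comap_target (e : OpenPartialHomeomorph X (EuclideanSpace ℝ (Fin n))) :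
    (Measure.comap Subtype.val (volume : Measure 𝔼)).map (Subtype.val : e.target → 𝔼) =
      volume.restrict e.target :=
  map_comap_subtype_coe e.open_target.measurableSet _

theorem chartVolume_apply (e : OpenPartialHomeomorph X (EuclideanSpace ℝ (Fin n))) (A : Set X) :
    chartVolume e A = volume (e.symm ⁻¹' A ∩ e.target) := by
  rw [chartVolume, (measurableEmbedding_chart_symm e).map_apply]
  have : e.target.domRestrict e.symm ⁻¹' A = Subtype.val ⁻¹' (e.symm ⁻¹' A) := rfl
  rw [this, ← (MeasurableEmbedding.subtype_coe e.open_target.measurableSet).map_apply,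
    map_comap_target, Measure.restrict_apply' e.open_target.measurableSet]

theorem integrableOn_chartVolume (e : OpenPartialHomeomorph X (EuclideanSpace ℝ (Fin n)))
    (g : 𝔼 → ℂ) (A : Set X) :
    IntegrableOn (fun z => g (e z)) A (chartVolume e) ↔ IntegrableOn g (e.symm ⁻¹' A ∩ e.target) := by
  rw [chartVolume, (measurableEmbedding_chart_symm e).integrableOn_map_iff]
  have h1 : (fun z => g (e z)) ∘ e.target.domRestrict e.symm = g ∘ (Subtype.val : e.target → 𝔼) := by
    funext y
    exact congrArg g (e.right_inv y.2)
  have h2 : e.target.domRestrict e.symm ⁻¹' A = Subtype.val ⁻¹' (e.symm ⁻¹' A) := rfl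
  rw [h1, h2, ← (MeasurableEmbedding.subtype_coe e.open_target.measurableSet).integrableOn_map_iff,
    map_comap_target, IntegrableOn, IntegrableOn,
    Measure.restrict_restrict' e.open_target.measurableSet]

theorem setIntegral_chartVolume (e : OpenPartialHomeomorph X (EuclideanSpace ℝ (Fin n)))
    (g : 𝔼 → ℂ) (A : Set X) :
    ∫ z in A, g (e z) ∂(chartVolume e) = ∫ y in e.symm ⁻¹' A ∩ e.target, g y := by
  rw [chartVolume, (measurableEmbedding_chart_symm e).setIntegral_map]
  have h1 : ∀ y : e.target, g (e (e.target.domRestrict e.symm y)) = g y := by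
    intro y
    exact congrArg g (e.right_inv y.2)
  have h2 : e.target.domRestrict e.symm ⁻¹' A = Subtype.val ⁻¹' (e.symm ⁻¹' A) := rfl
  simp only [h1]
  rw [h2, ← (MeasurableEmbedding.subtype_coe e.open_target.measurableSet).setIntegral_map,
    map_comap_target, Measure.restrict_restrict' e.open_target.measurableSet]

theorem chartMeasure_apply_of_subset {p : X} {A : Set X} (hA : MeasurableSet A)
    (hAp : A ⊆ chartSel n X ⁻¹' {p}) :
    chartMeasure n X A = chartVolume (chartAt (EuclideanSpace ℝ (Fin n)) p) A := by
  rw [chartMeasure, Measure.sum_apply _ hA, tsum_eq_single p]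
  · rw [Measure.restrict_apply hA, inter_eq_self_of_subset_left hAp, chartVolume_apply,
      Measure.map_apply_of_aemeasurable _ hA, Measure.restrict_apply' , extChartAt_target_eq,
      extChartAt_symm_eq]
    · rw [extChartAt_target_eq]
      exact (chartAt 𝔼 p).open_target.measurableSet
    · rw [extChartAt_target_eq, extChartAt_symm_eq]
      exact (chartAt 𝔼 p).continuousOn_symm.aemeasurable (chartAt 𝔼 p).open_target.measurableSet
  · intro q hq
    rw [Measure.restrict_apply hA]
    have : A ∩ chartSel n X ⁻¹' {q} = ∅ := by
      ext z
      simp only [mem_inter_iff, mem_preimage, mem_singleton_iff, mem_empty_iff_false, iff_false,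
        not_and]
      intro hz hzq
      exact hq (hzq.symm.trans (hAp hz))
    rw [this, measure_empty]

/-- The Jacobian of the chart `e` with respect to the selected charts. -/
noncomputable def chartJacobian (e : OpenPartialHomeomorph X (EuclideanSpace ℝ (Fin n)))
    (z : X) : ℝ :=
  |(fderiv ℝ (e ∘ (chartAt (EuclideanSpace ℝ (Fin n)) (chartSel n X z)).symm)
    (chartAt (EuclideanSpace ℝ (Fin n)) (chartSel n X z) z)).det|

variable (n) in
theorem iUnion_fiber_inter (A : Set X) :
    ⋃ p : range (chartSel n X), chartSel n X ⁻¹' {(p : X)} ∩ A = A := by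
  ext z
  simp

variable [IsManifold (𝓡 n) (⊤ : ℕ∞) X]

variable {e : OpenPartialHomeomorph X (EuclideanSpace ℝ (Fin n))}

theorem aemeasurable_chartJacobian (he : e ∈ IsManifold.maximalAtlas (𝓡 n) (⊤ : ℕ∞) X)
    (ν : Measure X) : AEMeasurable (chartJacobian e) (ν.restrict e.source) := by
  have hc := isChartSelection_chartSel n X
  haveI : Countable (range (chartSel n X)) := hc.countable_range.to_subtype
  rw [← iUnion_fiber_inter n e.source, aemeasurable_iUnion_iff]
  rintro ⟨p, -⟩
  have hp := IsManifold.chart_mem_maximalAtlas (I := 𝓡 n) (n := (⊤ : ℕ∞)) p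
  have hsub : chartSel n X ⁻¹' {p} ∩ e.source ⊆ (chartAt 𝔼 p).source ∩ e.source := by
    rintro z ⟨hz, hze⟩
    have h1 := hc.mem_source z
    rw [show chartSel n X z = p from hz] at h1
    exact ⟨h1, hze⟩
  have h1 : ContinuousOn (fun z => |(fderiv ℝ (e ∘ (chartAt 𝔼 p).symm) (chartAt 𝔼 p z)).det|)
      (chartSel n X ⁻¹' {p} ∩ e.source) := by
    have h2 : ContinuousOn (fderiv ℝ (e ∘ (chartAt 𝔼 p).symm))
        ((chartAt 𝔼 p).target ∩ (chartAt 𝔼 p).symm ⁻¹' e.source) :=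
      (contDiffOn_transition hp he).continuousOn_fderiv_of_isOpen
        ((chartAt 𝔼 p).isOpen_inter_preimage_symm e.open_source) (by simp)
    refine ((contDiff_clm_det.continuous.comp_continuousOn h2).comp
      ((chartAt 𝔼 p).continuousOn.mono fun z hz => (hsub hz).1) fun z hz => ?_).abs
    refine ⟨(chartAt 𝔼 p).map_source (hsub hz).1, ?_⟩
    change (chartAt 𝔼 p).symm (chartAt 𝔼 p z) ∈ e.source
    rw [(chartAt 𝔼 p).left_inv (hsub hz).1]
    exact hz.2
  have hm : MeasurableSet (chartSel n X ⁻¹' {p} ∩ e.source) :=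
    (hc.measurable_fiber p).inter e.open_source.measurableSet
  refine (h1.aemeasurable hm).congr ?_
  filter_upwards [ae_restrict_mem hm] with z hz
  unfold chartJacobian
  rw [show chartSel n X z = p from hz.1]

theorem chartVolume_eq_of_subset (he : e ∈ IsManifold.maximalAtlas (𝓡 n) (⊤ : ℕ∞) X) {p : X}
    {A : Set X} (hA : MeasurableSet A) (hAp : A ⊆ chartSel n X ⁻¹' {p}) (hAe : A ⊆ e.source) :
    chartVolume e A = ∫⁻ z in A, ENNReal.ofReal (chartJacobian e z) ∂(chartMeasure n X) := by
  have hc := isChartSelection_chartSel n X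
  set e' := chartAt 𝔼 p with he'
  have hp : e' ∈ IsManifold.maximalAtlas (𝓡 n) (⊤ : ℕ∞) X := IsManifold.chart_mem_maximalAtlas p
  have hAs : A ⊆ e'.source := fun z hz => by
    have h1 := hc.mem_source z
    rwa [show chartSel n X z = p from hAp hz] at h1
  have hν : (chartMeasure n X).restrict A = (chartVolume e').restrict A := by
    ext B hB
    rw [Measure.restrict_apply hB, Measure.restrict_apply hB,
      chartMeasure_apply_of_subset (hB.inter hA) (inter_subset_right.trans hAp)]
  have hJ : ∀ z ∈ A, ENNReal.ofReal (chartJacobian e z) =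
      ENNReal.ofReal |(fderiv ℝ (e ∘ e'.symm) (e' z)).det| := by
    intro z hz
    unfold chartJacobian
    rw [show chartSel n X z = p from hAp hz]
  rw [hν, setLIntegral_congr_fun hA hJ, chartVolume.eq_def e',
    (measurableEmbedding_chart_symm e').restrict_map, (measurableEmbedding_chart_symm e').lintegral_map]
  set B : Set 𝔼 := e'.symm ⁻¹' A ∩ e'.target with hB
  have hBm : MeasurableSet B := by
    have h1 := (measurableEmbedding_chart_symm e').measurable hA
    have h2 := (MeasurableEmbedding.subtype_coe e'.open_target.measurableSet).measurableSet_image.2 h1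
    have h3 : B = Subtype.val '' (e'.target.domRestrict e'.symm ⁻¹' A) := by
      ext y
      simp [hB, and_comm]
    rwa [h3]
  have h1 : ∀ y : e'.target, ENNReal.ofReal |(fderiv ℝ (e ∘ e'.symm)
      (e' (e'.target.domRestrict e'.symm y))).det| =
      ENNReal.ofReal |(fderiv ℝ (e ∘ e'.symm) (y : 𝔼)).det| := by
    intro y
    rw [show e' (e'.target.domRestrict e'.symm y) = y from e'.right_inv y.2]
  have h2 : e'.target.domRestrict e'.symm ⁻¹' A = Subtype.val ⁻¹' (e'.symm ⁻¹' A) := rfl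
  simp only [h1]
  have hemb := MeasurableEmbedding.subtype_coe e'.open_target.measurableSet
  rw [h2, ← hemb.lintegral_map (fun y : 𝔼 => ENNReal.ofReal |(fderiv ℝ (e ∘ e'.symm) y).det|),
    ← hemb.restrict_map, map_comap_target, Measure.restrict_restrict' e'.open_target.measurableSet]
  have hBe : ∀ y ∈ B, y ∈ e'.target ∩ e'.symm ⁻¹' e.source := fun y hy => ⟨hy.2, hAe hy.1⟩
  rw [lintegral_abs_det_fderiv_eq_addHaar_image volume hBm
    (fun y hy => ((contDiffAt_transition hp he (hBe y hy)).differentiableAt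
      (by simp)).hasFDerivAt.hasFDerivWithinAt) ?_]
  · change chartVolume e A = _
    rw [chartVolume_apply]
    congr 1
    ext y
    constructor
    · rintro ⟨hy1, hy2⟩
      refine ⟨e' (e.symm y), ⟨?_, e'.map_source (hAs hy1)⟩, ?_⟩
      · change e'.symm (e' (e.symm y)) ∈ A
        rw [e'.left_inv (hAs hy1)]
        exact hy1
      · change e (e'.symm (e' (e.symm y))) = y
        rw [e'.left_inv (hAs hy1), e.right_inv hy2]
    · rintro ⟨x, hx, rfl⟩
      refine ⟨?_, e.map_source (hBe x hx).2⟩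
      change e.symm (e (e'.symm x)) ∈ A
      rw [e.left_inv (hBe x hx).2]
      exact hx.1
  · intro x hx y hy hxy
    have h3 : e'.symm x = e'.symm y := e.injOn (hBe x hx).2 (hBe y hy).2 hxy
    exact e'.symm.injOn hx.2 hy.2 h3

/-- The change of variables between a chart and the selected charts, assembled over the pieces of the
chart selection. -/
theorem chartVolume_restrict (he : e ∈ IsManifold.maximalAtlas (𝓡 n) (⊤ : ℕ∞) X)
    {A : Set X} (hA : MeasurableSet A) (hAe : A ⊆ e.source) :
    (chartVolume e).restrict A = ((chartMeasure n X).restrict A).withDensity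
      fun z => ENNReal.ofReal (chartJacobian e z) := by
  have hc := isChartSelection_chartSel n X
  haveI : Countable (range (chartSel n X)) := hc.countable_range.to_subtype
  ext B hB
  rw [Measure.restrict_apply hB, withDensity_apply _ hB, Measure.restrict_restrict hB]
  set C := B ∩ A
  have hC : MeasurableSet C := hB.inter hA
  have hm : ∀ p : range (chartSel n X), MeasurableSet (chartSel n X ⁻¹' {(p : X)} ∩ C) :=
    fun p => (hc.measurable_fiber p).inter hC
  have hd : Pairwise (Function.onFun Disjoint
      fun p : range (chartSel n X) => chartSel n X ⁻¹' {(p : X)} ∩ C) := by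
    intro p q hpq
    rw [Function.onFun, disjoint_left]
    rintro z ⟨hz, -⟩ ⟨hz', -⟩
    exact hpq (Subtype.ext ((show chartSel n X z = p from hz).symm.trans hz'))
  rw [← iUnion_fiber_inter n C, measure_iUnion hd hm, lintegral_iUnion hm hd]
  refine tsum_congr fun p => ?_
  exact chartVolume_eq_of_subset he (hm p) inter_subset_left
    ((inter_subset_right.trans inter_subset_right).trans hAe)

/-- In another chart, the density changes by the absolute value of the Jacobian: the determinant from
the top form and its sign from the orientation combine. -/
theorem density_eq (o : ManifoldOrientation n X)
    (he : e ∈ IsManifold.maximalAtlas (𝓡 n) (⊤ : ℕ∞) X) (ω : Form n X n) {z : X}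
    (hz : z ∈ e.source) :
    density o ω z = (chartJacobian e z : ℂ) * ((chartSign o e (e z) : ℂ) * coeffIn e ω (e z)) := by
  set e' := chartAt 𝔼 (chartSel n X z) with he'd
  have he' : e' ∈ IsManifold.maximalAtlas (𝓡 n) (⊤ : ℕ∞) X :=
    IsManifold.chart_mem_maximalAtlas _
  have hz' : z ∈ e'.source := (isChartSelection_chartSel n X).mem_source z
  have h0 : e'.symm (e' z) = z := e'.left_inv hz'
  have hmem : e' z ∈ e'.target ∩ e'.symm ⁻¹' e.source := by
    refine ⟨e'.map_source hz', ?_⟩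
    rw [mem_preimage, h0]
    exact hz
  have h1 : density o ω z = (chartSign o e' (e' z) : ℂ) * coeffIn e' ω (e' z) := rfl
  rw [h1, chartSign_eq o he' he hmem, coeffIn_eq he' he ω hmem, h0]
  have h2 : chartJacobian e z = |(fderiv ℝ (e ∘ e'.symm) (e' z)).det| := rfl
  rw [h2]
  set d := (fderiv ℝ (e ∘ e'.symm) (e' z)).det
  have h3 : (((SignType.sign d : SignType) : ℝ) : ℂ) * (d : ℂ) = ((|d| : ℝ) : ℂ) := by
    rw [← Complex.ofReal_mul, sign_mul_self]
  rw [← h3]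
  push_cast
  ring

/-- Integrals of top forms over subsets of a chart domain, on which the sign of the coordinate
frame is constant, are Lebesgue integrals of the coefficient. -/
theorem formIntegrableOn_iff_coeffIn (o : ManifoldOrientation n X)
    (he : e ∈ IsManifold.maximalAtlas (𝓡 n) (⊤ : ℕ∞) X) (ω : Form n X n) {A : Set X}
    (hA : MeasurableSet A) (hAe : A ⊆ e.source) {σ : ℝ} (hσ : σ ≠ 0)
    (hs : ∀ z ∈ A, chartSign o e (e z) = σ) :
    (FormIntegrableOn o ω A ↔ IntegrableOn (coeffIn e ω) (e.symm ⁻¹' A ∩ e.target)) ∧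
      formIntegral o ω A = σ * ∫ y in e.symm ⁻¹' A ∩ e.target, coeffIn e ω y := by
  have hm : AEMeasurable (fun z => ENNReal.ofReal (chartJacobian e z))
      ((chartMeasure n X).restrict A) :=
    ((aemeasurable_chartJacobian he (chartMeasure n X)).mono_measure
      (Measure.restrict_mono hAe le_rfl)).ennreal_ofReal
  have hJ : ∀ z, 0 ≤ chartJacobian e z := fun z => abs_nonneg _
  have hd : ∀ z ∈ A, density o ω z =
      (σ : ℂ) • ((ENNReal.ofReal (chartJacobian e z)).toReal • coeffIn e ω (e z)) := by
    intro z hz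
    rw [density_eq o he ω (hAe hz), hs z hz, ENNReal.toReal_ofReal (hJ z), Complex.real_smul,
      smul_eq_mul]
    ring
  have hlt : ∀ᵐ z ∂((chartMeasure n X).restrict A), ENNReal.ofReal (chartJacobian e z) < ⊤ :=
    Eventually.of_forall fun z => ENNReal.ofReal_lt_top
  constructor
  · rw [← integrableOn_chartVolume, FormIntegrableOn, integrableOn_congr_fun hd hA, IntegrableOn,
      IntegrableOn]
    rw [show (fun z => (σ : ℂ) • ((ENNReal.ofReal (chartJacobian e z)).toReal • coeffIn e ω (e z))) =
      (σ : ℂ) • (fun z => (ENNReal.ofReal (chartJacobian e z)).toReal • coeffIn e ω (e z)) from rfl,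
      integrable_smul_iff (by exact_mod_cast hσ), chartVolume_restrict he hA hAe,
      integrable_withDensity_iff_integrable_smul₀' hm hlt]
  · rw [← setIntegral_chartVolume, formIntegral, setIntegral_congr_fun hA hd, integral_smul,
      chartVolume_restrict he hA hAe, integral_withDensity_eq_integral_toReal_smul₀ hm hlt,
      smul_eq_mul]

/-- The sign of the coordinate frame of a chart is locally constant. -/
theorem exists_open_chartSign_const (o : ManifoldOrientation n X)
    (he : e ∈ IsManifold.maximalAtlas (𝓡 n) (⊤ : ℕ∞) X) {x : X} (hx : x ∈ e.source) :
    ∃ O : Set X, IsOpen O ∧ x ∈ O ∧ O ⊆ e.source ∧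
      ∀ z ∈ O, chartSign o e (e z) = chartSign o e (e x) := by
  set e' := chartAt 𝔼 x with he'd
  have he' : e' ∈ IsManifold.maximalAtlas (𝓡 n) (⊤ : ℕ∞) X := IsManifold.chart_mem_maximalAtlas _
  have hx' : x ∈ e'.source := mem_chart_source _ _
  have hO : IsOpen (e.source ∩ e'.source) := e.open_source.inter e'.open_source
  have hmem : ∀ z ∈ e.source ∩ e'.source, e z ∈ e.target ∩ e.symm ⁻¹' e'.source := by
    rintro z ⟨hz, hz'⟩
    refine ⟨e.map_source hz, ?_⟩
    rw [mem_preimage, e.left_inv hz]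
    exact hz'
  have hsc : ContinuousAt (fun d : ℝ => ((SignType.sign d : SignType) : ℝ))
      (fderiv ℝ (e' ∘ e.symm) (e x)).det := by
    have hne := det_transition_ne_zero he he' (hmem x ⟨hx, hx'⟩)
    have h1 : (fun d : ℝ => ((SignType.sign d : SignType) : ℝ)) =ᶠ[𝓝
        (fderiv ℝ (e' ∘ e.symm) (e x)).det]
        fun _ => ((SignType.sign (fderiv ℝ (e' ∘ e.symm) (e x)).det : SignType) : ℝ) := by
      rcases lt_or_gt_of_ne hne with h | h
      · filter_upwards [eventually_lt_nhds h] with d hd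
        rw [sign_neg hd, sign_neg h]
      · filter_upwards [eventually_gt_nhds h] with d hd
        rw [sign_pos hd, sign_pos h]
    exact h1.continuousAt
  have h1 : ContinuousAt (fun z => chartSign o e (e z)) x := by
    have h2 : (fun z => chartSign o e (e z)) =ᶠ[𝓝 x] fun z =>
        ((SignType.sign (fderiv ℝ (e' ∘ e.symm) (e z)).det : SignType) : ℝ) *
          chartSign o e' (e' z) := by
      filter_upwards [hO.mem_nhds ⟨hx, hx'⟩] with z hz
      rw [chartSign_eq o he he' (hmem z hz), e.left_inv hz.1]
    refine ContinuousAt.congr ?_ h2.symm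
    refine ContinuousAt.mul ?_ ?_
    · have h3 : ContinuousAt (fun z => (fderiv ℝ (e' ∘ e.symm) (e z)).det) x := by
        have h4 : ContinuousAt (fderiv ℝ (e' ∘ e.symm)) (e x) :=
          ((contDiffAt_transition he he' (hmem x ⟨hx, hx'⟩)).fderiv_right
            (m := (⊤ : ℕ∞)) (by simp)).continuousAt
        exact contDiff_clm_det.continuous.continuousAt.comp
          (ContinuousAt.comp (f := e) h4 (e.continuousAt hx))
      exact ContinuousAt.comp (f := fun z => (fderiv ℝ (e' ∘ e.symm) (e z)).det) hsc h3
    · have h5 : ContinuousOn (chartSign o e') e'.target := by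
        have := o.locally_const x
        rw [extChartAt_target_eq] at this
        exact this
      exact ContinuousAt.comp (f := e') (h5.continuousAt
        (e'.open_target.mem_nhds (e'.map_source hx'))) (e'.continuousAt hx')
  -- Signs are integers, so a sign that varies by less than `1` is constant.
  have hval : ∀ t : SignType, ∀ t' : SignType, |((t : ℝ)) - (t' : ℝ)| < 1 → (t : ℝ) = t' := by
    intro t t'
    cases t <;> cases t' <;> norm_num
  have h2 : ∀ᶠ z in 𝓝 x, |chartSign o e (e z) - chartSign o e (e x)| < 1 := by
    exact h1.eventually (Metric.ball_mem_nhds _ one_pos)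
  obtain ⟨O, hO1, hO2, hO3⟩ := _root_.mem_nhds_iff.1 h2
  exact ⟨O ∩ e.source, hO2.inter e.open_source, ⟨hO3, hx⟩, inter_subset_right, fun z hz =>
    hval _ _ (hO1 hz.1)⟩

end ChartMeasure

/-! ### Polar coordinates -/

section Polar

variable {m : ℕ} {W : Type} [NormedAddCommGroup W] [MeasureSpace W]
  [BorelSpace W] [SecondCountableTopology W] [SFinite (volume : Measure W)]

local notation "𝕌" => EuclideanSpace ℝ (Fin m)

variable (m) in
/-- The surface measure of the unit sphere, as a measure on the ambient space. -/
noncomputable def sphereMeasure : Measure (EuclideanSpace ℝ (Fin m)) :=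
  (volume : Measure (EuclideanSpace ℝ (Fin m))).toSphere.map Subtype.val

instance : IsFiniteMeasure (sphereMeasure m) := by
  unfold sphereMeasure
  infer_instance

theorem ae_sphereMeasure : ∀ᵐ θ ∂(sphereMeasure m), θ ∈ Metric.sphere (0 : 𝕌) 1 := by
  unfold sphereMeasure
  rw [(MeasurableEmbedding.subtype_coe Metric.isClosed_sphere.measurableSet).ae_map_iff]
  exact Eventually.of_forall fun θ => θ.2

open scoped Pointwise in
/-- The symmetry of the sphere responsible for the evenness of spherical averages in the radius. -/
theorem map_neg_sphereMeasure : (sphereMeasure m).map Neg.neg = sphereMeasure m := by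
  have hemb := MeasurableEmbedding.subtype_coe
    (Metric.isClosed_sphere (x := (0 : 𝕌)) (ε := 1)).measurableSet
  ext s hs
  rw [Measure.map_apply measurable_neg hs, sphereMeasure,
    Measure.map_apply measurable_subtype_coe (measurable_neg hs),
    Measure.map_apply measurable_subtype_coe hs,
    Measure.toSphere_apply' _ (measurable_subtype_coe (measurable_neg hs)),
    Measure.toSphere_apply' _ (measurable_subtype_coe hs)]
  congr 1
  have h1 : Ioo (0 : ℝ) 1 • ((↑) '' ((Subtype.val : Metric.sphere (0 : 𝕌) 1 → 𝕌) ⁻¹' (Neg.neg ⁻¹' s)) : Set 𝕌) =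
      Neg.neg ⁻¹' (Ioo (0 : ℝ) 1 • ((↑) '' ((Subtype.val : Metric.sphere (0 : 𝕌) 1 → 𝕌) ⁻¹' s) : Set 𝕌)) := by
    ext x
    simp only [Set.mem_smul, mem_preimage, Subtype.image_preimage_coe, mem_inter_iff]
    constructor
    · rintro ⟨r, hr, θ, ⟨h1, h2⟩, rfl⟩
      exact ⟨r, hr, -θ, ⟨by simpa using h1, h2⟩, by simp⟩
    · rintro ⟨r, hr, θ, ⟨h1, h2⟩, h3⟩
      refine ⟨r, hr, -θ, ⟨by simpa using h1, by simpa using h2⟩, ?_⟩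
      have h4 : r • θ = -x := h3
      change r • -θ = x
      rw [smul_neg, h4, neg_neg]
  rw [h1]
  exact Measure.measure_preimage_neg _ _

/-- Integration in polar coordinates in the first variable. -/
theorem integrable_polar_iff (hm : 1 ≤ m) (F : 𝕌 × W → ℂ) :
    (Integrable F ↔ Integrable (fun p : ℝ × (𝕌 × W) =>
      ((p.1 ^ (m - 1) : ℝ) : ℂ) * F (p.1 • p.2.1, p.2.2))
        ((volume.restrict (Ioi 0)).prod ((sphereMeasure m).prod volume))) ∧
    ∫ x, F x = ∫ p : ℝ × (𝕌 × W), ((p.1 ^ (m - 1) : ℝ) : ℂ) * F (p.1 • p.2.1, p.2.2)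
      ∂((volume.restrict (Ioi 0)).prod ((sphereMeasure m).prod volume)) := by
  haveI : Nonempty (Fin m) := ⟨⟨0, hm⟩⟩
  set σ := (volume : Measure 𝕌).toSphere with hσ
  set l : Measure (Ioi (0 : ℝ)) := Measure.comap Subtype.val volume with hl
  haveI : SigmaFinite l := by
    refine SigmaFinite.of_map l measurable_subtype_coe.aemeasurable ?_
    rw [hl, map_comap_subtype_coe measurableSet_Ioi]
    infer_instance
  set M : Measure ((Metric.sphere (0 : 𝕌) 1 × Ioi (0 : ℝ)) × W) := (σ.prod l).prod volume with hM
  let d : (Metric.sphere (0 : 𝕌) 1 × Ioi (0 : ℝ)) × W → ENNReal :=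
    fun x => ENNReal.ofReal (x.1.2.1 ^ (m - 1))
  have hdm : Measurable d := by fun_prop
  have hMd : (σ.prod (Measure.volumeIoiPow (m - 1))).prod (volume : Measure W) = M.withDensity d := by
    have hmm : Measurable fun r : Ioi (0 : ℝ) => ENNReal.ofReal (r.1 ^ (m - 1)) := by fun_prop
    rw [Measure.volumeIoiPow, prod_withDensity_right hmm, prod_withDensity_left (by fun_prop)]
  -- the map `((θ, r), w) ↦ (r θ, w)`
  let κ₂ : (Metric.sphere (0 : 𝕌) 1 × Ioi (0 : ℝ)) × W → 𝕌 × W :=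
    Prod.map (Subtype.val ∘ (homeomorphUnitSphereProd 𝕌).symm) id
  have hemb₂ : MeasurableEmbedding κ₂ :=
    ((MeasurableEmbedding.subtype_coe (measurableSet_singleton (0 : 𝕌)).compl).comp
      (homeomorphUnitSphereProd 𝕌).symm.measurableEmbedding).prodMap MeasurableEmbedding.id
  have hmp₂ : MeasurePreserving κ₂ (M.withDensity d) volume := by
    rw [← hMd]
    refine MeasurePreserving.prod ?_ (MeasurePreserving.id volume)
    have h1 := (volume : Measure 𝕌).measurePreserving_homeomorphUnitSphereProd
    rw [finrank_euclideanSpace_fin] at h1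
    have h2 := h1.symm (homeomorphUnitSphereProd 𝕌).toMeasurableEquiv
    have h3 : MeasurePreserving (Subtype.val : ({0}ᶜ : Set 𝕌) → 𝕌)
        (Measure.comap Subtype.val volume) volume := by
      refine ⟨measurable_subtype_coe, ?_⟩
      rw [map_comap_subtype_coe (measurableSet_singleton (0 : 𝕌)).compl, restrict_compl_singleton]
    exact h3.comp h2
  let κ : (Metric.sphere (0 : 𝕌) 1 × Ioi (0 : ℝ)) × W → ℝ × (𝕌 × W) :=
    fun x => (x.1.2.1, (x.1.1.1, x.2))
  have hmp : MeasurePreserving κ M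
      ((volume.restrict (Ioi 0)).prod ((sphereMeasure m).prod volume)) := by
    have h1 : MeasurePreserving (Prod.map Prod.swap id :
        (Metric.sphere (0 : 𝕌) 1 × Ioi (0 : ℝ)) × W → (Ioi (0 : ℝ) × Metric.sphere (0 : 𝕌) 1) × W)
        M ((l.prod σ).prod volume) :=
      Measure.measurePreserving_swap.prod (MeasurePreserving.id volume)
    have h2 : MeasurePreserving (MeasurableEquiv.prodAssoc :
        (Ioi (0 : ℝ) × Metric.sphere (0 : 𝕌) 1) × W ≃ᵐ _) ((l.prod σ).prod volume)
        (l.prod (σ.prod volume)) := measurePreserving_prodAssoc l σ volume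
    have h3 : MeasurePreserving (Subtype.val : Ioi (0 : ℝ) → ℝ) l (volume.restrict (Ioi 0)) :=
      ⟨measurable_subtype_coe, map_comap_subtype_coe measurableSet_Ioi _⟩
    have h4 : MeasurePreserving (Subtype.val : Metric.sphere (0 : 𝕌) 1 → 𝕌) σ (sphereMeasure m) :=
      ⟨measurable_subtype_coe, rfl⟩
    exact (h3.prod (h4.prod (MeasurePreserving.id volume))).comp (h2.comp h1)
  have hemb : MeasurableEmbedding κ := by
    have h1 : MeasurableEmbedding (Prod.map Prod.swap id :
        (Metric.sphere (0 : 𝕌) 1 × Ioi (0 : ℝ)) × W → (Ioi (0 : ℝ) × Metric.sphere (0 : 𝕌) 1) × W) :=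
      (MeasurableEquiv.prodComm (α := Metric.sphere (0 : 𝕌) 1) (β := Ioi (0 : ℝ))).measurableEmbedding.prodMap
        MeasurableEmbedding.id
    have h2 := (MeasurableEquiv.prodAssoc :
        (Ioi (0 : ℝ) × Metric.sphere (0 : 𝕌) 1) × W ≃ᵐ _).measurableEmbedding
    have h3 := (MeasurableEmbedding.subtype_coe (measurableSet_Ioi (a := (0 : ℝ)))).prodMap
      ((MeasurableEmbedding.subtype_coe
        (Metric.isClosed_sphere (x := (0 : 𝕌)) (ε := 1)).measurableSet).prodMap
        (MeasurableEmbedding.id : MeasurableEmbedding (id : W → W)))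
    exact h3.comp (h2.comp h1)
  have hk : ∀ x, F (κ₂ x) = F ((κ x).1 • (κ x).2.1, (κ x).2.2) := fun x => rfl
  have hlt : ∀ᵐ x ∂M, d x < ⊤ := Eventually.of_forall fun x => ENNReal.ofReal_lt_top
  have hd : ∀ x, (d x).toReal • F (κ₂ x) =
      (((κ x).1 ^ (m - 1) : ℝ) : ℂ) * F ((κ x).1 • (κ x).2.1, (κ x).2.2) := fun x => by
    rw [hk, Complex.real_smul]
    congr 2
    exact ENNReal.toReal_ofReal (pow_nonneg (le_of_lt x.1.2.2) _)
  constructor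
  · rw [← hmp₂.integrable_comp_emb hemb₂, integrable_withDensity_iff_integrable_smul' hdm hlt,
      ← hmp.integrable_comp_emb hemb]
    exact iff_of_eq (congrArg (Integrable · M) (funext hd))
  · rw [← hmp₂.integral_comp hemb₂, integral_withDensity_eq_integral_toReal_smul hdm hlt,
      ← hmp.integral_comp hemb]
    exact congrArg _ (funext hd)

end Polar

/-! ### Morse–Bott charts -/

section Hessian

/-- At a critical point the second derivative transforms as a bilinear form. -/
theorem fderiv_fderiv_comp_of_critical {E F : Type*} [NormedAddCommGroup E] [NormedSpace ℝ E]
    [NormedAddCommGroup F] [NormedSpace ℝ F] {g : F → ℝ} {τ : E → F} {p : E}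
    (hg : ContDiffAt ℝ (⊤ : ℕ∞) g (τ p)) (hτ : ContDiffAt ℝ (⊤ : ℕ∞) τ p)
    (h0 : fderiv ℝ g (τ p) = 0) (v w : E) :
    fderiv ℝ (fderiv ℝ (g ∘ τ)) p v w =
      fderiv ℝ (fderiv ℝ g) (τ p) (fderiv ℝ τ p v) (fderiv ℝ τ p w) := by
  have hg' : ∀ᶠ y in 𝓝 (τ p), DifferentiableAt ℝ g y := by
    filter_upwards [(hg.of_le (m := 1) (by exact_mod_cast le_top)).eventually (by simp)] with y hy
    exact hy.differentiableAt (by simp)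
  have hτ' : ∀ᶠ y in 𝓝 p, DifferentiableAt ℝ τ y := by
    filter_upwards [(hτ.of_le (m := 1) (by exact_mod_cast le_top)).eventually (by simp)] with y hy
    exact hy.differentiableAt (by simp)
  have h1 : fderiv ℝ (g ∘ τ) =ᶠ[𝓝 p] fun y => (fderiv ℝ g (τ y)).comp (fderiv ℝ τ y) := by
    filter_upwards [hτ', hτ.continuousAt.eventually hg'] with y hy1 hy2
    exact fderiv_comp y hy2 hy1
  have h2 : HasFDerivAt (fun y => fderiv ℝ g (τ y))
      ((fderiv ℝ (fderiv ℝ g) (τ p)).comp (fderiv ℝ τ p)) p := by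
    have h3 : ContDiffAt ℝ (⊤ : ℕ∞) (fderiv ℝ g) (τ p) := hg.fderiv_right (m := (⊤ : ℕ∞)) (by simp)
    exact (h3.differentiableAt (by simp)).hasFDerivAt.comp p
      (hτ.differentiableAt (by simp)).hasFDerivAt
  have h4 : HasFDerivAt (fderiv ℝ τ) (fderiv ℝ (fderiv ℝ τ) p) p :=
    ((hτ.fderiv_right (m := (⊤ : ℕ∞)) (by simp)).differentiableAt (by simp)).hasFDerivAt
  have h5 := h2.clm_comp h4
  rw [h1.fderiv_eq, h5.fderiv, h0]
  simp

variable {m : ℕ} {W : Type} [NormedAddCommGroup W] [NormedSpace ℝ W] [FiniteDimensional ℝ W]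

local notation "𝕌" => EuclideanSpace ℝ (Fin m)

/-- If the kernel of the Hessian at a point of `{u = 0}` is not larger than the tangent space of
`{u = 0}`, then the Hessian is positive in the direction of `u`. -/
theorem hessian_pos_of_finrank_ker {f : 𝕌 × W → ℝ} (hf : ContDiff ℝ (⊤ : ℕ∞) f)
    (hf0 : ∀ p, 0 ≤ f p) (hfz : ∀ w, f (0, w) = 0) (w₀ : W)
    (hker : Module.finrank ℝ (LinearMap.ker (fderiv ℝ (fderiv ℝ f) (0, w₀)).toLinearMap) ≤
      Module.finrank ℝ W) (u : 𝕌) (hu : u ≠ 0) :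
    0 < fderiv ℝ (fderiv ℝ f) (0, w₀) (u, 0) (u, 0) := by
  obtain ⟨A, hA, hAs, hAf, hA0⟩ := exists_quadratic_form hf hf0 hfz
  set Q := fderiv ℝ (fderiv ℝ f) (0, w₀) with hQ
  have hsym : ∀ x y, Q x y = Q y x := fun x y =>
    (hf.contDiffAt.isSymmSndFDerivAt (by simp; norm_cast) : IsSymmSndFDerivAt ℝ f (0, w₀)).eq x y
  have hf1 : ContDiff ℝ (⊤ : ℕ∞) (fderiv ℝ f) := hf.fderiv_right (m := (⊤ : ℕ∞)) (by simp)
  have hQw : ∀ w : W, Q (0, w) = 0 := by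
    intro w
    have hline : HasDerivAt (fun t : ℝ => ((0, w₀ + t • w) : 𝕌 × W)) (0, w) 0 := by
      have := ((hasDerivAt_id (0 : ℝ)).smul_const w).const_add w₀
      simpa using (hasDerivAt_const (0 : ℝ) (0 : 𝕌)).prodMk this
    have h0 : ∀ w, fderiv ℝ f (0, w) = 0 := fun w => by
      have : IsLocalMin f (0, w) := Eventually.of_forall fun p => by rw [hfz]; exact hf0 p
      exact this.fderiv_eq_zero
    have h1 : HasFDerivAt (fderiv ℝ f) Q ((fun t : ℝ => ((0, w₀ + t • w) : 𝕌 × W)) 0) := by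
      simpa using (hf1.differentiable (by simp) (0, w₀)).hasFDerivAt
    have h2 := h1.comp_hasDerivAt 0 hline
    have h3 : fderiv ℝ f ∘ (fun t : ℝ => ((0, w₀ + t • w) : 𝕌 × W)) = fun _ => 0 := by
      funext t
      exact h0 _
    rw [h3] at h2
    exact h2.unique (hasDerivAt_const _ _)
  -- `A₀` is positive semidefinite: divide `f (t u, w₀) ≥ 0` by `t²` and let `t` tend to `0`.
  set A₀ := A (0, w₀) with hA₀
  have hpsd : ∀ u : 𝕌, 0 ≤ inner ℝ (A₀ u) u := by
    intro u
    have h1 : Tendsto (fun t : ℝ => inner ℝ (A (t • u, w₀) u) u) (𝓝[>] 0)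
        (𝓝 (inner ℝ (A₀ u) u)) := by
      have hc : Continuous fun t : ℝ => inner ℝ (A (t • u, w₀) u) u :=
        ((hA.continuous.comp (by fun_prop : Continuous fun t : ℝ => ((t • u, w₀) : 𝕌 × W))).clm_apply
          continuous_const).inner continuous_const
      have := (hc.tendsto 0).mono_left (nhdsWithin_le_nhds (s := Ioi 0))
      simpa using this
    refine ge_of_tendsto h1 ?_
    filter_upwards [self_mem_nhdsWithin] with t (ht : 0 < t)
    have h2 := hf0 (t • u, w₀)
    rw [hAf, map_smul, real_inner_smul_left, real_inner_smul_right] at h2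
    by_contra h3
    push Not at h3
    have := mul_neg_of_pos_of_neg ht (mul_neg_of_pos_of_neg ht h3)
    linarith
  by_contra hcon
  have hzero : inner ℝ (A₀ u) u = 0 := by
    refine le_antisymm ?_ (hpsd u)
    rw [hA0]
    linarith
  -- A semidefinite form vanishing at `u` has `u` in its kernel: with `v = A₀ u`, the form at `u + t v`
  -- is negative for a suitable `t < 0` unless `v = 0`.
  have hA₀u : A₀ u = 0 := by
    set v := A₀ u with hv
    set c := inner ℝ (A₀ v) v with hc
    have hc0 : 0 ≤ c := hpsd v
    have hvv : inner ℝ v v = ‖v‖ ^ 2 := real_inner_self_eq_norm_sq v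
    set q := ‖v‖ ^ 2 with hq
    have h1 : ∀ t : ℝ, 0 ≤ 2 * t * q + t ^ 2 * c := by
      intro t
      have h2 := hpsd (u + t • v)
      rw [map_add, map_smul, inner_add_left, inner_add_right, inner_add_right,
        real_inner_smul_left, real_inner_smul_left, real_inner_smul_right, real_inner_smul_right,
        hzero, (hAs (0, w₀) v u : inner ℝ (A₀ v) u = inner ℝ v (A₀ u)), ← hv, hvv, ← hc] at h2
      linarith
    have h3 := h1 (-q / (c + 1))
    have h4 : 2 * (-q / (c + 1)) * q + (-q / (c + 1)) ^ 2 * c = -(q ^ 2 * (c + 2) / (c + 1) ^ 2) := by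
      field_simp
      ring
    rw [h4] at h3
    have h5 : q ^ 2 * (c + 2) / (c + 1) ^ 2 ≤ 0 := by linarith
    have h6 : q = 0 := by
      by_contra hne
      have : 0 < q ^ 2 * (c + 2) / (c + 1) ^ 2 := by positivity
      linarith
    rw [hq] at h6
    simpa using h6
  have hQu : Q (u, 0) = 0 := by
    ext x
    · have := hA0 w₀ u x
      rw [← hA₀, hA₀u, inner_zero_left] at this
      simp only [ContinuousLinearMap.comp_apply, ContinuousLinearMap.inl_apply]
      simp
      linarith
    · simp only [ContinuousLinearMap.comp_apply, ContinuousLinearMap.inr_apply]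
      rw [hsym, hQw]
      simp
  -- the kernel contains `ℝ u ⊕ W`
  let T : ℝ × W →ₗ[ℝ] 𝕌 × W :=
    { toFun := fun x => (x.1 • u, x.2)
      map_add' := fun x y => by simp [add_smul]
      map_smul' := fun c x => by simp [mul_smul] }
  have hT : ∀ x, T x ∈ LinearMap.ker Q.toLinearMap := by
    rintro ⟨t, w⟩
    rw [LinearMap.mem_ker]
    have h1 : T (t, w) = t • (u, 0) + (0, w) := by simp [T]
    rw [h1, map_add, map_smul]
    change t • Q (u, 0) + Q (0, w) = 0
    rw [hQu, hQw, smul_zero, add_zero]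
  have hinj : Function.Injective (T.codRestrict _ hT) := by
    rintro ⟨t, w⟩ ⟨t', w'⟩ h
    have h1 : T (t, w) = T (t', w') := congrArg Subtype.val h
    simp only [T, LinearMap.coe_mk, AddHom.coe_mk, Prod.mk.injEq] at h1
    rw [smul_left_injective ℝ hu h1.1, h1.2]
  have h1 := LinearMap.finrank_le_finrank_of_injective hinj
  rw [Module.finrank_prod, Module.finrank_self] at h1
  omega

end Hessian

section MorseChart

/-- Splitting off the first `m` of `n` coordinates. -/
noncomputable def splitCoord {m n : ℕ} (h : m ≤ n) : EuclideanSpace ℝ (Fin n) ≃L[ℝ]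
    EuclideanSpace ℝ (Fin m) × EuclideanSpace ℝ (Fin (n - m)) :=
  LinearEquiv.toContinuousLinearEquiv
    { toFun := fun y => (WithLp.toLp 2 fun i => y ⟨i, i.2.trans_le h⟩,
        WithLp.toLp 2 fun j => y ⟨m + j, by omega⟩)
      map_add' := fun x y => by
        ext <;> simp
      map_smul' := fun c x => by
        ext <;> simp
      invFun := fun p => WithLp.toLp 2 fun i =>
        if hi : (i : ℕ) < m then p.1 ⟨i, hi⟩ else p.2 ⟨i - m, by omega⟩
      left_inv := fun y => by
        ext i
        by_cases hi : (i : ℕ) < m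
        · simp [hi]
        · have : m + ((i : ℕ) - m) = i := by omega
          simp [hi, this]
      right_inv := fun p => by
        ext i <;> simp }

theorem splitCoord_fst_eq_zero {m n : ℕ} (h : m ≤ n) (y : EuclideanSpace ℝ (Fin n)) :
    (splitCoord h y).1 = 0 ↔ ∀ i : Fin n, (i : ℕ) < m → y i = 0 := by
  constructor
  · intro h0 i hi
    have := congrArg (fun u : EuclideanSpace ℝ (Fin m) => u ⟨i, hi⟩) h0
    exact this
  · intro h0
    ext i
    exact h0 ⟨i, i.2.trans_le h⟩ i.2

variable {n : ℕ} {X : Type*} [TopologicalSpace X] [ChartedSpace (EuclideanSpace ℝ (Fin n)) X]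
  [IsManifold (𝓡 n) (⊤ : ℕ∞) X]

local notation "𝔼" => EuclideanSpace ℝ (Fin n)

theorem contDiffOn_comp_chart_symm {φ : X → ℝ} (hφ : ContMDiff (𝓡 n) 𝓘(ℝ, ℝ) (⊤ : ℕ∞) φ)
    {e : OpenPartialHomeomorph X (EuclideanSpace ℝ (Fin n))}
    (he : e ∈ IsManifold.maximalAtlas (𝓡 n) (⊤ : ℕ∞) X) :
    ContDiffOn ℝ (⊤ : ℕ∞) (φ ∘ e.symm) e.target := by
  have h1 : ContMDiffOn 𝓘(ℝ, 𝔼) 𝓘(ℝ, ℝ) (⊤ : ℕ∞) (φ ∘ e.symm) e.target :=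
    hφ.comp_contMDiffOn (contMDiffOn_symm_of_mem_maximalAtlas he)
  exact contMDiffOn_iff_contDiffOn.1 h1

/-- Near every point of `Y` there is a chart in which `μ` is the squared norm of the first `m`
coordinates. -/
theorem exists_morse_chart {m : ℕ} {Y : Set X} (hY : IsClosedSubmanifold n m Y) {μ : X → ℝ}
    (hμ : IsMorseBott n m Y μ) {x : X} (hx : x ∈ Y) :
    ∃ e ∈ IsManifold.maximalAtlas (𝓡 n) (⊤ : ℕ∞) X, x ∈ e.source ∧
      ∀ z ∈ e.source, μ z = ‖(splitCoord hY.1 (e z)).1‖ ^ 2 := by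
  obtain ⟨hmn, -, hloc⟩ := hY
  obtain ⟨e₀, he₀, hxe, heY⟩ := hloc x hx
  set l := splitCoord hmn with hl
  set e' := chartAt 𝔼 x with he'd
  have he' : e' ∈ IsManifold.maximalAtlas (𝓡 n) (⊤ : ℕ∞) X := IsManifold.chart_mem_maximalAtlas x
  have hxe' : x ∈ e'.source := mem_chart_source _ _
  have hzero : ∀ p, l.symm p ∈ e₀.target → p.1 = 0 → μ (e₀.symm (l.symm p)) = 0 := by
    intro p hp hp1
    rw [hμ.zero_iff, heY _ (e₀.map_target hp), e₀.right_inv hp, ← splitCoord_fst_eq_zero hmn, ← hl,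
      l.apply_symm_apply, hp1]
  set w₀ := (l (e₀ x)).2 with hw₀
  have hp₀ : l (e₀ x) = (0, w₀) := by
    refine Prod.ext ?_ rfl
    exact (splitCoord_fst_eq_zero hmn _).2 ((heY x hxe).1 hx)
  have hp₀' : l.symm (0, w₀) = e₀ x := by rw [← hp₀, l.symm_apply_apply]
  set Ω := l.symm ⁻¹' e₀.target with hΩ
  have hΩo : IsOpen Ω := e₀.open_target.preimage l.symm.continuous
  have hp₀Ω : ((0, w₀) : EuclideanSpace ℝ (Fin m) × EuclideanSpace ℝ (Fin (n - m))) ∈ Ω := by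
    rw [hΩ, mem_preimage, hp₀']
    exact e₀.map_source hxe
  obtain ⟨R, hR, hRΩ⟩ := Metric.nhds_basis_closedBall.mem_iff.1 (hΩo.mem_nhds hp₀Ω)
  -- multiplication by a bump function extends `μ`, in the coordinates, to the whole space
  let b : ContDiffBump ((0, w₀) : EuclideanSpace ℝ (Fin m) × EuclideanSpace ℝ (Fin (n - m))) :=
    ⟨R / 2, R, by positivity, by linarith⟩
  set f₀ : EuclideanSpace ℝ (Fin m) × EuclideanSpace ℝ (Fin (n - m)) → ℝ :=
    fun p => μ (e₀.symm (l.symm p)) with hf₀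
  have hf₀s : ContDiffOn ℝ (⊤ : ℕ∞) f₀ Ω :=
    (contDiffOn_comp_chart_symm hμ.smooth he₀).comp l.symm.contDiff.contDiffOn fun p hp => hp
  set f : EuclideanSpace ℝ (Fin m) × EuclideanSpace ℝ (Fin (n - m)) → ℝ :=
    fun p => b p * f₀ p with hf
  have hfs : ContDiff ℝ (⊤ : ℕ∞) f := by
    rw [contDiff_iff_contDiffAt]
    intro p
    by_cases hp : p ∈ Ω
    · exact b.contDiff.contDiffAt.mul (hf₀s.contDiffAt (hΩo.mem_nhds hp))
    · have h1 : p ∉ tsupport b := fun h => hp (hRΩ (by rwa [b.tsupport_eq] at h))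
      have h2 : f =ᶠ[𝓝 p] fun _ => 0 := by
        filter_upwards [(isClosed_tsupport b).isOpen_compl.mem_nhds h1] with q hq
        simp only [hf, image_eq_zero_of_notMem_tsupport hq, zero_mul]
      exact contDiffAt_const.congr_of_eventuallyEq h2
  have hf0 : ∀ p, 0 ≤ f p := fun p => mul_nonneg b.nonneg (hμ.nonneg _)
  have hfz : ∀ w, f (0, w) = 0 := by
    intro w
    by_cases hp : ((0, w) : EuclideanSpace ℝ (Fin m) × EuclideanSpace ℝ (Fin (n - m))) ∈ Ω
    · simp only [hf, hf₀, hzero _ hp rfl, mul_zero]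
    · have h1 : ((0, w) : EuclideanSpace ℝ (Fin m) × EuclideanSpace ℝ (Fin (n - m))) ∉ tsupport b :=
        fun h => hp (hRΩ (by rwa [b.tsupport_eq] at h))
      simp only [hf, image_eq_zero_of_notMem_tsupport h1, zero_mul]
  -- comparison of the Hessian of `f` with that of `μ` in the preferred chart at `x`
  set g : 𝔼 → ℝ := μ ∘ e'.symm with hg
  set τ : EuclideanSpace ℝ (Fin m) × EuclideanSpace ℝ (Fin (n - m)) → 𝔼 :=
    (e' ∘ e₀.symm) ∘ l.symm with hτ
  have hmem : e₀ x ∈ e₀.target ∩ e₀.symm ⁻¹' e'.source := by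
    refine ⟨e₀.map_source hxe, ?_⟩
    rw [mem_preimage, e₀.left_inv hxe]
    exact hxe'
  have hτp : τ (0, w₀) = e' x := by
    simp only [hτ, Function.comp_apply, hp₀', e₀.left_inv hxe]
  have ht := contDiffAt_transition he₀ he' hmem
  have hτs : ContDiffAt ℝ (⊤ : ℕ∞) τ (0, w₀) := by
    refine ContDiffAt.comp (0, w₀) ?_ l.symm.contDiff.contDiffAt
    rwa [hp₀']
  have hτd : fderiv ℝ τ (0, w₀) = (fderiv ℝ (e' ∘ e₀.symm) (e₀ x)).comp
      (l.symm : _ →L[ℝ] 𝔼) := by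
    have h1 : HasFDerivAt (e' ∘ e₀.symm) (fderiv ℝ (e' ∘ e₀.symm) (e₀ x)) (l.symm (0, w₀)) := by
      rw [hp₀']
      exact (ht.differentiableAt (by simp)).hasFDerivAt
    exact (h1.comp (0, w₀) l.symm.hasFDerivAt).fderiv
  have hgs : ContDiffAt ℝ (⊤ : ℕ∞) g (τ (0, w₀)) := by
    rw [hτp]
    exact (contDiffOn_comp_chart_symm hμ.smooth he').contDiffAt
      (e'.open_target.mem_nhds (e'.map_source hxe'))
  have hgd : fderiv ℝ g (τ (0, w₀)) = 0 := by
    have : IsLocalMin g (τ (0, w₀)) := Eventually.of_forall fun p => by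
      rw [hτp, hg]
      simp only [Function.comp_apply]
      rw [e'.left_inv hxe', (hμ.zero_iff x).2 hx]
      exact hμ.nonneg _
    exact this.fderiv_eq_zero
  have hfg : f =ᶠ[𝓝 (0, w₀)] g ∘ τ := by
    have h1 : ∀ᶠ p in 𝓝 (0, w₀), e₀.symm (l.symm p) ∈ e'.source := by
      have hc : ContinuousAt (e₀.symm ∘ l.symm) (0, w₀) := by
        refine ContinuousAt.comp ?_ l.symm.continuous.continuousAt
        rw [hp₀']
        exact e₀.symm.continuousAt (e₀.map_source hxe)
      refine hc.eventually (e'.open_source.mem_nhds ?_)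
      simp only [Function.comp_apply, hp₀', e₀.left_inv hxe]
      exact hxe'
    filter_upwards [h1, b.eventuallyEq_one] with p hp hb
    simp only [hf, hf₀, hg, hτ, Function.comp_apply, hb, Pi.one_apply, one_mul, e'.left_inv hp]
  have hHess : ∀ v w, fderiv ℝ (fderiv ℝ f) (0, w₀) v w =
      hessian n μ x (fderiv ℝ τ (0, w₀) v) (fderiv ℝ τ (0, w₀) w) := by
    intro v w
    rw [hfg.fderiv.fderiv_eq, fderiv_fderiv_comp_of_critical hgs hτs hgd, hτp]
    rfl
  have hdet := det_transition_ne_zero he₀ he' hmem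
  set L : (EuclideanSpace ℝ (Fin m) × EuclideanSpace ℝ (Fin (n - m))) ≃L[ℝ] 𝔼 :=
    l.symm.trans ((fderiv ℝ (e' ∘ e₀.symm) (e₀ x)).toContinuousLinearEquivOfDetNeZero hdet) with hL
  have hLτ : ∀ v, fderiv ℝ τ (0, w₀) v = L v := by
    intro v
    rw [hτd]
    rfl
  have hker : Module.finrank ℝ (LinearMap.ker (fderiv ℝ (fderiv ℝ f) (0, w₀)).toLinearMap) ≤
      Module.finrank ℝ (EuclideanSpace ℝ (Fin (n - m))) := by
    have h1 : ∀ v : LinearMap.ker (fderiv ℝ (fderiv ℝ f) (0, w₀)).toLinearMap,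
        (L.toLinearMap ∘ₗ Submodule.subtype _) v ∈ LinearMap.ker (hessian n μ x).toLinearMap := by
      rintro ⟨v, hv⟩
      rw [LinearMap.mem_ker] at hv ⊢
      ext z
      have h2 := hHess v (L.symm z)
      rw [hLτ, hLτ, L.apply_symm_apply] at h2
      change hessian n μ x (L v) z = 0
      rw [← h2]
      change fderiv ℝ (fderiv ℝ f) (0, w₀) v = 0 at hv
      rw [hv]
      rfl
    have h2 : Function.Injective (LinearMap.codRestrict _ _ h1) := by
      intro v w h
      have h3 : L v = L w := congrArg Subtype.val h
      exact Subtype.ext (L.injective h3)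
    have h3 := LinearMap.finrank_le_finrank_of_injective h2
    have h4 := LinearMap.finrank_range_add_finrank_ker (hessian n μ x).toLinearMap
    rw [hμ.hessian_rank x hx, finrank_euclideanSpace_fin] at h4
    rw [finrank_euclideanSpace_fin]
    omega
  obtain ⟨Φ, hΦ0, hΦs, hΦs', hΦf⟩ := exists_morseBott_coordinates hfs hf0 hfz w₀
    (hessian_pos_of_finrank_ker hfs hf0 hfz w₀ hker)
  -- On the ball of radius `R / 2` the bump function is `1`.
  set Φ' := Φ.restrOpen (Metric.ball (0, w₀) (R / 2)) Metric.isOpen_ball with hΦ'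
  set e : OpenPartialHomeomorph X 𝔼 :=
    ((e₀.trans l.toHomeomorph.toOpenPartialHomeomorph).trans Φ').trans
      l.symm.toHomeomorph.toOpenPartialHomeomorph with he
  have hsrc : ∀ z, z ∈ e.source ↔ z ∈ e₀.source ∧ l (e₀ z) ∈ Φ.source ∧
      l (e₀ z) ∈ Metric.ball (0, w₀) (R / 2) := by
    intro z
    simp [he, hΦ', and_assoc]
  have htgt : ∀ y, y ∈ e.target → l y ∈ Φ.target ∧ l.symm (Φ.symm (l y)) ∈ e₀.target := by
    intro y hy
    simp [he, hΦ'] at hy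
    tauto
  have hcoe : ∀ z, e z = l.symm (Φ (l (e₀ z))) := fun z => rfl
  have hcoes : ∀ y, e.symm y = e₀.symm (l.symm (Φ.symm (l y))) := fun y => rfl
  refine ⟨e, ?_, ?_, ?_⟩
  · refine e.mem_maximalAtlas_of_contMDiffOn ?_ ?_
    · have h1 : ContMDiffOn (𝓡 n) 𝓘(ℝ, 𝔼) (⊤ : ℕ∞) e₀ e.source :=
        (contMDiffOn_of_mem_maximalAtlas he₀).mono fun z hz => ((hsrc z).1 hz).1
      have h2 : ContDiffOn ℝ (⊤ : ℕ∞) (fun y => l.symm (Φ (l y))) (l ⁻¹' Φ.source) :=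
        l.symm.contDiff.comp_contDiffOn (hΦs.comp l.contDiff.contDiffOn fun y hy => hy)
      exact (contMDiffOn_iff_contDiffOn.2 h2).comp h1 fun z hz => ((hsrc z).1 hz).2.1
    · have h2 : ContDiffOn ℝ (⊤ : ℕ∞) (fun y => l.symm (Φ.symm (l y))) (l ⁻¹' Φ.target) :=
        l.symm.contDiff.comp_contDiffOn (hΦs'.comp l.contDiff.contDiffOn fun y hy => hy)
      have h3 : ContMDiffOn 𝓘(ℝ, 𝔼) 𝓘(ℝ, 𝔼) (⊤ : ℕ∞) (fun y => l.symm (Φ.symm (l y))) e.target :=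
        contMDiffOn_iff_contDiffOn.2 (h2.mono fun y hy => (htgt y hy).1)
      exact (contMDiffOn_symm_of_mem_maximalAtlas he₀).comp h3 fun y hy => (htgt y hy).2
  · rw [hsrc, hp₀]
    exact ⟨hxe, hΦ0, Metric.mem_ball_self (by positivity)⟩
  · intro z hz
    obtain ⟨hz1, hz2, hz3⟩ := (hsrc z).1 hz
    have h1 := hΦf _ hz2
    have h2 : b (l (e₀ z)) = 1 := b.one_of_mem_closedBall (Metric.ball_subset_closedBall hz3)
    rw [hcoe, l.apply_symm_apply, ← h1]
    simp only [hf, hf₀, h2, one_mul, l.symm_apply_apply, e₀.left_inv hz1]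

end MorseChart

/-! ### Cutoffs and supports -/

section Cutoff

variable {E : Type*} [NormedAddCommGroup E] [NormedSpace ℝ E] [FiniteDimensional ℝ E]

/-- A smooth cutoff function for a compact subset of an open set. -/
theorem exists_contDiff_one_on_compact {K T : Set E} (hK : IsCompact K) (hT : IsOpen T)
    (hKT : K ⊆ T) : ∃ χ : E → ℝ, ContDiff ℝ (⊤ : ℕ∞) χ ∧ HasCompactSupport χ ∧ tsupport χ ⊆ T ∧
      ∀ x ∈ K, χ x = 1 := by
  haveI : ProperSpace E := FiniteDimensional.proper_real E
  obtain ⟨K', hK', hKK', hK'T⟩ := exists_compact_between hK hT hKT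
  have hd : Disjoint (interior K')ᶜ K := disjoint_compl_left_iff_subset.2 hKK'
  obtain ⟨f, hf0, hf1, -⟩ := exists_contMDiffMap_zero_one_of_isClosed (n := (⊤ : ℕ∞)) 𝓘(ℝ, E)
    isOpen_interior.isClosed_compl hK.isClosed hd
  have hsupp : Function.support f ⊆ K' := by
    intro x hx
    by_contra hxK
    exact hx (hf0 fun h => hxK (interior_subset h))
  have ht : tsupport f ⊆ K' := closure_minimal hsupp hK'.isClosed
  refine ⟨f, contMDiff_iff_contDiff.1 f.contMDiff, ?_, ht.trans hK'T, fun x hx => hf1 hx⟩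
  exact hK'.of_isClosed_subset (isClosed_tsupport _) ht

theorem ContDiff.smul_of_tsupport_subset {F : Type*} [NormedAddCommGroup F] [NormedSpace ℝ F]
    {χ : E → ℝ} (hχ : ContDiff ℝ (⊤ : ℕ∞) χ) {T : Set E} (hT : IsOpen T) (hχT : tsupport χ ⊆ T)
    {g : E → F} (hg : ContDiffOn ℝ (⊤ : ℕ∞) g T) : ContDiff ℝ (⊤ : ℕ∞) fun x => χ x • g x := by
  rw [contDiff_iff_contDiffAt]
  intro p
  by_cases hp : p ∈ T
  · exact hχ.contDiffAt.smul (hg.contDiffAt (hT.mem_nhds hp))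
  · have h2 : (fun x => χ x • g x) =ᶠ[𝓝 p] fun _ => 0 := by
      filter_upwards [(isClosed_tsupport χ).isOpen_compl.mem_nhds fun h => hp (hχT h)] with q hq
      simp only [image_eq_zero_of_notMem_tsupport hq, zero_smul]
    exact contDiffAt_const.congr_of_eventuallyEq h2

end Cutoff

section LinearChange

/-- Linear changes of variables, up to an unspecified constant. -/
theorem exists_integral_comp_linear {E F : Type*} [NormedAddCommGroup E] [NormedSpace ℝ E]
    [FiniteDimensional ℝ E] [MeasureSpace E] [BorelSpace E] [NormedAddCommGroup F] [NormedSpace ℝ F]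
    [FiniteDimensional ℝ F] [MeasureSpace F] [BorelSpace F] [(volume : Measure E).IsAddHaarMeasure]
    [(volume : Measure F).IsAddHaarMeasure] (l : E ≃L[ℝ] F) :
    ∃ c : ℝ, c ≠ 0 ∧ ∀ H : E → ℂ, (Integrable H ↔ Integrable fun p => H (l.symm p)) ∧
      ∫ y, H y = c * ∫ p, H (l.symm p) := by
  haveI : ProperSpace E := FiniteDimensional.proper_real E
  haveI : ProperSpace F := FiniteDimensional.proper_real F
  haveI : (Measure.map l (volume : Measure E)).IsAddHaarMeasure := l.isAddHaarMeasure_map volume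
  have hmap := Measure.isAddLeftInvariant_eq_smul (Measure.map l (volume : Measure E))
    (volume : Measure F)
  set c := Measure.addHaarScalarFactor (Measure.map l (volume : Measure E)) (volume : Measure F)
  have hc : c ≠ 0 := by
    intro h0
    rw [h0, zero_smul] at hmap
    exact (NeZero.ne (Measure.map l (volume : Measure E))) hmap
  have hemb : MeasurableEmbedding l := l.toHomeomorph.measurableEmbedding
  have hH : ∀ H : E → ℂ, (fun p => H (l.symm p)) ∘ l = H := fun H => by
    funext y
    simp
  refine ⟨c, by exact_mod_cast hc, fun H => ⟨?_, ?_⟩⟩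
  · have h1 := hemb.integrable_map_iff (μ := volume) (g := fun p => H (l.symm p))
    rw [hH, hmap] at h1
    rw [← h1]
    have h2 := integrable_smul_measure (μ := (volume : Measure F)) (f := fun p => H (l.symm p))
      (c := (c : ENNReal)) (by exact_mod_cast hc) ENNReal.coe_ne_top
    exact h2
  · have h1 := hemb.integral_map (μ := volume) (fun p => H (l.symm p))
    rw [hmap, integral_smul_nnreal_measure] at h1
    have h2 : (fun y => H (l.symm (l y))) = H := hH H
    simp only [h2] at h1
    rw [← h1, NNReal.smul_def, Complex.real_smul]

end LinearChange

section Supports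

variable {n : ℕ} {X : Type*} [TopologicalSpace X] [ChartedSpace (EuclideanSpace ℝ (Fin n)) X]

/-- Multiplication of a form by a function. -/
noncomputable def mulForm {k : ℕ} (g : X → ℂ) (ω : Form n X k) : Form n X k := fun x => g x • ω x

theorem powForm_eq_mulForm {k : ℕ} (μ : X → ℝ) (s : ℂ) (ω : Form n X k) :
    powForm μ s ω = mulForm (fun x => (μ x : ℂ) ^ (s / 2)) ω := rfl

theorem mulForm_one {k : ℕ} (ω : Form n X k) : mulForm 1 ω = ω := by
  funext x
  exact one_smul _ _

theorem mulForm_eq_zero {k : ℕ} (g : X → ℂ) {ω : Form n X k} {x : X} (h : ω x = 0) :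
    mulForm g ω x = 0 := by
  change g x • ω x = 0
  rw [h]
  exact smul_zero (A := EuclideanSpace ℝ (Fin n) [⋀^Fin k]→L[ℝ] ℂ) (g x)

theorem real_smul_form_eq_zero {k : ℕ} (c : ℝ) {ω : Form n X k} {x : X} (h : ω x = 0) :
    c • ω x = 0 := by
  rw [h]
  exact smul_zero (A := EuclideanSpace ℝ (Fin n) [⋀^Fin k]→L[ℝ] ℂ) c

theorem coeffIn_mulForm (e : OpenPartialHomeomorph X (EuclideanSpace ℝ (Fin n))) (g : X → ℂ)
    (ω : Form n X n) (y : EuclideanSpace ℝ (Fin n)) :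
    coeffIn e (mulForm g ω) y = g (e.symm y) * coeffIn e ω y := rfl

theorem coeffIn_eq_zero (e : OpenPartialHomeomorph X (EuclideanSpace ℝ (Fin n)))
    {ω : Form n X n} {y : EuclideanSpace ℝ (Fin n)} (h : ω (e.symm y) = 0) : coeffIn e ω y = 0 := by
  have h1 : formAt ω (e.symm y) = 0 := h
  unfold coeffIn formIn
  rw [h1]
  rfl

theorem coeffIn_of_eq_smul (e : OpenPartialHomeomorph X (EuclideanSpace ℝ (Fin n)))
    {ω η : Form n X n} {y : EuclideanSpace ℝ (Fin n)} {c : ℝ}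
    (h : η (e.symm y) = c • ω (e.symm y)) : coeffIn e η y = c * coeffIn e ω y := by
  have h1 : formAt η (e.symm y) = c • formAt ω (e.symm y) := h
  unfold coeffIn formIn
  rw [h1]
  change c • (_ : ℂ) = _
  rw [Complex.real_smul]
  rfl

variable [SecondCountableTopology X] [MeasurableSpace X] [BorelSpace X]

theorem density_eq_zero (o : ManifoldOrientation n X) {ω : Form n X n} {z : X} (h : ω z = 0) :
    density o ω z = 0 := by
  set e' := chartAt (EuclideanSpace ℝ (Fin n)) (chartSel n X z) with he'd
  have hz' : z ∈ e'.source := (isChartSelection_chartSel n X).mem_source z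
  have h0 : e'.symm (e' z) = z := e'.left_inv hz'
  have h1 : density o ω z = (chartSign o e' (e' z) : ℂ) * coeffIn e' ω (e' z) := rfl
  rw [h1, coeffIn_eq_zero e' (by rw [h0]; exact h), mul_zero]

theorem formIntegrableOn_inter_iff (o : ManifoldOrientation n X) {ω : Form n X n} {A O : Set X}
    (hA : MeasurableSet A) (h : ∀ z ∈ A, z ∉ O → ω z = 0) :
    (FormIntegrableOn o ω A ↔ FormIntegrableOn o ω (A ∩ O)) ∧
      formIntegral o ω A = formIntegral o ω (A ∩ O) := by
  have h0 : ∀ z ∈ A \ (A ∩ O), density o ω z = 0 := fun z hz =>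
    density_eq_zero o (h z hz.1 fun hO => hz.2 ⟨hz.1, hO⟩)
  refine ⟨⟨fun hi => hi.mono_set inter_subset_left, fun hi => ?_⟩, ?_⟩
  · exact IntegrableOn.of_forall_sdiff_eq_zero hi hA h0
  · exact setIntegral_eq_of_subset_of_forall_sdiff_eq_zero hA inter_subset_left h0

theorem measurableSet_chart_preimage (e : OpenPartialHomeomorph X (EuclideanSpace ℝ (Fin n)))
    {A : Set X} (hA : MeasurableSet A) : MeasurableSet (e.symm ⁻¹' A ∩ e.target) := by
  have h1 := (measurableEmbedding_chart_symm e).measurable hA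
  have h2 := (MeasurableEmbedding.subtype_coe e.open_target.measurableSet).measurableSet_image.2 h1
  have h3 : e.symm ⁻¹' A ∩ e.target = Subtype.val '' (e.target.domRestrict e.symm ⁻¹' A) := by
    ext y
    simp [and_comm]
  rwa [h3]

end Supports

/-! ### Polar models of singular forms -/

section PolarModel

variable {n : ℕ} {X : Type*} [TopologicalSpace X] [ChartedSpace (EuclideanSpace ℝ (Fin n)) X]
  [SecondCountableTopology X] [MeasurableSpace X] [BorelSpace X]

local notation "𝔼" => EuclideanSpace ℝ (Fin n)

/-- The transversal parameter space of polar coordinates: a direction in `ℝᵐ` and a point of a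
ball in `ℝᵏ`. -/
def polarBase (m k : ℕ) (R : ℝ) : Set (EuclideanSpace ℝ (Fin m) × EuclideanSpace ℝ (Fin k)) :=
  Metric.sphere 0 1 ×ˢ Metric.closedBall 0 R

/-- Surface measure of the sphere times Lebesgue measure on a ball. -/
noncomputable def polarMeasure (m k : ℕ) (R : ℝ) :
    Measure (EuclideanSpace ℝ (Fin m) × EuclideanSpace ℝ (Fin k)) :=
  (sphereMeasure m).prod (volume.restrict (Metric.closedBall 0 R))

instance (m k : ℕ) (R : ℝ) : IsFiniteMeasure (polarMeasure m k R) := by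
  haveI : IsFiniteMeasure
      ((volume : Measure (EuclideanSpace ℝ (Fin k))).restrict (Metric.closedBall 0 R)) :=
    ⟨by rw [Measure.restrict_apply_univ]; exact measure_closedBall_lt_top⟩
  unfold polarMeasure
  infer_instance

theorem isCompact_polarBase (m k : ℕ) (R : ℝ) : IsCompact (polarBase m k R) :=
  (isCompact_sphere _ _).prod (isCompact_closedBall _ _)

theorem ae_polarMeasure (m k : ℕ) (R : ℝ) : ∀ᵐ v ∂(polarMeasure m k R), v ∈ polarBase m k R := by
  haveI : SFinite ((volume : Measure (EuclideanSpace ℝ (Fin k))).restrict (Metric.closedBall 0 R)) :=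
    inferInstance
  have h1 : ∀ᵐ v ∂(polarMeasure m k R), v.1 ∈ Metric.sphere (0 : EuclideanSpace ℝ (Fin m)) 1 :=
    Measure.quasiMeasurePreserving_fst.ae ae_sphereMeasure
  have h2 : ∀ᵐ v ∂(polarMeasure m k R), v.2 ∈ Metric.closedBall (0 : EuclideanSpace ℝ (Fin k)) R :=
    Measure.quasiMeasurePreserving_snd.ae (ae_restrict_mem Metric.isClosed_closedBall.measurableSet)
  filter_upwards [h1, h2] with v hv1 hv2 using ⟨hv1, hv2⟩

/-- A description of the top form `ω` in polar coordinates `(r, v) ↦ Θ (r, v)` around `Y`, in which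
`μ = r²` and `ω = r^{-a-1} q dr dv` with `q` smooth, compactly supported, and even in `r` on
average. The function `q` is defined for all real `r`, also negative ones. Only integrals enter: `Θ`
is not required to be a diffeomorphism, the field `integral` being its change of variables formula;
`lift` says that smooth functions on `X` are smooth in polar coordinates. -/
structure IsPolarModel (o : ManifoldOrientation n X) (Y : Set X) (μ : X → ℝ) (a : ℤ)
    (ω : Form n X n) {m k : ℕ} (R : ℝ)
    (Θ : ℝ × (EuclideanSpace ℝ (Fin m) × EuclideanSpace ℝ (Fin k)) → X)
    (q : ℝ × (EuclideanSpace ℝ (Fin m) × EuclideanSpace ℝ (Fin k)) → ℂ) : Prop where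
  smooth : ContDiff ℝ (⊤ : ℕ∞) q
  bound : ∀ r v, R < r → v ∈ polarBase m k R → q (r, v) = 0
  even : ∀ r, ∫ v, q (-r, v) ∂(polarMeasure m k R) = ∫ v, q (r, v) ∂(polarMeasure m k R)
  radius : ∀ r v, v ∈ polarBase m k R → q (r, v) ≠ 0 → μ (Θ (r, v)) = r ^ 2
  integral : ∀ (g : X → ℂ) (A : Set X), MeasurableSet A → A ⊆ Yᶜ →
    (FormIntegrableOn o (mulForm g ω) A ↔
      Integrable (fun p => A.indicator g (Θ p) * ((p.1 : ℂ) ^ (-(a : ℂ) - 1) * q p))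
        ((volume.restrict (Ioi 0)).prod (polarMeasure m k R))) ∧
    formIntegral o (mulForm g ω) A =
      ∫ p, A.indicator g (Θ p) * ((p.1 : ℂ) ^ (-(a : ℂ) - 1) * q p)
        ∂((volume.restrict (Ioi 0)).prod (polarMeasure m k R))
  lift : ∀ φ : X → ℝ, ContMDiff (𝓡 n) 𝓘(ℝ, ℝ) (⊤ : ℕ∞) φ →
    ∃ φ' : ℝ × (EuclideanSpace ℝ (Fin m) × EuclideanSpace ℝ (Fin k)) → ℝ,
      ContDiff ℝ (⊤ : ℕ∞) φ' ∧ ∀ p, q p ≠ 0 → φ' p = φ (Θ p)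

variable [IsManifold (𝓡 n) (⊤ : ℕ∞) X]

/-- Forms supported near a point of `Y` have polar models. -/
theorem exists_isPolarModel (o : ManifoldOrientation n X) {m : ℕ} (hm : 1 ≤ m) {Y : Set X}
    (hY : IsClosedSubmanifold n m Y) {μ : X → ℝ} (hμ : IsMorseBott n m Y μ) {x : X} (hx : x ∈ Y) :
    ∃ O : Set X, IsOpen O ∧ x ∈ O ∧ ∀ (N : ℕ) (ω : Form n X n), SingularOfOrder Y μ N ω →
      RelCompactSupport Y ω → closure {x | x ∉ Y ∧ ω x ≠ 0} ⊆ O →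
      ∃ (R : ℝ) (Θ : ℝ × (EuclideanSpace ℝ (Fin m) × EuclideanSpace ℝ (Fin (n - m))) → X)
        (q : ℝ × (EuclideanSpace ℝ (Fin m) × EuclideanSpace ℝ (Fin (n - m))) → ℂ),
        IsPolarModel o Y μ (2 * N - m) ω R Θ q := by
  obtain ⟨e, he, hxe, heμ⟩ := exists_morse_chart hY hμ hx
  obtain ⟨O, hO, hxO, hOe, hOs⟩ := exists_open_chartSign_const o he hxe
  set σ := chartSign o e (e x) with hσ
  have hσ0 : σ ≠ 0 := chartSign_ne_zero o he (e.map_source hxe)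
  set l := splitCoord hY.1 with hl
  haveI : (volume : Measure (EuclideanSpace ℝ (Fin m) × EuclideanSpace ℝ (Fin (n - m)))).IsAddHaarMeasure := by
    rw [Measure.volume_eq_prod]
    infer_instance
  obtain ⟨c, hc0, hc⟩ := exists_integral_comp_linear l
  refine ⟨O, hO, hxO, ?_⟩
  rintro N ω ⟨-, η, hη, hηω⟩ hcomp hsub
  set S := closure {x | x ∉ Y ∧ ω x ≠ 0} with hS
  have hScomp : IsCompact S := hcomp
  have hSω : ∀ z, z ∉ Y → z ∉ S → ω z = 0 := fun z hz hzS => by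
    by_contra h
    exact hzS (subset_closure ⟨hz, h⟩)
  set T : Set 𝔼 := e.target ∩ e.symm ⁻¹' O with hT
  have hTo : IsOpen T := e.isOpen_inter_preimage_symm hO
  have heS : e '' S ⊆ T := by
    rintro _ ⟨z, hz, rfl⟩
    refine ⟨e.map_source (hOe (hsub hz)), ?_⟩
    rw [mem_preimage, e.left_inv (hOe (hsub hz))]
    exact hsub hz
  have heSc : IsCompact (e '' S) := hScomp.image_of_continuousOn
    (e.continuousOn.mono (hsub.trans hOe))
  -- `χ` is `1` on the support of `ω`, and `χ'` is `1` on the support of `χ`: the first makes the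
  -- coefficient of `η = μ^N ω` a smooth function `β` on the whole space, the second extends functions
  -- on `X`, in the coordinates.
  obtain ⟨χ, hχs, hχc, hχT, hχ1⟩ := exists_contDiff_one_on_compact heSc hTo heS
  obtain ⟨χ', hχ's, -, hχ'T, hχ'1⟩ := exists_contDiff_one_on_compact hχc hTo hχT
  set β : 𝔼 → ℂ := fun y => χ y • coeffIn e η y with hβ
  have hβs : ContDiff ℝ (⊤ : ℕ∞) β := hχs.smul_of_tsupport_subset hTo hχT
    ((contDiffOn_coeffIn he isOpen_univ hη).mono fun y hy => ⟨hy.1, mem_univ _⟩)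
  have hβχ : ∀ y, β y ≠ 0 → y ∈ tsupport χ := fun y hy => by
    by_contra h
    exact hy (by simp only [hβ, image_eq_zero_of_notMem_tsupport h, zero_smul])
  obtain ⟨R, hR⟩ := (hχc.image l.continuous).isBounded.subset_closedBall
    (0 : EuclideanSpace ℝ (Fin m) × EuclideanSpace ℝ (Fin (n - m)))
  have hβR : ∀ p, β (l.symm p) ≠ 0 → ‖p.1‖ ≤ R ∧ ‖p.2‖ ≤ R := fun p hp => by
    have h1 := hR ⟨_, hβχ _ hp, l.apply_symm_apply p⟩
    rw [mem_closedBall_zero_iff] at h1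
    exact ⟨(norm_fst_le p).trans h1, (norm_snd_le p).trans h1⟩
  let P : ℝ × (EuclideanSpace ℝ (Fin m) × EuclideanSpace ℝ (Fin (n - m))) → 𝔼 :=
    fun p => l.symm (p.1 • p.2.1, p.2.2)
  have hP : ContDiff ℝ (⊤ : ℕ∞) P := by
    refine l.symm.contDiff.comp (ContDiff.prodMk ?_ ?_)
    · exact contDiff_fst.smul (contDiff_fst.comp contDiff_snd)
    · exact contDiff_snd.comp contDiff_snd
  let Θ : ℝ × (EuclideanSpace ℝ (Fin m) × EuclideanSpace ℝ (Fin (n - m))) → X :=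
    fun p => e.symm (P p)
  let q : ℝ × (EuclideanSpace ℝ (Fin m) × EuclideanSpace ℝ (Fin (n - m))) → ℂ :=
    fun p => ((σ * c : ℝ) : ℂ) * β (P p)
  have hqβ : ∀ p, q p ≠ 0 → β (P p) ≠ 0 := fun p hp => right_ne_zero_of_mul hp
  have hμT : ∀ y ∈ e.target, μ (e.symm y) = ‖(l y).1‖ ^ 2 := fun y hy => by
    rw [heμ _ (e.map_target hy), e.right_inv hy]
  refine ⟨R, Θ, q, ?_, ?_, ?_, ?_, ?_, ?_⟩
  · exact contDiff_const.mul (hβs.comp hP)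
  · intro r v hr hv
    by_contra hq
    have h1 := (hβR _ (hqβ _ hq)).1
    have h2 : ‖v.1‖ = 1 := by simpa using hv.1
    simp only [norm_smul, h2, mul_one, Real.norm_eq_abs] at h1
    exact absurd (le_abs_self r) (by linarith)
  · intro r
    -- `(-r, θ)` and `(r, -θ)` are the same point, and the measure is invariant under `θ ↦ -θ`.
    have hmp : MeasurePreserving (Prod.map Neg.neg id :
        EuclideanSpace ℝ (Fin m) × EuclideanSpace ℝ (Fin (n - m)) → _)
        (polarMeasure m (n - m) R) (polarMeasure m (n - m) R) :=
      (⟨measurable_neg, map_neg_sphereMeasure⟩ : MeasurePreserving Neg.neg (sphereMeasure m) _).prod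
        (MeasurePreserving.id _)
    have hemb : MeasurableEmbedding (Prod.map Neg.neg id :
        EuclideanSpace ℝ (Fin m) × EuclideanSpace ℝ (Fin (n - m)) → _) :=
      (Homeomorph.neg _).measurableEmbedding.prodMap MeasurableEmbedding.id
    rw [← hmp.integral_comp hemb]
    refine integral_congr_ae (Eventually.of_forall fun v => ?_)
    simp [q, P]
  · intro r v hv hq
    have h1 := hχT (hβχ _ (hqβ _ hq))
    change μ (e.symm (P (r, v))) = r ^ 2
    rw [hμT _ h1.1]
    have h2 : ‖v.1‖ = 1 := by simpa using hv.1
    simp only [P, l.apply_symm_apply, norm_smul, h2, mul_one, Real.norm_eq_abs, sq_abs]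
  · intro g A hA hAY
    obtain ⟨hi1, hi2⟩ := formIntegrableOn_inter_iff o (ω := mulForm g ω) (O := O) hA (by
      intro z hz hzO
      exact mulForm_eq_zero g (hSω z (hAY hz) fun h => hzO (hsub h)))
    obtain ⟨hj1, hj2⟩ := formIntegrableOn_iff_coeffIn o he (mulForm g ω) (hA.inter hO.measurableSet)
      (inter_subset_right.trans hOe) hσ0 (fun z hz => hOs z hz.2)
    set B := e.symm ⁻¹' (A ∩ O) ∩ e.target with hB
    have hBm : MeasurableSet B := measurableSet_chart_preimage e (hA.inter hO.measurableSet)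
    let H : 𝔼 → ℂ := fun y => A.indicator g (e.symm y) * (((‖(l y).1‖ : ℂ) ^ (2 * N))⁻¹ * β y)
    have hBH : ∀ y ∈ B, coeffIn e (mulForm g ω) y = H y := by
      rintro y ⟨⟨hyA, hyO⟩, hyt⟩
      simp only [H, indicator_of_mem hyA, coeffIn_mulForm]
      congr 1
      have hyY := hAY hyA
      by_cases hyS : e.symm y ∈ S
      · have h1 : χ y = 1 := hχ1 y ⟨_, hyS, e.right_inv hyt⟩
        have h2 := coeffIn_of_eq_smul e (hηω _ hyY)
        have h3 : ((μ (e.symm y) ^ N : ℝ) : ℂ) = (‖(l y).1‖ : ℂ) ^ (2 * N) := by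
          rw [hμT y hyt, ← pow_mul]
          push_cast
          rfl
        have h4 : μ (e.symm y) ≠ 0 := fun h => hyY ((hμ.zero_iff _).1 h)
        have h5 : ((μ (e.symm y) ^ N : ℝ) : ℂ) ≠ 0 := by
          exact_mod_cast pow_ne_zero _ h4
        simp only [hβ, h1, one_smul]
        rw [h2, ← h3, ← mul_assoc, inv_mul_cancel₀ h5, one_mul]
      · have h1 : ω (e.symm y) = 0 := hSω _ hyY hyS
        have h2 : η (e.symm y) = 0 := (hηω _ hyY).trans (real_smul_form_eq_zero _ h1)
        simp only [hβ, coeffIn_eq_zero e h1, coeffIn_eq_zero e h2, smul_zero, mul_zero]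
    have hH0 : ∀ y, y ∉ B → H y = 0 := by
      intro y hy
      by_contra h
      have h1 : A.indicator g (e.symm y) ≠ 0 := left_ne_zero_of_mul h
      have h2 : β y ≠ 0 := right_ne_zero_of_mul (right_ne_zero_of_mul h)
      have h3 := hχT (hβχ y h2)
      exact hy ⟨⟨mem_of_indicator_ne_zero h1, h3.2⟩, h3.1⟩
    have hk1 : IntegrableOn (coeffIn e (mulForm g ω)) B ↔ Integrable H := by
      rw [integrableOn_congr_fun hBH hBm]
      exact integrableOn_iff_integrable_of_support_subset fun y hy => by
        by_contra h
        exact hy (hH0 y h)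
    have hk2 : ∫ y in B, coeffIn e (mulForm g ω) y = ∫ y, H y := by
      rw [setIntegral_congr_fun hBm hBH]
      exact setIntegral_eq_integral_of_forall_compl_eq_zero hH0
    obtain ⟨hl1, hl2⟩ := hc H
    obtain ⟨hp1, hp2⟩ := integrable_polar_iff hm fun p => H (l.symm p)
    -- outside the ball of radius `R` the integrand vanishes
    set G : ℝ × (EuclideanSpace ℝ (Fin m) × EuclideanSpace ℝ (Fin (n - m))) → ℂ := fun p =>
      ((p.1 ^ (m - 1) : ℝ) : ℂ) * H (l.symm (p.1 • p.2.1, p.2.2)) with hG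
    have hν : (volume.restrict (Ioi (0 : ℝ))).prod (polarMeasure m (n - m) R) =
        ((volume.restrict (Ioi (0 : ℝ))).prod ((sphereMeasure m).prod volume)).restrict
          (univ ×ˢ (univ ×ˢ Metric.closedBall 0 R)) := by
      rw [polarMeasure, ← Measure.prod_restrict, Measure.restrict_univ, ← Measure.prod_restrict,
        Measure.restrict_univ]
    have hG0 : ∀ p, p ∉ (univ : Set ℝ) ×ˢ ((univ : Set (EuclideanSpace ℝ (Fin m))) ×ˢ
        Metric.closedBall (0 : EuclideanSpace ℝ (Fin (n - m))) R) → G p = 0 := by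
      intro p hp
      by_contra h
      have h1 : β (l.symm (p.1 • p.2.1, p.2.2)) ≠ 0 :=
        right_ne_zero_of_mul (right_ne_zero_of_mul (right_ne_zero_of_mul h))
      have h2 := (hβR _ h1).2
      exact hp ⟨mem_univ _, mem_univ _, by simpa using h2⟩
    have hn1 : Integrable G ((volume.restrict (Ioi 0)).prod ((sphereMeasure m).prod volume)) ↔
        Integrable G ((volume.restrict (Ioi 0)).prod (polarMeasure m (n - m) R)) := by
      rw [hν]
      exact (integrableOn_iff_integrable_of_support_subset fun y hy => by
        by_contra h
        exact hy (hG0 y h)).symm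
    have hn2 : ∫ p, G p ∂((volume.restrict (Ioi 0)).prod ((sphereMeasure m).prod volume)) =
        ∫ p, G p ∂((volume.restrict (Ioi 0)).prod (polarMeasure m (n - m) R)) := by
      rw [hν]
      exact (setIntegral_eq_integral_of_forall_compl_eq_zero hG0).symm
    -- the factor `r^{m-1}` of the volume and `r^{-2N}` from `ω = μ^{-N} η` combine to `r^{-a-1}`
    have hGq : (fun p => A.indicator g (Θ p) * ((p.1 : ℂ) ^ (-((2 * N - m : ℤ) : ℂ) - 1) * q p))
        =ᵐ[(volume.restrict (Ioi 0)).prod (polarMeasure m (n - m) R)]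
        fun p => ((σ * c : ℝ) : ℂ) • G p := by
      filter_upwards [ae_radial_prod (ae_polarMeasure m (n - m) R)] with p hp
      have h2 : ‖p.2.1‖ = 1 := by simpa using hp.2.1
      have h3 : ‖(l (l.symm (p.1 • p.2.1, p.2.2))).1‖ = p.1 := by
        rw [l.apply_symm_apply]
        simp [norm_smul, h2, abs_of_pos hp.1]
      have hp0 : (p.1 : ℂ) ≠ 0 := by exact_mod_cast hp.1.ne'
      have h4 : (p.1 : ℂ) ^ (-((2 * N - m : ℤ) : ℂ) - 1) =
          (p.1 : ℂ) ^ (m - 1) * ((p.1 : ℂ) ^ (2 * N))⁻¹ := by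
        have h5 : (-((2 * N - m : ℤ) : ℂ) - 1) = ((m - 1 : ℕ) : ℂ) + -((2 * N : ℕ) : ℂ) := by
          rw [Nat.cast_sub hm]
          push_cast
          ring
        rw [h5, Complex.cpow_add _ _ hp0, Complex.cpow_neg, Complex.cpow_natCast,
          Complex.cpow_natCast]
      simp only [hG, H, h3, h4, q, Θ, P, smul_eq_mul]
      push_cast
      ring
    constructor
    · rw [hi1, hj1, hk1, hl1, hp1, hn1, integrable_congr hGq]
      exact (integrable_smul_iff (by exact_mod_cast mul_ne_zero hσ0 hc0) G).symm
    · rw [hi2, hj2, hk2, hl2, hp2, hn2, integral_congr_ae hGq, integral_smul]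
      push_cast
      simp only [smul_eq_mul]
      ring
  · intro φ hφ
    refine ⟨fun p => χ' (P p) • φ (e.symm (P p)), ?_, ?_⟩
    · have h1 : ContDiff ℝ (⊤ : ℕ∞) fun y => χ' y • (φ ∘ e.symm) y :=
        hχ's.smul_of_tsupport_subset hTo hχ'T
          ((contDiffOn_comp_chart_symm hφ he).mono inter_subset_left)
      exact h1.comp hP
    · intro p hp
      simp only [hχ'1 _ (hβχ _ (hqβ _ hp)), one_smul]
      rfl

end PolarModel

/-! ### Regularization in a polar model -/

section PolarModelConsequences

variable {n : ℕ} {X : Type*} [TopologicalSpace X] [ChartedSpace (EuclideanSpace ℝ (Fin n)) X]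
  [SecondCountableTopology X] [MeasurableSpace X] [BorelSpace X]

variable {o : ManifoldOrientation n X} {Y : Set X} {μ : X → ℝ} {a : ℤ} {ω : Form n X n} {m k : ℕ}
  {R : ℝ} {Θ : ℝ × (EuclideanSpace ℝ (Fin m) × EuclideanSpace ℝ (Fin k)) → X}
  {q : ℝ × (EuclideanSpace ℝ (Fin m) × EuclideanSpace ℝ (Fin k)) → ℂ}

theorem IsPolarModel.notMem_of_ne_zero (h : IsPolarModel o Y μ a ω R Θ q)
    (hμY : ∀ x, μ x = 0 ↔ x ∈ Y) {p : ℝ × (EuclideanSpace ℝ (Fin m) × EuclideanSpace ℝ (Fin k))}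
    (hp : 0 < p.1) (hpC : p.2 ∈ polarBase m k R) (hq : q p ≠ 0) : Θ p ∈ Yᶜ := by
  intro hY
  have h1 := h.radius p.1 p.2 hpC hq
  rw [(hμY _).2 hY] at h1
  exact (pow_pos hp 2).ne h1

/-- Integrals of the form `∫ rˢ f ω` in a polar model. -/
theorem IsPolarModel.formIntegral_mul (h : IsPolarModel o Y μ a ω R Θ q) (hYc : IsClosed Y)
    (hμY : ∀ x, μ x = 0 ↔ x ∈ Y)
    {f : ℝ × (EuclideanSpace ℝ (Fin m) × EuclideanSpace ℝ (Fin k)) → ℂ} (hf : Continuous f)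
    {g : X → ℂ} {s : ℂ} (hs : (a : ℝ) < s.re)
    (hg : ∀ p, 0 < p.1 → p.2 ∈ polarBase m k R → q p ≠ 0 → g (Θ p) = (p.1 : ℂ) ^ s * f p) :
    FormIntegrableOn o (mulForm g ω) Yᶜ ∧
    IntegrableOn (fun r : ℝ => (r : ℂ) ^ (s - a - 1) * ∫ v, f (r, v) * q (r, v) ∂(polarMeasure m k R))
      (Ioi 0) ∧
    formIntegral o (mulForm g ω) Yᶜ =
      ∫ r in Ioi (0 : ℝ), (r : ℂ) ^ (s - a - 1) *
        ∫ v, f (r, v) * q (r, v) ∂(polarMeasure m k R) := by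
  obtain ⟨h1, h2⟩ := h.integral g Yᶜ hYc.measurableSet.compl Subset.rfl
  have hz : 0 < (s - a).re := by
    rw [Complex.sub_re, Complex.intCast_re]
    linarith
  have hcont : Continuous fun p => f p * q p := hf.mul h.smooth.continuous
  have hbd : ∀ r v, R < r → v ∈ polarBase m k R → f (r, v) * q (r, v) = 0 := fun r v hr hv => by
    rw [h.bound r v hr hv, mul_zero]
  have hae : (fun p => Yᶜ.indicator g (Θ p) * ((p.1 : ℂ) ^ (-(a : ℂ) - 1) * q p))
      =ᵐ[(volume.restrict (Ioi 0)).prod (polarMeasure m k R)]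
      fun p => (p.1 : ℂ) ^ (s - a - 1) * (f p * q p) := by
    filter_upwards [ae_radial_prod (ae_polarMeasure m k R)] with p hp
    by_cases hq : q p = 0
    · simp [hq]
    · have hp0 : (p.1 : ℂ) ≠ 0 := by exact_mod_cast hp.1.ne'
      rw [indicator_of_mem (h.notMem_of_ne_zero hμY hp.1 hp.2 hq), hg p hp.1 hp.2 hq,
        show s - a - 1 = s + (-(a : ℂ) - 1) by ring, Complex.cpow_add _ _ hp0]
      ring
  have h3 := integrable_cpow_mul (isCompact_polarBase m k R) (ae_polarMeasure m k R) hcont hbd hz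
  obtain ⟨h4, h5⟩ := radial_fubini (isCompact_polarBase m k R) (ae_polarMeasure m k R) hcont hbd hz
  refine ⟨h1.2 ((integrable_congr hae).2 h3), h4, ?_⟩
  rw [h2, integral_congr_ae hae]
  exact h5

theorem sq_cpow_half {r : ℝ} (hr : 0 < r) (s : ℂ) : ((r ^ 2 : ℝ) : ℂ) ^ (s / 2) = (r : ℂ) ^ s := by
  have h0 : (r : ℂ) ≠ 0 := by exact_mod_cast hr.ne'
  have h1 : ((r ^ 2 : ℝ) : ℂ) ≠ 0 := by exact_mod_cast (pow_pos hr 2).ne'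
  rw [Complex.cpow_def_of_ne_zero h1, Complex.cpow_def_of_ne_zero h0, ← Complex.ofReal_log
    (by positivity), ← Complex.ofReal_log hr.le, Real.log_pow]
  congr 1
  push_cast
  ring

theorem IsPolarModel.formIntegral_powForm (h : IsPolarModel o Y μ a ω R Θ q) (hYc : IsClosed Y)
    (hμY : ∀ x, μ x = 0 ↔ x ∈ Y) {s : ℂ} (hs : (a : ℝ) < s.re) :
    FormIntegrableOn o (powForm μ s ω) Yᶜ ∧
    IntegrableOn (fun r : ℝ => (r : ℂ) ^ (s - a - 1) * ∫ v, q (r, v) ∂(polarMeasure m k R))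
      (Ioi 0) ∧
    formIntegral o (powForm μ s ω) Yᶜ =
      ∫ r in Ioi (0 : ℝ), (r : ℂ) ^ (s - a - 1) * ∫ v, q (r, v) ∂(polarMeasure m k R) := by
  have := h.formIntegral_mul hYc hμY (f := fun _ => 1) continuous_const
    (g := fun x => (μ x : ℂ) ^ (s / 2)) hs (fun p hp hpC hq => by
      rw [h.radius p.1 p.2 hpC hq, sq_cpow_half hp, mul_one])
  simp only [one_mul] at this
  exact this

theorem IsPolarModel.formIntegral_cutoff (h : IsPolarModel o Y μ a ω R Θ q)
    (hμY : ∀ x, μ x = 0 ↔ x ∈ Y) (hμm : Measurable μ) {ε : ℝ} (hε : 0 < ε) :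
    FormIntegrableOn o ω {x | ε ^ 2 ≤ μ x} ∧
    cutoffIntegral o μ ω ε = ∫ r in Ioi ε, (r : ℂ) ^ (-(a : ℂ) - 1) *
      ∫ v, q (r, v) ∂(polarMeasure m k R) := by
  have hAm : MeasurableSet {x | ε ^ 2 ≤ μ x} := measurableSet_le measurable_const hμm
  obtain ⟨h1, h2⟩ := h.integral 1 {x | ε ^ 2 ≤ μ x} hAm (fun x hx hxY => by
    rw [mem_ofPred_eq, (hμY x).2 hxY] at hx
    exact absurd (pow_pos hε 2) (not_lt.2 hx))
  rw [mulForm_one] at h1 h2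
  -- `r^{-a-1}` is written as `r^{-M} r^{M-a-1}`, with a bounded and an integrable factor on `r ≥ ε`.
  obtain ⟨M, hM⟩ := exists_nat_gt (a : ℝ)
  have hz : 0 < ((M : ℂ) - a).re := by
    rw [Complex.sub_re, Complex.intCast_re, Complex.natCast_re]
    linarith
  have h3 := integrable_cpow_mul (isCompact_polarBase m k R) (ae_polarMeasure m k R)
    h.smooth.continuous h.bound hz
  have hae : (fun p => {x | ε ^ 2 ≤ μ x}.indicator (1 : X → ℂ) (Θ p) *
      ((p.1 : ℂ) ^ (-(a : ℂ) - 1) * q p))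
      =ᵐ[(volume.restrict (Ioi 0)).prod (polarMeasure m k R)]
      fun p => (Ici ε).indicator (fun r : ℝ => ((r : ℂ) ^ M)⁻¹) p.1 *
        ((p.1 : ℂ) ^ ((M : ℂ) - a - 1) * q p) := by
    filter_upwards [ae_radial_prod (ae_polarMeasure m k R)] with p hp
    by_cases hq : q p = 0
    · simp [hq]
    · have hp0 : (p.1 : ℂ) ≠ 0 := by exact_mod_cast hp.1.ne'
      have hr := h.radius p.1 p.2 hp.2 hq
      by_cases hpε : ε ≤ p.1
      · have hmem : Θ p ∈ {x | ε ^ 2 ≤ μ x} := by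
          change ε ^ 2 ≤ μ (Θ p)
          rw [hr]
          exact pow_le_pow_left₀ hε.le hpε 2
        rw [indicator_of_mem hmem, indicator_of_mem (show p.1 ∈ Ici ε from hpε),
          show (M : ℂ) - a - 1 = (M : ℂ) + (-(a : ℂ) - 1) by ring, Complex.cpow_add _ _ hp0,
          Complex.cpow_natCast, Pi.one_apply, one_mul, mul_assoc, ← mul_assoc,
          inv_mul_cancel₀ (pow_ne_zero _ hp0), one_mul]
      · have hmem : Θ p ∉ {x | ε ^ 2 ≤ μ x} := by
          change ¬ ε ^ 2 ≤ μ (Θ p)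
          rw [hr, not_le]
          exact pow_lt_pow_left₀ (not_le.1 hpε) hp.1.le (by norm_num)
        rw [indicator_of_notMem hmem, indicator_of_notMem (show p.1 ∉ Ici ε from hpε)]
        simp
  have hint : Integrable (fun p : ℝ × (EuclideanSpace ℝ (Fin m) × EuclideanSpace ℝ (Fin k)) =>
      (Ici ε).indicator (fun r : ℝ => ((r : ℂ) ^ M)⁻¹) p.1 * ((p.1 : ℂ) ^ ((M : ℂ) - a - 1) * q p))
      ((volume.restrict (Ioi 0)).prod (polarMeasure m k R)) := by
    refine h3.bdd_mul (c := (ε ^ M)⁻¹) ?_ ?_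
    · refine Measurable.aestronglyMeasurable ?_
      have h5 : Measurable ((Ici ε).indicator (fun r : ℝ => ((r : ℂ) ^ M)⁻¹)) :=
        Measurable.indicator (by fun_prop) measurableSet_Ici
      exact h5.comp measurable_fst
    · refine Eventually.of_forall fun p => ?_
      by_cases hpε : p.1 ∈ Ici ε
      · have hpε' : ε ≤ p.1 := hpε
        rw [indicator_of_mem hpε, norm_inv, norm_pow, Complex.norm_real, Real.norm_eq_abs,
          abs_of_pos (hε.trans_le hpε')]
        exact inv_anti₀ (pow_pos hε M) (pow_le_pow_left₀ hε.le hpε' M)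
      · rw [indicator_of_notMem hpε, norm_zero]
        positivity
  refine ⟨h1.2 ((integrable_congr hae).2 hint), ?_⟩
  rw [cutoffIntegral, h2, integral_congr_ae hae, integral_prod _ hint]
  have h6 : ∀ r : ℝ, ∫ v, (Ici ε).indicator (fun r : ℝ => ((r : ℂ) ^ M)⁻¹) r *
      ((r : ℂ) ^ ((M : ℂ) - a - 1) * q (r, v)) ∂(polarMeasure m k R) =
      (Ici ε).indicator (fun r : ℝ => (r : ℂ) ^ (-(a : ℂ) - 1) *
        ∫ v, q (r, v) ∂(polarMeasure m k R)) r := by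
    intro r
    by_cases hr : r ∈ Ici ε
    · have hr' : ε ≤ r := hr
      have hr0 : (r : ℂ) ≠ 0 := by exact_mod_cast (hε.trans_le hr').ne'
      rw [indicator_of_mem hr, indicator_of_mem hr, integral_const_mul, integral_const_mul,
        show (M : ℂ) - a - 1 = (M : ℂ) + (-(a : ℂ) - 1) by ring, Complex.cpow_add _ _ hr0,
        Complex.cpow_natCast, mul_assoc, ← mul_assoc, inv_mul_cancel₀ (pow_ne_zero _ hr0), one_mul]
    · rw [indicator_of_notMem hr, indicator_of_notMem hr]
      simp
  simp only [h6]
  rw [integral_indicator measurableSet_Ici, Measure.restrict_restrict measurableSet_Ici,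
    inter_eq_self_of_subset_left (show Ici ε ⊆ Ioi 0 from fun r hr => hε.trans_le hr),
    integral_Ici_eq_integral_Ioi]

theorem IsPolarModel.exists_hasMellinExpansion (h : IsPolarModel o Y μ a ω R Θ q)
    (hYc : IsClosed Y) (hμY : ∀ x, μ x = 0 ↔ x ∈ Y) (hμm : Measurable μ) :
    ∃ b A, HasMellinExpansion a b A (fun s => formIntegral o (powForm μ s ω) Yᶜ)
      (cutoffIntegral o μ ω) := by
  have hh := contDiff_integral_right (isCompact_polarBase m k R) (ae_polarMeasure m k R) h.smooth
  obtain ⟨b, A, hbA⟩ := exists_hasMellinExpansion_of_even hh h.even (R := R + 1) (fun r hr => by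
    have h1 : ∀ᵐ v ∂(polarMeasure m k R), q (r, v) = 0 := by
      filter_upwards [ae_polarMeasure m k R] with v hv
      exact h.bound r v (by linarith) hv
    rw [integral_congr_ae h1, integral_zero]) a
  refine ⟨b, A, hbA.congr (fun s hs => (h.formIntegral_powForm hYc hμY hs).2.2) ?_⟩
  filter_upwards [self_mem_nhdsWithin] with ε hε
  exact (h.formIntegral_cutoff hμY hμm hε).2.symm

/-- The second order Taylor formula for the exponential function, with integral remainder. -/
theorem integral_exp_remainder (s : ℂ) (t : ℝ) :
    ∫ τ in Icc (0 : ℝ) 1, Complex.exp (s * ((τ * t : ℝ) : ℂ)) * (((1 - τ) * t ^ 2 : ℝ) : ℂ) * s ^ 2 =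
      Complex.exp (s * t) - 1 - s * t := by
  rw [integral_Icc_eq_integral_Ioc, ← intervalIntegral.integral_of_le zero_le_one]
  have hd : ∀ τ : ℝ, HasDerivAt (fun τ : ℝ => (1 - (τ : ℂ)) * (s * t) *
      Complex.exp (s * ((τ * t : ℝ) : ℂ)) + Complex.exp (s * ((τ * t : ℝ) : ℂ)))
      (Complex.exp (s * ((τ * t : ℝ) : ℂ)) * (((1 - τ) * t ^ 2 : ℝ) : ℂ) * s ^ 2) τ := by
    intro τ
    have h0 : HasDerivAt (fun τ : ℝ => (τ : ℂ)) 1 τ := Complex.ofRealCLM.hasDerivAt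
    have h1 : HasDerivAt (fun τ : ℝ => Complex.exp (s * ((τ * t : ℝ) : ℂ)))
        (Complex.exp (s * ((τ * t : ℝ) : ℂ)) * (s * t)) τ := by
      have h2 : HasDerivAt (fun τ : ℝ => s * ((τ * t : ℝ) : ℂ)) (s * t) τ := by
        have := (h0.mul_const (t : ℂ)).const_mul s
        simpa using this
      exact h2.cexp
    have h3 := (((h0.const_sub 1).mul_const (s * t)).mul h1).add h1
    refine h3.congr_deriv ?_
    push_cast
    ring
  rw [intervalIntegral.integral_eq_sub_of_hasDerivAt (fun τ _ => hd τ)]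
  · simp
    ring
  · refine Continuous.intervalIntegrable ?_ _ _
    fun_prop

/-- The first two terms of the expansion of `∫ e^{sφ} μ^{s/2} ω` in `φ` account for the change of
the logarithmic coefficient and of the finite part under a conformal change of `μ`; the remainder
is `s²` times a function whose continuation has at most simple poles. -/
theorem IsPolarModel.conformal_change (h : IsPolarModel o Y μ a ω R Θ q) (hYc : IsClosed Y)
    (hμY : ∀ x, μ x = 0 ↔ x ∈ Y) {φ : X → ℝ} (hφ : ContMDiff (𝓡 n) 𝓘(ℝ, ℝ) (⊤ : ℕ∞) φ)
    {b b' bφ : ℤ → ℂ} {A A' Aφ : ℂ} {F F' Fφ : ℝ → ℂ}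
    (hb : HasMellinExpansion a b A (fun s => formIntegral o (powForm μ s ω) Yᶜ) F)
    (hb' : HasMellinExpansion a b' A'
      (fun s => formIntegral o (powForm (fun x => Real.exp (2 * φ x) * μ x) s ω) Yᶜ) F')
    (hbφ : HasMellinExpansion a bφ Aφ
      (fun s => formIntegral o (powForm μ s (fun x => φ x • ω x)) Yᶜ) Fφ) :
    b' 0 = b 0 ∧ A' = A + bφ 0 := by
  obtain ⟨φ', hφ's, hφ'⟩ := h.lift φ hφ
  set K := a.toNat + 1 with hKd
  have hK : a < K := by omega
  -- the Taylor parameter is adjoined to the transversal variables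
  set C := polarBase m k R ×ˢ Icc (0 : ℝ) 1 with hC
  set ν := (polarMeasure m k R).prod (volume.restrict (Icc (0 : ℝ) 1)) with hν
  have hCc : IsCompact C := (isCompact_polarBase m k R).prod isCompact_Icc
  haveI : IsFiniteMeasure ν := by
    rw [hν]
    infer_instance
  have hCν : ∀ᵐ v ∂ν, v ∈ C := by
    have h1 : ∀ᵐ v ∂ν, v.1 ∈ polarBase m k R :=
      Measure.quasiMeasurePreserving_fst.ae (ae_polarMeasure m k R)
    have h2 : ∀ᵐ v ∂ν, v.2 ∈ Icc (0 : ℝ) 1 :=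
      Measure.quasiMeasurePreserving_snd.ae (ae_restrict_mem measurableSet_Icc)
    filter_upwards [h1, h2] with v hv1 hv2 using ⟨hv1, hv2⟩
  let V := (EuclideanSpace ℝ (Fin m) × EuclideanSpace ℝ (Fin k)) × ℝ
  let Φ : ℝ × V → ℝ := fun p => p.2.2 * φ' (p.1, p.2.1)
  let q' : ℝ × V → ℂ := fun p =>
    (((1 - p.2.2) * φ' (p.1, p.2.1) ^ 2 : ℝ) : ℂ) * q (p.1, p.2.1)
  have hproj : ContDiff ℝ (⊤ : ℕ∞) fun p : ℝ × V => (p.1, p.2.1) :=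
    contDiff_fst.prodMk (contDiff_fst.comp contDiff_snd)
  have hτ : ContDiff ℝ (⊤ : ℕ∞) fun p : ℝ × V => p.2.2 := contDiff_snd.comp contDiff_snd
  have hΦ : ContDiff ℝ (⊤ : ℕ∞) Φ := hτ.mul (hφ's.comp hproj)
  have hq' : ContDiff ℝ (⊤ : ℕ∞) q' := by
    refine ContDiff.mul (Complex.ofRealCLM.contDiff.comp ?_) (h.smooth.comp hproj)
    exact (contDiff_const.sub hτ).mul ((hφ's.comp hproj).pow 2)
  obtain ⟨G, hG, hGQ⟩ := exists_continuation_radial hCc hCν hΦ K a hq' (R := R)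
    (fun r v hr hv => by simp only [q', h.bound r v.1 hr hv.1, mul_zero])
  refine HasMellinExpansion.conformal_change hb hb' hbφ hK hG hGQ fun s hs => ?_
  have hcφ : Continuous φ' := hφ's.continuous
  obtain ⟨-, i1, e1⟩ := h.formIntegral_powForm hYc hμY hs
  obtain ⟨-, i2, e2⟩ := h.formIntegral_mul hYc hμY (f := fun p => (φ' p : ℂ)) (by fun_prop)
    (g := fun x => (μ x : ℂ) ^ (s / 2) * φ x) hs (fun p hp hpC hqp => by
      rw [h.radius p.1 p.2 hpC hqp, sq_cpow_half hp, hφ' p hqp])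
  obtain ⟨-, i3, e3⟩ := h.formIntegral_mul hYc hμY (f := fun p => Complex.exp (s * φ' p))
    (by fun_prop) (g := fun x => ((Real.exp (2 * φ x) * μ x : ℝ) : ℂ) ^ (s / 2)) hs
    (fun p hp hpC hqp => by
      rw [h.radius p.1 p.2 hpC hqp, hφ' p hqp, two_mul, Real.exp_add,
        show Real.exp (φ (Θ p)) * Real.exp (φ (Θ p)) * p.1 ^ 2 = (p.1 * Real.exp (φ (Θ p))) ^ 2 by
          ring, sq_cpow_half (by positivity), Complex.ofReal_mul,
        Complex.mul_cpow_ofReal_nonneg hp.le (Real.exp_pos _).le]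
      congr 1
      rw [Complex.cpow_def_of_ne_zero (by exact_mod_cast (Real.exp_pos _).ne'),
        ← Complex.ofReal_log (Real.exp_pos _).le, Real.log_exp, mul_comm])
  have e2' : formIntegral o (powForm μ s (fun x => φ x • ω x)) Yᶜ =
      formIntegral o (mulForm (fun x => (μ x : ℂ) ^ (s / 2) * φ x) ω) Yᶜ := by
    congr 1
    funext x
    change (μ x : ℂ) ^ (s / 2) • (φ x • ω x) = ((μ x : ℂ) ^ (s / 2) * φ x) • ω x
    rw [mul_smul]
    rfl
  have hinner : ∀ r : ℝ, ∫ v, Complex.exp (s * φ' (r, v)) * q (r, v) ∂(polarMeasure m k R) =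
      ∫ v, q (r, v) ∂(polarMeasure m k R) +
        s * ∫ v, (φ' (r, v) : ℂ) * q (r, v) ∂(polarMeasure m k R) +
        s ^ 2 * ∫ v, Complex.exp (s * Φ (r, v)) * q' (r, v) ∂ν := by
    intro r
    have hqc := h.smooth.continuous
    have c0 : Continuous fun v : EuclideanSpace ℝ (Fin m) × EuclideanSpace ℝ (Fin k) => q (r, v) := by
      fun_prop
    have c1 : Continuous fun v : EuclideanSpace ℝ (Fin m) × EuclideanSpace ℝ (Fin k) =>
        (φ' (r, v) : ℂ) * q (r, v) := by fun_prop
    have c2 : Continuous fun v : EuclideanSpace ℝ (Fin m) × EuclideanSpace ℝ (Fin k) =>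
        Complex.exp (s * φ' (r, v)) * q (r, v) := by fun_prop
    have c3 : Continuous fun v : V => Complex.exp (s * Φ (r, v)) * q' (r, v) := by
      have := hΦ.continuous
      have := hq'.continuous
      fun_prop
    have j0 := integrable_of_continuous_of_compact (isCompact_polarBase m k R)
      (ae_polarMeasure m k R) c0
    have j1 := integrable_of_continuous_of_compact (isCompact_polarBase m k R)
      (ae_polarMeasure m k R) c1
    have j2 := integrable_of_continuous_of_compact (isCompact_polarBase m k R)
      (ae_polarMeasure m k R) c2
    have j3 := integrable_of_continuous_of_compact hCc hCν c3
    have h4 : s ^ 2 * ∫ v, Complex.exp (s * Φ (r, v)) * q' (r, v) ∂ν =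
        ∫ v, (Complex.exp (s * φ' (r, v)) - 1 - s * φ' (r, v)) * q (r, v) ∂(polarMeasure m k R) := by
      rw [hν, integral_prod _ j3, ← integral_const_mul]
      refine integral_congr_ae (Eventually.of_forall fun v => ?_)
      simp only [Φ, q']
      rw [← integral_exp_remainder, ← integral_const_mul, ← integral_mul_const]
      refine integral_congr_ae (Eventually.of_forall fun τ => ?_)
      simp only
      ring
    rw [h4, ← integral_const_mul, ← integral_add j0 (j1.const_mul s), ← integral_add]
    · refine integral_congr_ae (Eventually.of_forall fun v => ?_)
      simp only
      ring
    · exact j0.add (j1.const_mul s)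
    · refine ((j2.sub j0).sub (j1.const_mul s)).congr (Eventually.of_forall fun v => ?_)
      simp only [Pi.sub_apply]
      ring
  rw [e2', e1, e2]
  change formIntegral o (mulForm (fun x => ((Real.exp (2 * φ x) * μ x : ℝ) : ℂ) ^ (s / 2)) ω) Yᶜ = _
  rw [e3]
  have hpt : ∀ r : ℝ, (r : ℂ) ^ (s - a - 1) *
      ∫ v, Complex.exp (s * φ' (r, v)) * q (r, v) ∂(polarMeasure m k R) =
      ((r : ℂ) ^ (s - a - 1) * ∫ v, q (r, v) ∂(polarMeasure m k R) +
        s * ((r : ℂ) ^ (s - a - 1) * ∫ v, (φ' (r, v) : ℂ) * q (r, v) ∂(polarMeasure m k R))) +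
        s ^ 2 * ((r : ℂ) ^ (s - a - 1) * ∫ v, Complex.exp (s * Φ (r, v)) * q' (r, v) ∂ν) := by
    intro r
    rw [hinner r]
    ring
  have hcomb := i1.add (Integrable.const_mul i2 s)
  have i4 : IntegrableOn (fun r : ℝ => s ^ 2 * ((r : ℂ) ^ (s - a - 1) *
      ∫ v, Complex.exp (s * Φ (r, v)) * q' (r, v) ∂ν)) (Ioi 0) := by
    refine (i3.sub hcomb).congr (Eventually.of_forall fun r => ?_)
    simp only [Pi.sub_apply, Pi.add_apply]
    rw [hpt r]
    ring
  rw [← integral_const_mul, ← integral_const_mul, ← integral_add i1 (Integrable.const_mul i2 s)]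
  exact (integral_congr_ae (Eventually.of_forall hpt)).trans (integral_add hcomb i4)

end PolarModelConsequences

/-! ### Forms supported away from the zero set -/

section Integrability

variable {n : ℕ} {X : Type*} [TopologicalSpace X] [ChartedSpace (EuclideanSpace ℝ (Fin n)) X]

theorem mem_closure_of_form_ne_zero {Y : Set X} {k : ℕ} {ω : Form n X k} {x : X} (hx : x ∉ Y)
    (h : ω x ≠ 0) : x ∈ closure {x : X | x ∉ Y ∧ ω x ≠ 0} := subset_closure ⟨hx, h⟩

theorem HadamardReg.SmoothFormOn.smul [IsManifold (𝓡 n) (⊤ : ℕ∞) X] {k : ℕ} {U : Set X}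
    {η : Form n X k} (hη : SmoothFormOn η U) {χ : X → ℝ}
    (hχ : ContMDiff (𝓡 n) 𝓘(ℝ, ℝ) (⊤ : ℕ∞) χ) : SmoothFormOn (fun x => χ x • η x) U := by
  intro p
  have h1 := contDiffOn_comp_chart_symm hχ
    (IsManifold.chart_mem_maximalAtlas (I := 𝓡 n) (n := (⊤ : ℕ∞)) p)
  have h2 : ContDiffOn ℝ (⊤ : ℕ∞) (χ ∘ (extChartAt (𝓡 n) p).symm) (extChartAt (𝓡 n) p).target := by
    rw [extChartAt_target_eq p]
    exact h1
  exact (h2.mono inter_subset_left).smul (hη p)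

theorem HadamardReg.SingularOfOrder.smul [IsManifold (𝓡 n) (⊤ : ℕ∞) X] {Y : Set X} {μ : X → ℝ}
    {N k : ℕ} {ω : Form n X k} (h : SingularOfOrder Y μ N ω) {χ : X → ℝ}
    (hχ : ContMDiff (𝓡 n) 𝓘(ℝ, ℝ) (⊤ : ℕ∞) χ) :
    SingularOfOrder Y μ N (fun x => χ x • ω x) := by
  obtain ⟨h1, η, hη, hηω⟩ := h
  refine ⟨h1.smul hχ, fun x => χ x • η x, hη.smul hχ, fun x hx => ?_⟩
  change χ x • η x = μ x ^ N • (χ x • ω x)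
  rw [hηω x hx]
  exact smul_comm (α := EuclideanSpace ℝ (Fin n) [⋀^Fin k]→L[ℝ] ℂ) (χ x) (μ x ^ N) (ω x)

theorem support_smul_form_subset {Y : Set X} {k : ℕ} (χ : X → ℝ) (ω : Form n X k) :
    closure {x | x ∉ Y ∧ χ x • ω x ≠ 0} ⊆ closure {x | x ∉ Y ∧ ω x ≠ 0} ∩ tsupport χ := by
  refine subset_inter (closure_mono fun x hx => ⟨hx.1, fun h => hx.2 (real_smul_form_eq_zero _ h)⟩)
    (closure_mono fun x hx h => hx.2 ?_)
  rw [h]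
  exact zero_smul ℝ (A := EuclideanSpace ℝ (Fin n) [⋀^Fin k]→L[ℝ] ℂ) (ω x)

theorem HadamardReg.RelCompactSupport.smul {Y : Set X} {k : ℕ} {ω : Form n X k} (h : RelCompactSupport Y ω)
    (χ : X → ℝ) : RelCompactSupport Y (fun x => χ x • ω x) :=
  h.of_isClosed_subset isClosed_closure ((support_smul_form_subset χ ω).trans inter_subset_left)

variable [SecondCountableTopology X] [MeasurableSpace X] [BorelSpace X]

theorem density_mulForm (o : ManifoldOrientation n X) (g : X → ℂ) (ω : Form n X n) (z : X) :
    density o (mulForm g ω) z = g z * density o ω z := by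
  set e' := chartAt (EuclideanSpace ℝ (Fin n)) (chartSel n X z) with he'd
  have hz' : z ∈ e'.source := (isChartSelection_chartSel n X).mem_source z
  have h1 : ∀ η : Form n X n,
      density o η z = (chartSign o e' (e' z) : ℂ) * coeffIn e' η (e' z) := fun _ => rfl
  rw [h1, h1, coeffIn_mulForm, e'.left_inv hz']
  ring

theorem density_real_smul (o : ManifoldOrientation n X) (χ : X → ℝ) (ω : Form n X n) (z : X) :
    density o (fun x => χ x • ω x) z = χ z * density o ω z :=
  density_mulForm o (fun x => (χ x : ℂ)) ω z

variable [T2Space X] [IsManifold (𝓡 n) (⊤ : ℕ∞) X]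

/-- A smooth top form is integrable over compact sets. -/
theorem formIntegrableOn_of_isCompact (o : ManifoldOrientation n X) {ω : Form n X n} {U : Set X}
    (hU : IsOpen U) (hω : SmoothFormOn ω U) {K : Set X} (hK : IsCompact K) (hKU : K ⊆ U) :
    FormIntegrableOn o ω K := by
  haveI : LocallyCompactSpace X := ChartedSpace.locallyCompactSpace (EuclideanSpace ℝ (Fin n)) X
  refine LocallyIntegrableOn.integrableOn_isCompact (fun x hx => ?_) hK
  set e := chartAt (EuclideanSpace ℝ (Fin n)) x with hed
  have he : e ∈ IsManifold.maximalAtlas (𝓡 n) (⊤ : ℕ∞) X := IsManifold.chart_mem_maximalAtlas _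
  have hxe : x ∈ e.source := mem_chart_source _ _
  obtain ⟨O, hO, hxO, hOe, hOs⟩ := exists_open_chartSign_const o he hxe
  obtain ⟨K', hK', hxK', hK'O⟩ := exists_compact_subset (hO.inter hU) ⟨hxO, hKU hx⟩
  refine ⟨K', mem_nhdsWithin_of_mem_nhds (mem_interior_iff_mem_nhds.1 hxK'), ?_⟩
  have hK'e : K' ⊆ e.source := fun z hz => hOe (hK'O hz).1
  refine ((formIntegrableOn_iff_coeffIn o he ω hK'.isClosed.measurableSet hK'e
    (chartSign_ne_zero o he (e.map_source hxe)) fun z hz => hOs z (hK'O hz).1).1).2 ?_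
  have h1 : e.symm ⁻¹' K' ∩ e.target = e '' K' := by
    rw [e.image_eq_target_inter_inv_preimage hK'e, inter_comm]
  rw [h1]
  refine ContinuousOn.integrableOn_compact (hK'.image_of_continuousOn (e.continuousOn.mono hK'e)) ?_
  refine (contDiffOn_coeffIn he hU hω).continuousOn.mono ?_
  rintro _ ⟨z, hz, rfl⟩
  refine ⟨e.map_source (hK'e hz), ?_⟩
  rw [mem_preimage, e.left_inv (hK'e hz)]
  exact (hK'O hz).2

variable {Y : Set X} {μ : X → ℝ} {ω : Form n X n}

/-- The integral with cutoff converges absolutely. -/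
theorem formIntegrableOn_cutoff (o : ManifoldOrientation n X) (hYc : IsClosed Y)
    (hμc : Continuous μ) (hμY : ∀ x, μ x = 0 ↔ x ∈ Y) (hω : SmoothFormOn ω Yᶜ)
    (hS : RelCompactSupport Y ω) {ε : ℝ} (hε : 0 < ε) :
    FormIntegrableOn o ω {x | ε ^ 2 ≤ μ x} := by
  have hAc : IsClosed {x | ε ^ 2 ≤ μ x} := isClosed_le continuous_const hμc
  have hAY : {x | ε ^ 2 ≤ μ x} ⊆ Yᶜ := by
    intro x hx hxY
    rw [mem_ofPred_eq, (hμY x).2 hxY] at hx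
    exact absurd (pow_pos hε 2) (not_lt.2 hx)
  refine ((formIntegrableOn_inter_iff o hAc.measurableSet (O := closure {x | x ∉ Y ∧ ω x ≠ 0})
    fun z hz hzS => ?_).1).2 ?_
  · by_contra h
    exact hzS (mem_closure_of_form_ne_zero (hAY hz) h)
  · exact formIntegrableOn_of_isCompact o hYc.isOpen_compl hω (hS.inter_left hAc)
      (inter_subset_left.trans hAY)

/-- A form supported away from `Y` has an entire zeta function, and its integral with cutoff is
eventually constant. -/
theorem hasMellinExpansion_of_disjoint (o : ManifoldOrientation n X) (hYc : IsClosed Y)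
    (hμc : Continuous μ) (hμ0 : ∀ x, 0 ≤ μ x) (hμY : ∀ x, μ x = 0 ↔ x ∈ Y)
    (hω : SmoothFormOn ω Yᶜ) (hS : RelCompactSupport Y ω)
    (hd : Disjoint (closure {x | x ∉ Y ∧ ω x ≠ 0}) Y) (a : ℤ) :
    (∀ s, FormIntegrableOn o (powForm μ s ω) Yᶜ) ∧
    HasMellinExpansion a 0 (formIntegral o ω Yᶜ) (fun s => formIntegral o (powForm μ s ω) Yᶜ)
      (cutoffIntegral o μ ω) := by
  set S := closure {x | x ∉ Y ∧ ω x ≠ 0} with hSd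
  have hSY : S ⊆ Yᶜ := fun x hx hxY => disjoint_left.1 hd hx hxY
  have hSm : MeasurableSet S := isClosed_closure.measurableSet
  have hpos : ∀ x ∈ S, 0 < μ x := fun x hx =>
    lt_of_le_of_ne (hμ0 x) fun h => hSY hx ((hμY x).1 h.symm)
  have hzero : ∀ z ∈ Yᶜ, z ∉ S → ω z = 0 := fun z hz hzS => by
    by_contra h
    exact hzS (mem_closure_of_form_ne_zero hz h)
  -- `μ^{s/2} = e^{sL}`, with `L` bounded on the support of `ω`
  set L : X → ℝ := fun x => Real.log (μ x) / 2 with hL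
  have hLm : Measurable L := (Real.measurable_log.comp hμc.measurable).div_const 2
  have hdens : ∀ s, ∀ z ∈ S, density o (powForm μ s ω) z =
      Complex.exp (s * L z) * density o ω z := by
    intro s z hz
    rw [powForm_eq_mulForm, density_mulForm, Complex.cpow_def_of_ne_zero
      (by exact_mod_cast (hpos z hz).ne'), ← Complex.ofReal_log (hμ0 z)]
    congr 2
    simp only [hL]
    push_cast
    ring
  have hi0 : IntegrableOn (density o ω) S (chartMeasure n X) :=
    formIntegrableOn_of_isCompact o hYc.isOpen_compl hω hS hSY
  have hLc : ContinuousOn L S :=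
    (hμc.continuousOn.log fun x hx => (hpos x hx).ne').div_const 2
  have hi : ∀ s : ℂ, Integrable (fun z => Complex.exp (s * L z) * density o ω z)
      ((chartMeasure n X).restrict S) := by
    intro s
    have hc : ContinuousOn (fun z => Complex.exp (s * L z)) S := by fun_prop
    obtain ⟨c, hc'⟩ := hS.exists_bound_of_continuousOn hc
    refine hi0.bdd_mul (c := c) (by fun_prop) ?_
    filter_upwards [ae_restrict_mem hSm] with z hz using hc' z hz
  have hcut : ∀ s, (FormIntegrableOn o (powForm μ s ω) Yᶜ ↔
      FormIntegrableOn o (powForm μ s ω) S) ∧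
      formIntegral o (powForm μ s ω) Yᶜ = formIntegral o (powForm μ s ω) S := by
    intro s
    have := formIntegrableOn_inter_iff o (ω := powForm μ s ω) (O := S) hYc.measurableSet.compl
      fun z hz hzS => mulForm_eq_zero (fun x => (μ x : ℂ) ^ (s / 2)) (hzero z hz hzS)
    rwa [inter_eq_self_of_subset_right hSY] at this
  have hJ : ∀ s, formIntegral o (powForm μ s ω) Yᶜ =
      ∫ z in S, Complex.exp (s * L z) * density o ω z ∂(chartMeasure n X) := by
    intro s
    rw [(hcut s).2]
    exact setIntegral_congr_fun hSm (hdens s)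
  have h0 : powForm μ 0 ω = ω := by
    rw [powForm_eq_mulForm]
    simp only [zero_div, Complex.cpow_zero]
    exact mulForm_one ω
  refine ⟨fun s => (hcut s).1.2 ((integrableOn_congr_fun (hdens s) hSm).2 (hi s)), ?_⟩
  have hent := HasMellinExpansion.of_entire (a := a)
    (J := fun s => formIntegral o (powForm μ s ω) Yᶜ) (F := cutoffIntegral o μ ω) ?_ ?_
  · simpa only [h0] using hent
  · simp only [hJ]
    rw [← differentiableOn_univ]
    exact differentiableOn_integral_exp hLm.aemeasurable isOpen_univ fun s _ => hi s
  · obtain ⟨c, hc0, hc⟩ := hS.exists_forall_le' hμc.continuousOn hpos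
    have h1 : ∀ᶠ ε : ℝ in 𝓝[>] 0, ε ^ 2 < c := by
      have : Tendsto (fun ε : ℝ => ε ^ 2) (𝓝[>] 0) (𝓝 0) := by
        have h2 : Continuous fun ε : ℝ => ε ^ 2 := by fun_prop
        simpa using (h2.tendsto 0).mono_left nhdsWithin_le_nhds
      exact this.eventually_lt_const hc0
    filter_upwards [h1, self_mem_nhdsWithin] with ε hε hε0
    have hAS : {x | ε ^ 2 ≤ μ x} ∩ S = S :=
      inter_eq_self_of_subset_right fun x hx => hε.le.trans (hc x hx)
    have h3 := (formIntegrableOn_inter_iff o (ω := ω) (O := S)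
      (measurableSet_le (measurable_const (a := ε ^ 2)) hμc.measurable) fun z hz hzS =>
        hzero z (fun hzY => by
          rw [mem_ofPred_eq, (hμY z).2 hzY] at hz
          exact absurd (pow_pos (mem_Ioi.1 hε0) 2) (not_lt.2 hz)) hzS).2
    rw [hAS] at h3
    have h4 := (hcut 0).2
    rw [h0] at h4
    simp only [h0]
    rw [cutoffIntegral, h3, h4]

end Integrability

/-! ### Localization -/

section Localization

variable {n : ℕ} {X : Type*} [TopologicalSpace X] [ChartedSpace (EuclideanSpace ℝ (Fin n)) X]
  [SecondCountableTopology X]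

/-- A finite smooth partition of unity on a compact set, subordinate to a given family of
neighbourhoods. -/
theorem exists_finite_partition [T2Space X] [IsManifold (𝓡 n) (⊤ : ℕ∞) X] {S : Set X}
    (hS : IsCompact S) {O : X → Set X} (hO : ∀ x, IsOpen (O x)) (hxO : ∀ x, x ∈ O x) :
    ∃ (t : Finset X) (f : X → X → ℝ), (∀ i, ContMDiff (𝓡 n) 𝓘(ℝ, ℝ) (⊤ : ℕ∞) (f i)) ∧
      (∀ i, tsupport (f i) ⊆ O i) ∧ ∀ x ∈ S, ∑ i ∈ t, f i x = 1 := by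
  haveI : LocallyCompactSpace X := ChartedSpace.locallyCompactSpace (EuclideanSpace ℝ (Fin n)) X
  obtain ⟨f, hf⟩ := SmoothPartitionOfUnity.exists_isSubordinate (𝓡 n) hS.isClosed O hO
    fun x _ => mem_iUnion.2 ⟨x, hxO x⟩
  have hfin := f.locallyFinite.finite_nonempty_inter_compact hS
  refine ⟨hfin.toFinset, fun i => f i, fun i => (f i).contMDiff, hf, fun x hx => ?_⟩
  rw [← f.sum_eq_one hx, finsum_eq_sum_of_support_subset]
  intro i hi
  rw [Finite.coe_toFinset]
  exact ⟨x, hi, hx⟩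

variable [MeasurableSpace X] [BorelSpace X] {ι : Type*} {t : Finset ι} {f : ι → X → ℝ}

theorem formIntegral_partition (o : ManifoldOrientation n X) {ω : Form n X n} {A : Set X}
    (hA : MeasurableSet A) (hf : ∀ z ∈ A, ω z ≠ 0 → ∑ i ∈ t, f i z = 1)
    (hi : ∀ i ∈ t, FormIntegrableOn o (fun x => f i x • ω x) A) :
    FormIntegrableOn o ω A ∧
      formIntegral o ω A = ∑ i ∈ t, formIntegral o (fun x => f i x • ω x) A := by
  have hd : ∀ z ∈ A, density o ω z = ∑ i ∈ t, density o (fun x => f i x • ω x) z := by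
    intro z hz
    simp only [density_real_smul]
    by_cases h : ω z = 0
    · simp [density_eq_zero o h]
    · rw [← Finset.sum_mul, ← Complex.ofReal_sum, hf z hz h, Complex.ofReal_one, one_mul]
  constructor
  · refine (integrableOn_congr_fun hd hA).2 ?_
    exact integrable_finsetSum t hi
  · rw [formIntegral, setIntegral_congr_fun hA hd]
    exact integral_finsetSum t hi

/-- The regularization of `ω`: the zeta integral converges for `re s > a`, and its continuation
and the expansion of the integral with cutoff are described by common coefficients. -/
structure IsRegularizable (o : ManifoldOrientation n X) (Y : Set X) (μ : X → ℝ) (a : ℤ)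
    (ω : Form n X n) : Prop where
  integrable : ∀ s : ℂ, (a : ℝ) < s.re → FormIntegrableOn o (powForm μ s ω) Yᶜ
  expansion : ∃ b A, HasMellinExpansion a b A (fun s => formIntegral o (powForm μ s ω) Yᶜ)
    (cutoffIntegral o μ ω)

theorem HasMellinExpansion.logCoeff_eq {o : ManifoldOrientation n X} {μ : X → ℝ} {a : ℤ}
    {ω : Form n X n} {b : ℤ → ℂ} {A : ℂ} {J : ℂ → ℂ}
    (h : HasMellinExpansion a b A J (cutoffIntegral o μ ω)) : logCoeff o μ ω = b 0 :=
  h.expansion.logCoeff_eq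

theorem HasMellinExpansion.finitePart_eq {o : ManifoldOrientation n X} {μ : X → ℝ} {a : ℤ}
    {ω : Form n X n} {b : ℤ → ℂ} {A : ℂ} {J : ℂ → ℂ}
    (h : HasMellinExpansion a b A J (cutoffIntegral o μ ω)) : finitePart o μ ω = A :=
  h.expansion.finitePart_eq

variable {o : ManifoldOrientation n X} {Y : Set X} {μ : X → ℝ} {a : ℤ} {ω : Form n X n}

theorem real_smul_powForm (χ : X → ℝ) (s : ℂ) :
    (fun x => χ x • powForm μ s ω x) = powForm μ s (fun x => χ x • ω x) := by
  funext x
  exact smul_comm (α := EuclideanSpace ℝ (Fin n) [⋀^Fin n]→L[ℝ] ℂ) (χ x)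
    ((μ x : ℂ) ^ (s / 2)) (ω x)

/-- Regularizability is local, and the regularized integrals are additive. -/
theorem isRegularizable_of_partition [T2Space X] [IsManifold (𝓡 n) (⊤ : ℕ∞) X]
    (hYc : IsClosed Y) (hμc : Continuous μ) (hμY : ∀ x, μ x = 0 ↔ x ∈ Y)
    (hω : ∀ i ∈ t, SmoothFormOn (fun x => f i x • ω x) Yᶜ)
    (hS : RelCompactSupport Y ω) (hf : ∀ z ∉ Y, ω z ≠ 0 → ∑ i ∈ t, f i z = 1)
    (h : ∀ i ∈ t, IsRegularizable o Y μ a (fun x => f i x • ω x)) :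
    IsRegularizable o Y μ a ω ∧
      logCoeff o μ ω = ∑ i ∈ t, logCoeff o μ (fun x => f i x • ω x) ∧
      finitePart o μ ω = ∑ i ∈ t, finitePart o μ (fun x => f i x • ω x) := by
  have h1 : ∀ s : ℂ, (a : ℝ) < s.re → FormIntegrableOn o (powForm μ s ω) Yᶜ ∧
      formIntegral o (powForm μ s ω) Yᶜ =
        ∑ i ∈ t, formIntegral o (powForm μ s (fun x => f i x • ω x)) Yᶜ := by
    intro s hs
    have := formIntegral_partition o (ω := powForm μ s ω) (f := f) (t := t)
      hYc.measurableSet.compl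
      (fun z hz hne => hf z hz fun h0 => hne (mulForm_eq_zero (fun x => (μ x : ℂ) ^ (s / 2)) h0))
      (fun i hi => by
        rw [real_smul_powForm]
        exact (h i hi).integrable s hs)
    simpa only [real_smul_powForm] using this
  have h2 : ∀ ε : ℝ, 0 < ε →
      ∑ i ∈ t, cutoffIntegral o μ (fun x => f i x • ω x) ε = cutoffIntegral o μ ω ε := by
    intro ε hε
    refine (formIntegral_partition o (measurableSet_le measurable_const hμc.measurable)
      (fun z hz hne => hf z (fun hzY => ?_) hne)
      (fun i hi => formIntegrableOn_cutoff o hYc hμc hμY (hω i hi) (hS.smul (f i)) hε)).2.symm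
    rw [mem_ofPred_eq, (hμY z).2 hzY] at hz
    exact absurd (pow_pos hε 2) (not_lt.2 hz)
  have h2' : (fun ε => ∑ i ∈ t, cutoffIntegral o μ (fun x => f i x • ω x) ε) =ᶠ[𝓝[>] 0]
      cutoffIntegral o μ ω := by
    filter_upwards [self_mem_nhdsWithin] with ε hε using h2 ε hε
  obtain ⟨b, A, hbA⟩ := exists_hasMellinExpansion_sum t fun i hi => (h i hi).expansion
  have h3 := hasHadamardExpansion_sum t (K := a.toNat)
    (F := fun i => cutoffIntegral o μ (fun x => f i x • ω x))
    (a := fun i => polarCoeff o μ (fun x => f i x • ω x))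
    (L := fun i => logCoeff o μ (fun x => f i x • ω x))
    (A := fun i => finitePart o μ (fun x => f i x • ω x)) (fun i hi => by
      obtain ⟨b, A, hbA⟩ := (h i hi).expansion
      rw [hbA.logCoeff_eq, hbA.finitePart_eq]
      exact hbA.expansion.congr EventuallyEq.rfl fun k hk => (hbA.expansion.polarCoeff_eq hk).symm)
  have h4 := h3.congr h2' fun _ _ => rfl
  refine ⟨⟨fun s hs => (h1 s hs).1, b, A, hbA.congr (fun s hs => (h1 s hs).2) h2'⟩, ?_, ?_⟩
  · exact h4.logCoeff_eq
  · exact h4.finitePart_eq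

variable [T2Space X] [IsManifold (𝓡 n) (⊤ : ℕ∞) X] {m : ℕ}

/-- Near a point, the singular forms have polar models or are supported away from `Y`. -/
theorem exists_nhds_polar_or_disjoint (o : ManifoldOrientation n X)
    (hY : IsClosedSubmanifold n m Y) (hμ : IsMorseBott n m Y μ) (x : X) :
    ∃ O : Set X, IsOpen O ∧ x ∈ O ∧ ∀ (N : ℕ) (ω : Form n X n), SingularOfOrder Y μ N ω →
      RelCompactSupport Y ω → closure {x | x ∉ Y ∧ ω x ≠ 0} ⊆ O →
      Disjoint (closure {x | x ∉ Y ∧ ω x ≠ 0}) Y ∨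
      ∃ (R : ℝ) (Θ : ℝ × (EuclideanSpace ℝ (Fin m) × EuclideanSpace ℝ (Fin (n - m))) → X)
        (q : ℝ × (EuclideanSpace ℝ (Fin m) × EuclideanSpace ℝ (Fin (n - m))) → ℂ),
        IsPolarModel o Y μ (2 * N - m) ω R Θ q := by
  by_cases hx : x ∈ Y
  · rcases Nat.eq_zero_or_pos m with rfl | hm
    · -- in codimension zero, `Y` is open
      obtain ⟨e, -, hxe, heY⟩ := hY.2.2 x hx
      refine ⟨e.source, e.open_source, hxe, fun N ω _ _ hS => Or.inl ?_⟩
      have hsub : e.source ⊆ Y := fun z hz => (heY z hz).2 fun i hi => absurd hi (Nat.not_lt_zero _)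
      have h0 : {x | x ∉ Y ∧ ω x ≠ 0} = ∅ := by
        ext z
        simp only [mem_ofPred_eq, mem_empty_iff_false, iff_false]
        exact fun hz => hz.1 (hsub (hS (subset_closure hz)))
      rw [h0, closure_empty]
      exact disjoint_bot_left
    · obtain ⟨O, hO, hxO, h⟩ := exists_isPolarModel o hm hY hμ hx
      exact ⟨O, hO, hxO, fun N ω h1 h2 h3 => Or.inr (h N ω h1 h2 h3)⟩
  · exact ⟨Yᶜ, hY.2.1.isOpen_compl, hx, fun N ω _ _ hS =>
      Or.inl (disjoint_left.2 fun z hz => hS hz)⟩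

/-- Singular forms whose support has compact closure are regularizable. -/
theorem isRegularizable_of_singular (o : ManifoldOrientation n X)
    (hY : IsClosedSubmanifold n m Y) (hμ : IsMorseBott n m Y μ) {N : ℕ}
    (hω : SingularOfOrder Y μ N ω) (hS : RelCompactSupport Y ω) :
    IsRegularizable o Y μ (2 * N - m) ω := by
  choose O hO hxO h using exists_nhds_polar_or_disjoint o hY hμ
  obtain ⟨t, f, hfs, hft, hf1⟩ := exists_finite_partition (n := n) hS hO hxO
  have hμc := hμ.smooth.continuous
  refine (isRegularizable_of_partition hY.2.1 hμc hμ.zero_iff (t := t) (f := f)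
    (fun i _ => (hω.smul (hfs i)).1) hS
    (fun z hz hne => hf1 z (mem_closure_of_form_ne_zero hz hne)) fun i _ => ?_).1
  rcases h i N _ (hω.smul (hfs i)) (hS.smul (f i))
    ((support_smul_form_subset (f i) ω).trans (inter_subset_right.trans (hft i))) with
    hd | ⟨R, Θ, q, hp⟩
  · obtain ⟨h1, h2⟩ := hasMellinExpansion_of_disjoint o hY.2.1 hμc hμ.nonneg hμ.zero_iff
      (hω.smul (hfs i)).1 (hS.smul (f i)) hd (2 * N - m)
    exact ⟨fun s _ => h1 s, _, _, h2⟩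
  · exact ⟨fun s hs => (hp.formIntegral_powForm hY.2.1 hμ.zero_iff hs).1,
      hp.exists_hasMellinExpansion hY.2.1 hμ.zero_iff hμc.measurable⟩

theorem contMDiff_exp_two_mul {φ : X → ℝ} (hφ : ContMDiff (𝓡 n) 𝓘(ℝ, ℝ) (⊤ : ℕ∞) φ) :
    ContMDiff (𝓡 n) 𝓘(ℝ, ℝ) (⊤ : ℕ∞) fun x => Real.exp (2 * φ x) := by
  have h2 : ContDiff ℝ (⊤ : ℕ∞) fun t : ℝ => Real.exp (2 * t) :=
    Real.contDiff_exp.comp (contDiff_const.mul contDiff_id)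
  exact h2.contMDiff.comp hφ

theorem HadamardReg.SingularOfOrder.conformal {φ : X → ℝ}
    (hφ : ContMDiff (𝓡 n) 𝓘(ℝ, ℝ) (⊤ : ℕ∞) φ) {N : ℕ} (h : SingularOfOrder Y μ N ω) :
    SingularOfOrder Y (fun x => Real.exp (2 * φ x) * μ x) N ω := by
  obtain ⟨h1, η, hη, hηω⟩ := h
  have hexp : ContMDiff (𝓡 n) 𝓘(ℝ, ℝ) (⊤ : ℕ∞) fun x => Real.exp (2 * φ x) ^ N :=
    (contMDiff_exp_two_mul hφ).pow N
  refine ⟨h1, fun x => Real.exp (2 * φ x) ^ N • η x, hη.smul hexp, fun x hx => ?_⟩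
  change Real.exp (2 * φ x) ^ N • η x = (Real.exp (2 * φ x) * μ x) ^ N • ω x
  rw [hηω x hx, mul_pow]
  exact (mul_smul (β := EuclideanSpace ℝ (Fin n) [⋀^Fin n]→L[ℝ] ℂ) _ _ (ω x)).symm

/-- At a critical zero of `g`, the second derivative of `f g` is that of `g` multiplied by the value
of `f`. -/
theorem fderiv_fderiv_mul_of_critical {E : Type*} [NormedAddCommGroup E] [NormedSpace ℝ E]
    {f g : E → ℝ} {x : E} (hf : ContDiffAt ℝ (⊤ : ℕ∞) f x) (hg : ContDiffAt ℝ (⊤ : ℕ∞) g x)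
    (h0 : g x = 0) (h1 : fderiv ℝ g x = 0) :
    fderiv ℝ (fderiv ℝ (fun y => f y * g y)) x = f x • fderiv ℝ (fderiv ℝ g) x := by
  have hev : ∀ {h : E → ℝ}, ContDiffAt ℝ (⊤ : ℕ∞) h x → ∀ᶠ y in 𝓝 x, DifferentiableAt ℝ h y := by
    intro h hh
    filter_upwards [(hh.of_le (m := 1) (by exact_mod_cast le_top)).eventually (by simp)] with y hy
    exact hy.differentiableAt (by simp)
  have hd : ∀ {h : E → ℝ}, ContDiffAt ℝ (⊤ : ℕ∞) h x → DifferentiableAt ℝ (fderiv ℝ h) x := by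
    intro h hh
    exact (hh.fderiv_right (m := (⊤ : ℕ∞)) (by simp)).differentiableAt (by simp)
  have h2 : fderiv ℝ (fun y => f y * g y) =ᶠ[𝓝 x] fun y => f y • fderiv ℝ g y + g y • fderiv ℝ f y := by
    filter_upwards [hev hf, hev hg] with y hfy hgy
    exact fderiv_fun_mul hfy hgy
  rw [h2.fderiv_eq, fderiv_fun_add (hf.differentiableAt (by simp) |>.fun_smul (hd hg))
    (hg.differentiableAt (by simp) |>.fun_smul (hd hf)),
    fderiv_fun_smul (hf.differentiableAt (by simp)) (hd hg),
    fderiv_fun_smul (hg.differentiableAt (by simp)) (hd hf), h0, h1]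
  ext v w
  simp

theorem HadamardReg.IsMorseBott.conformal {φ : X → ℝ} (hφ : ContMDiff (𝓡 n) 𝓘(ℝ, ℝ) (⊤ : ℕ∞) φ)
    (hμ : IsMorseBott n m Y μ) : IsMorseBott n m Y (fun x => Real.exp (2 * φ x) * μ x) where
  smooth := (contMDiff_exp_two_mul hφ).mul hμ.smooth
  nonneg x := mul_nonneg (Real.exp_pos _).le (hμ.nonneg x)
  zero_iff x := by rw [← hμ.zero_iff x, mul_eq_zero, or_iff_right (Real.exp_ne_zero _)]
  hessian_rank x hx := by
    have hsm : ∀ {g : X → ℝ}, ContMDiff (𝓡 n) 𝓘(ℝ, ℝ) (⊤ : ℕ∞) g →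
        ContDiffAt ℝ (⊤ : ℕ∞) (g ∘ (extChartAt (𝓡 n) x).symm) (extChartAt (𝓡 n) x x) := by
      intro g hg
      have h1 := contDiffOn_comp_chart_symm hg
        (IsManifold.chart_mem_maximalAtlas (I := 𝓡 n) (n := (⊤ : ℕ∞)) x)
      rw [← extChartAt_target_eq x] at h1
      exact h1.contDiffAt (extChartAt_target_mem_nhds x)
    have h0 : (μ ∘ (extChartAt (𝓡 n) x).symm) (extChartAt (𝓡 n) x x) = 0 := by
      rw [Function.comp_apply, extChartAt_to_inv, (hμ.zero_iff x).2 hx]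
    have h1 : fderiv ℝ (μ ∘ (extChartAt (𝓡 n) x).symm) (extChartAt (𝓡 n) x x) = 0 := by
      refine IsLocalMin.fderiv_eq_zero (Eventually.of_forall fun y => ?_)
      rw [h0]
      exact hμ.nonneg _
    have h2 := fderiv_fderiv_mul_of_critical (hsm (contMDiff_exp_two_mul hφ)) (hsm hμ.smooth) h0 h1
    have h3 : hessian n (fun x => Real.exp (2 * φ x) * μ x) x =
        Real.exp (2 * φ x) • hessian n μ x := by
      refine h2.trans ?_
      rw [Function.comp_apply, extChartAt_to_inv]
      rfl
    rw [h3, ContinuousLinearMap.toLinearMap_smul, LinearMap.range_smul _ _ (Real.exp_ne_zero _)]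
    exact hμ.hessian_rank x hx

/-- The effect of a conformal change on the regularized integrals. All terms are additive in `ω`, so a
partition of unity reduces the statement to polar models and to forms supported away from `Y`; for
the latter the finite part is the integral itself, and the logarithmic coefficients vanish. -/
theorem finitePart_conformal (o : ManifoldOrientation n X) (hY : IsClosedSubmanifold n m Y)
    (hμ : IsMorseBott n m Y μ) {N : ℕ} (hω : SingularOfOrder Y μ N ω) (hS : RelCompactSupport Y ω)
    {φ : X → ℝ} (hφ : ContMDiff (𝓡 n) 𝓘(ℝ, ℝ) (⊤ : ℕ∞) φ) :
    logCoeff o (fun x => Real.exp (2 * φ x) * μ x) ω = logCoeff o μ ω ∧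
    finitePart o (fun x => Real.exp (2 * φ x) * μ x) ω =
      finitePart o μ ω + logCoeff o μ (fun x => φ x • ω x) := by
  have hμc := hμ.smooth.continuous
  have hYc := hY.2.1
  have hμ' := hμ.conformal hφ
  choose O hO hxO h using exists_nhds_polar_or_disjoint o hY hμ
  obtain ⟨t, f, hfs, hft, hf1⟩ := exists_finite_partition (n := n) hS hO hxO
  have hlocal : ∀ i, logCoeff o (fun x => Real.exp (2 * φ x) * μ x) (fun x => f i x • ω x) =
        logCoeff o μ (fun x => f i x • ω x) ∧
      finitePart o (fun x => Real.exp (2 * φ x) * μ x) (fun x => f i x • ω x) =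
        finitePart o μ (fun x => f i x • ω x) + logCoeff o μ (fun x => φ x • (f i x • ω x)) := by
    intro i
    have hωi := hω.smul (hfs i)
    have hSi := hS.smul (f i)
    have hSφ : RelCompactSupport Y (fun x => φ x • (f i x • ω x)) := hSi.smul φ
    obtain ⟨b, A, hb⟩ := (isRegularizable_of_singular o hY hμ hωi hSi).expansion
    obtain ⟨b', A', hb'⟩ := (isRegularizable_of_singular o hY hμ' (hωi.conformal hφ) hSi).expansion
    obtain ⟨bφ, Aφ, hbφ⟩ := (isRegularizable_of_singular o hY hμ (hωi.smul hφ) hSφ).expansion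
    have e1 := hb.logCoeff_eq
    have e2 := hb.finitePart_eq
    have e3 := hb'.logCoeff_eq
    have e4 := hb'.finitePart_eq
    have e5 : logCoeff o μ (fun x => φ x • (f i x • ω x)) = bφ 0 := hbφ.logCoeff_eq
    rcases h i N _ hωi hSi
      ((support_smul_form_subset (f i) ω).trans (inter_subset_right.trans (hft i))) with
      hd | ⟨R, Θ, q, hp⟩
    · have k1 := (hasMellinExpansion_of_disjoint o hYc hμc hμ.nonneg hμ.zero_iff hωi.1 hSi hd 0).2
      have k2 := (hasMellinExpansion_of_disjoint o hYc hμ'.smooth.continuous hμ'.nonneg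
        hμ'.zero_iff hωi.1 hSi hd 0).2
      have k3 := (hasMellinExpansion_of_disjoint o hYc hμc hμ.nonneg hμ.zero_iff
        (hωi.smul hφ).1 hSφ (hd.mono_left ((support_smul_form_subset φ _).trans
          inter_subset_left)) 0).2
      rw [k1.logCoeff_eq, k2.logCoeff_eq, k1.finitePart_eq, k2.finitePart_eq]
      have k4 : logCoeff o μ (fun x => φ x • (f i x • ω x)) = 0 := k3.logCoeff_eq
      rw [k4, add_zero]
      exact ⟨rfl, rfl⟩
    · rw [e1, e2, e3, e4, e5]
      exact hp.conformal_change hYc hμ.zero_iff hφ hb hb' hbφ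
  have hne : ∀ z ∉ Y, ω z ≠ 0 → ∑ i ∈ t, f i z = 1 := fun z hz hne =>
    hf1 z (mem_closure_of_form_ne_zero hz hne)
  obtain ⟨-, g1, g2⟩ := isRegularizable_of_partition hYc hμc hμ.zero_iff (t := t) (f := f) (o := o)
    (fun i _ => (hω.smul (hfs i)).1) hS hne fun i _ =>
      isRegularizable_of_singular o hY hμ (hω.smul (hfs i)) (hS.smul (f i))
  obtain ⟨-, g3, g4⟩ := isRegularizable_of_partition hYc hμ'.smooth.continuous hμ'.zero_iff
    (t := t) (f := f) (o := o) (fun i _ => (hω.smul (hfs i)).1) hS hne fun i _ =>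
      isRegularizable_of_singular o hY hμ' ((hω.smul (hfs i)).conformal hφ) (hS.smul (f i))
  have hcomm : ∀ i, (fun x => f i x • (φ x • ω x)) = fun x => φ x • (f i x • ω x) := fun i => by
    funext x
    exact smul_comm (α := EuclideanSpace ℝ (Fin n) [⋀^Fin n]→L[ℝ] ℂ) (f i x) (φ x) (ω x)
  obtain ⟨-, g5, -⟩ := isRegularizable_of_partition hYc hμc hμ.zero_iff (t := t) (f := f) (o := o)
    (ω := fun x => φ x • ω x)
    (fun i _ => ((hω.smul hφ).smul (hfs i)).1) (hS.smul φ)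
    (fun z hz hne' => hne z hz fun h0 => hne' (real_smul_form_eq_zero _ h0)) fun i _ =>
      isRegularizable_of_singular o hY hμ ((hω.smul hφ).smul (hfs i)) ((hS.smul φ).smul (f i))
  simp only [hcomm] at g5
  rw [g1, g2, g3, g4, g5, ← Finset.sum_add_distrib]
  exact ⟨Finset.sum_congr rfl fun i _ => (hlocal i).1, Finset.sum_congr rfl fun i _ => (hlocal i).2⟩

end Localization

/-! ### The exterior derivative in charts -/

section ExteriorAlgebra

variable {E : Type*} [NormedAddCommGroup E] [NormedSpace ℝ E] {k : ℕ}

theorem oneWedge_apply (α : E →L[ℝ] ℝ) (ψ : E [⋀^Fin k]→L[ℝ] ℂ) (v : Fin (k + 1) → E) :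
    oneWedge α ψ v = ∑ i : Fin (k + 1), (-1 : ℤ) ^ (i : ℕ) • (α (v i) • ψ (i.removeNth v)) := by
  rw [oneWedge, ContinuousAlternatingMap.alternatizeUncurryFin_apply]
  rfl

theorem coe_smul_form (c : ℝ) (ψ : E [⋀^Fin k]→L[ℝ] ℂ) : (c : ℂ) • ψ = c • ψ := by
  ext v
  rw [ContinuousAlternatingMap.smul_apply, ContinuousAlternatingMap.smul_apply, smul_eq_mul,
    Complex.real_smul]

theorem oneWedge_smul_left (c : ℝ) (α : E →L[ℝ] ℝ) (ψ : E [⋀^Fin k]→L[ℝ] ℂ) :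
    oneWedge (c • α) ψ = c • oneWedge α ψ := by
  ext v
  simp only [oneWedge_apply, ContinuousAlternatingMap.smul_apply, Finset.smul_sum]
  refine Finset.sum_congr rfl fun i _ => ?_
  rw [smul_comm c, _root_.smul_apply, smul_assoc]

theorem oneWedge_smul_right (c : ℝ) (α : E →L[ℝ] ℝ) (ψ : E [⋀^Fin k]→L[ℝ] ℂ) :
    oneWedge α (c • ψ) = c • oneWedge α ψ := by
  ext v
  simp only [oneWedge_apply, ContinuousAlternatingMap.smul_apply, Finset.smul_sum]
  refine Finset.sum_congr rfl fun i _ => ?_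
  rw [smul_comm c, smul_comm c]

theorem oneWedge_sum {ι : Type*} (t : Finset ι) (α : E →L[ℝ] ℝ) (ψ : ι → E [⋀^Fin k]→L[ℝ] ℂ) :
    oneWedge α (∑ i ∈ t, ψ i) = ∑ i ∈ t, oneWedge α (ψ i) := by
  ext v
  simp only [oneWedge_apply, ContinuousAlternatingMap.sum_apply, Finset.smul_sum]
  exact Finset.sum_comm

theorem oneWedge_zero (α : E →L[ℝ] ℝ) : oneWedge α (0 : E [⋀^Fin k]→L[ℝ] ℂ) = 0 := by
  ext v
  simp [oneWedge_apply]

theorem oneWedge_compContinuousLinearMap {F : Type*} [NormedAddCommGroup F] [NormedSpace ℝ F]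
    (α : E →L[ℝ] ℝ) (ψ : E [⋀^Fin k]→L[ℝ] ℂ) (L : F →L[ℝ] E) :
    (oneWedge α ψ).compContinuousLinearMap L =
      oneWedge (α.comp L) (ψ.compContinuousLinearMap L) := by
  ext v
  rw [ContinuousAlternatingMap.compContinuousLinearMap_apply, oneWedge_apply, oneWedge_apply]
  rfl

theorem ContDiffOn.oneWedge {F : Type*} [NormedAddCommGroup F] [NormedSpace ℝ F]
    {α : F → E →L[ℝ] ℝ} {ψ : F → E [⋀^Fin k]→L[ℝ] ℂ} {s : Set F}
    (hα : ContDiffOn ℝ (⊤ : ℕ∞) α s) (hψ : ContDiffOn ℝ (⊤ : ℕ∞) ψ s) :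
    ContDiffOn ℝ (⊤ : ℕ∞) (fun y => oneWedge (α y) (ψ y)) s := by
  have h1 : ContDiffOn ℝ (⊤ : ℕ∞) (fun y => (α y).smulRight (ψ y)) s := hα.smulRight hψ
  exact (ContinuousAlternatingMap.alternatizeUncurryFinCLM ℝ E ℂ).contDiff.comp_contDiffOn h1

theorem ContDiffOn.extDeriv {β : E → E [⋀^Fin k]→L[ℝ] ℂ} {s : Set E} (hs : IsOpen s)
    (hβ : ContDiffOn ℝ (⊤ : ℕ∞) β s) : ContDiffOn ℝ (⊤ : ℕ∞) (extDeriv β) s :=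
  (ContinuousAlternatingMap.alternatizeUncurryFinCLM ℝ E ℂ).contDiff.comp_contDiffOn
    (hβ.fderiv_of_isOpen hs (by simp))

/-- The Leibniz rule for the product of a form and a complex-valued function of a real-valued
function. -/
theorem extDeriv_comp_smul {P : ℝ → ℂ} {P' : ℂ} {g : E → ℝ} {β : E → E [⋀^Fin k]→L[ℝ] ℂ} {y : E}
    (hP : HasDerivAt P P' (g y)) (hg : DifferentiableAt ℝ g y) (hβ : DifferentiableAt ℝ β y) :
    extDeriv (fun z => P (g z) • β z) y =
      P (g y) • extDeriv β y + P' • oneWedge (fderiv ℝ g y) (β y) := by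
  have h1 : HasFDerivAt (fun z => P (g z)) ((fderiv ℝ g y).smulRight P') y :=
    hP.hasFDerivAt.comp y hg.hasFDerivAt |>.congr_fderiv (by
      ext v
      simp)
  have h2 := h1.fun_smul hβ.hasFDerivAt
  ext v
  rw [extDeriv, h2.fderiv, ContinuousAlternatingMap.alternatizeUncurryFin_apply,
    ContinuousAlternatingMap.add_apply, ContinuousAlternatingMap.smul_apply,
    ContinuousAlternatingMap.smul_apply, oneWedge_apply, extDeriv,
    ContinuousAlternatingMap.alternatizeUncurryFin_apply, Finset.smul_sum, Finset.smul_sum,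
    ← Finset.sum_add_distrib]
  refine Finset.sum_congr rfl fun i _ => ?_
  simp only [_root_.add_apply, _root_.smul_apply,
    ContinuousLinearMap.smulRight_apply, ContinuousAlternatingMap.add_apply,
    ContinuousAlternatingMap.smul_apply, smul_eq_mul, Complex.real_smul, zsmul_eq_mul]
  push_cast
  ring

theorem extDeriv_fun_sum {ι : Type*} (t : Finset ι) {β : ι → E → E [⋀^Fin k]→L[ℝ] ℂ} {y : E}
    (h : ∀ i ∈ t, DifferentiableAt ℝ (β i) y) :
    extDeriv (fun z => ∑ i ∈ t, β i z) y = ∑ i ∈ t, extDeriv (β i) y := by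
  simp only [extDeriv]
  rw [fderiv_fun_sum h]
  exact map_sum (ContinuousAlternatingMap.alternatizeUncurryFinCLM ℝ E ℂ) _ _

end ExteriorAlgebra

section ExteriorDerivative

variable {n k : ℕ} {X : Type*} [TopologicalSpace X] [ChartedSpace (EuclideanSpace ℝ (Fin n)) X]

local notation "𝔼" => EuclideanSpace ℝ (Fin n)

/-- The form `dg ∧ ψ`. -/
noncomputable def dWedge (g : X → ℝ) (ψ : Form n X k) : Form n X (k + 1) := fun x =>
  oneWedge (E := EuclideanSpace ℝ (Fin n)) (mfderiv (𝓡 n) 𝓘(ℝ, ℝ) g x) (ψ x)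

theorem mem_chartAt_target_inter {U : Set X} {x : X} (hx : x ∈ U) :
    chartAt 𝔼 x x ∈ (chartAt 𝔼 x).target ∩ (chartAt 𝔼 x).symm ⁻¹' U := by
  refine ⟨(chartAt 𝔼 x).map_source (mem_chart_source 𝔼 x), ?_⟩
  rw [mem_preimage, (chartAt 𝔼 x).left_inv (mem_chart_source 𝔼 x)]
  exact hx

variable [IsManifold (𝓡 n) (⊤ : ℕ∞) X]
  {e : OpenPartialHomeomorph X (EuclideanSpace ℝ (Fin n))} {g : X → ℝ} {ψ : Form n X k}

theorem mfderiv_comp_chartFrame (he : e ∈ IsManifold.maximalAtlas (𝓡 n) (⊤ : ℕ∞) X)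
    (hg : ContMDiff (𝓡 n) 𝓘(ℝ, ℝ) (⊤ : ℕ∞) g) {y : 𝔼} (hy : y ∈ e.target) :
    (mfderiv (𝓡 n) 𝓘(ℝ, ℝ) g (e.symm y) : 𝔼 →L[ℝ] ℝ).comp (chartFrame e y) =
      fderiv ℝ (g ∘ e.symm) y := by
  rw [← mfderiv_eq_fderiv]
  exact (mfderiv_comp y (hg.mdifferentiableAt (by simp)) (mdifferentiableAt_chart_symm he hy)).symm

theorem formIn_dWedge (he : e ∈ IsManifold.maximalAtlas (𝓡 n) (⊤ : ℕ∞) X)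
    (hg : ContMDiff (𝓡 n) 𝓘(ℝ, ℝ) (⊤ : ℕ∞) g) {y : 𝔼} (hy : y ∈ e.target) :
    formIn e (dWedge g ψ) y = oneWedge (fderiv ℝ (g ∘ e.symm) y) (formIn e ψ y) := by
  rw [← mfderiv_comp_chartFrame he hg hy]
  exact oneWedge_compContinuousLinearMap (E := 𝔼) (F := 𝔼) _ (formAt ψ (e.symm y)) (chartFrame e y)

theorem HadamardReg.SmoothFormOn.contDiffOn_formIn {U : Set X} (hψ : SmoothFormOn ψ U) (p : X) :
    ContDiffOn ℝ (⊤ : ℕ∞) (formIn (chartAt 𝔼 p) ψ)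
      ((chartAt 𝔼 p).target ∩ (chartAt 𝔼 p).symm ⁻¹' U) := by
  have := hψ p
  rwa [extChartAt_target_eq p] at this

theorem smoothFormOn_of_formIn {U : Set X} (h : ∀ p, ContDiffOn ℝ (⊤ : ℕ∞) (formIn (chartAt 𝔼 p) ψ)
    ((chartAt 𝔼 p).target ∩ (chartAt 𝔼 p).symm ⁻¹' U)) : SmoothFormOn ψ U := by
  intro p
  rw [extChartAt_target_eq p]
  exact h p

/-- The coordinate expression of the de Rham differential. -/
theorem formIn_extD (he : e ∈ IsManifold.maximalAtlas (𝓡 n) (⊤ : ℕ∞) X) {U : Set X} (hU : IsOpen U)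
    (hψ : SmoothFormOn ψ U) {y : 𝔼} (hy : y ∈ e.target ∩ e.symm ⁻¹' U) :
    formIn e (extD ψ) y = extDeriv (formIn e ψ) y := by
  set x := e.symm y with hx
  set e' := chartAt 𝔼 x with he'd
  have he' : e' ∈ IsManifold.maximalAtlas (𝓡 n) (⊤ : ℕ∞) X := IsManifold.chart_mem_maximalAtlas x
  have hy' : y ∈ e.target ∩ e.symm ⁻¹' e'.source := ⟨hy.1, mem_chart_source 𝔼 x⟩
  have h1 : formIn e ψ =ᶠ[𝓝 y] fun z => (formIn e' ψ ((e' ∘ e.symm) z)).compContinuousLinearMap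
      (fderiv ℝ (e' ∘ e.symm) z) := by
    filter_upwards [(e.isOpen_inter_preimage_symm e'.open_source).mem_nhds hy'] with z hz
    exact formIn_eq he he' ψ hz
  have h2 : DifferentiableAt ℝ (formIn e' ψ) ((e' ∘ e.symm) y) :=
    ((hψ.contDiffOn_formIn x).contDiffAt ((e'.isOpen_inter_preimage_symm hU).mem_nhds
      (mem_chartAt_target_inter hy.2))).differentiableAt (by simp)
  rw [h1.extDeriv_eq, extDeriv_pullback h2 (contDiffAt_transition he he' hy') (by
    rw [minSmoothness_of_isRCLikeNormedField]
    exact WithTop.coe_le_coe.2 (le_top (a := (2 : ℕ∞))))]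
  have h3 : fderiv ℝ (e' ∘ e.symm) y =
      (mfderiv (𝓡 n) 𝓘(ℝ, 𝔼) e' x : 𝔼 →L[ℝ] 𝔼).comp (chartFrame e y) := by
    rw [← mfderiv_eq_fderiv]
    exact mfderiv_comp y (mdifferentiableAt_chart he' hy'.2) (mdifferentiableAt_chart_symm he hy.1)
  rw [h3]
  rfl

theorem form_ext_of_formIn (he : e ∈ IsManifold.maximalAtlas (𝓡 n) (⊤ : ℕ∞) X) {y : 𝔼}
    (hy : y ∈ e.target) {ω η : Form n X k} (h : formIn e ω y = formIn e η y) :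
    ω (e.symm y) = η (e.symm y) := by
  obtain ⟨L, hL⟩ := exists_comp_chartFrame he hy
  have hL' : (chartFrame e y).comp L = ContinuousLinearMap.id ℝ 𝔼 := by
    have h1 : (L : 𝔼 →ₗ[ℝ] 𝔼) * (chartFrame e y : 𝔼 →ₗ[ℝ] 𝔼) = 1 := by
      ext1 v
      exact DFunLike.congr_fun hL v
    have h2 := mul_eq_one_comm.1 h1
    ext1 v
    exact DFunLike.congr_fun h2 v
  have h3 : ∀ θ : Form n X k, formAt θ (e.symm y) = (formIn e θ y).compContinuousLinearMap L := by
    intro θ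
    ext v
    change _ = formAt θ (e.symm y) fun i => ((chartFrame e y).comp L) (v i)
    rw [hL']
    rfl
  change formAt ω (e.symm y) = formAt η (e.symm y)
  rw [h3, h3, h]

theorem form_ext_of_formIn_chartAt {x : X} {ω η : Form n X k}
    (h : formIn (chartAt 𝔼 x) ω (chartAt 𝔼 x x) = formIn (chartAt 𝔼 x) η (chartAt 𝔼 x x)) :
    ω x = η x := by
  have := form_ext_of_formIn (IsManifold.chart_mem_maximalAtlas x)
    ((chartAt 𝔼 x).map_source (mem_chart_source 𝔼 x)) h
  rwa [(chartAt 𝔼 x).left_inv (mem_chart_source 𝔼 x)] at this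

theorem HadamardReg.SmoothFormOn.extD {U : Set X} (hU : IsOpen U) (hψ : SmoothFormOn ψ U) :
    SmoothFormOn (extD ψ) U := smoothFormOn_of_formIn fun p =>
  ((hψ.contDiffOn_formIn p).extDeriv ((chartAt 𝔼 p).isOpen_inter_preimage_symm hU)).congr
    fun _ hy => formIn_extD (IsManifold.chart_mem_maximalAtlas p) hU hψ hy

theorem HadamardReg.SmoothFormOn.dWedge {U : Set X} (hg : ContMDiff (𝓡 n) 𝓘(ℝ, ℝ) (⊤ : ℕ∞) g)
    (hψ : SmoothFormOn ψ U) : SmoothFormOn (dWedge g ψ) U := smoothFormOn_of_formIn fun p => by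
  have he : chartAt 𝔼 p ∈ IsManifold.maximalAtlas (𝓡 n) (⊤ : ℕ∞) X :=
    IsManifold.chart_mem_maximalAtlas p
  have h1 : ContDiffOn ℝ (⊤ : ℕ∞) (fderiv ℝ (g ∘ (chartAt 𝔼 p).symm)) (chartAt 𝔼 p).target :=
    (contDiffOn_comp_chart_symm hg he).fderiv_of_isOpen (chartAt 𝔼 p).open_target (by simp)
  exact ((h1.mono inter_subset_left).oneWedge (hψ.contDiffOn_formIn p)).congr
    fun y hy => formIn_dWedge he hg hy.1

end ExteriorDerivative

/-! ### Stokes' theorem on Euclidean space -/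

section ComplexPower

theorem hasDerivAt_ofReal_cpow {w : ℂ} (hw : 1 < w.re) (t : ℝ) :
    HasDerivAt (fun t : ℝ => (t : ℂ) ^ w) (w * (t : ℂ) ^ (w - 1)) t := by
  have hw0 : w ≠ 0 := fun h => by
    rw [h, Complex.zero_re] at hw
    linarith
  rcases eq_or_ne t 0 with rfl | ht
  · have hw1 : w - 1 ≠ 0 := fun h => by
      rw [sub_eq_zero.1 h, Complex.one_re] at hw
      exact lt_irrefl _ hw
    rw [Complex.ofReal_zero, Complex.zero_cpow hw1, mul_zero, hasDerivAt_iff_tendsto_slope]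
    have hc := Complex.continuousAt_ofReal_cpow_const 0 (w - 1) (Or.inl (by
      rw [Complex.sub_re, Complex.one_re]
      linarith))
    have h1 : Tendsto (fun t : ℝ => (t : ℂ) ^ (w - 1)) (𝓝[≠] 0) (𝓝 0) := by
      have := hc.tendsto.mono_left (nhdsWithin_le_nhds (s := {0}ᶜ))
      rwa [Complex.ofReal_zero, Complex.zero_cpow hw1] at this
    refine h1.congr' ?_
    filter_upwards [self_mem_nhdsWithin] with t ht
    have ht' : (t : ℂ) ≠ 0 := by exact_mod_cast ht
    rw [slope_def_module, Complex.ofReal_zero, Complex.zero_cpow hw0, sub_zero, sub_zero,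
      Complex.cpow_sub _ _ ht', Complex.cpow_one, Complex.real_smul, Complex.ofReal_inv]
    ring
  · exact hasDerivAt_ofReal_cpow_const ht hw0

theorem contDiff_ofReal_cpow {w : ℂ} (hw : 1 < w.re) : ContDiff ℝ 1 fun t : ℝ => (t : ℂ) ^ w := by
  rw [contDiff_one_iff_deriv]
  refine ⟨fun t => (hasDerivAt_ofReal_cpow hw t).differentiableAt, ?_⟩
  have h1 : deriv (fun t : ℝ => (t : ℂ) ^ w) = fun t : ℝ => w * (t : ℂ) ^ (w - 1) :=
    funext fun t => (hasDerivAt_ofReal_cpow hw t).deriv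
  rw [h1]
  refine continuous_const.mul (continuous_iff_continuousAt.2 fun t => ?_)
  exact Complex.continuousAt_ofReal_cpow_const t (w - 1) (Or.inl (by
    rw [Complex.sub_re, Complex.one_re]
    linarith))

end ComplexPower

section EuclideanStokes

variable {k : ℕ}

/-- The integral of a directional derivative vanishes: integration by parts against the constant `1`. -/
theorem integral_fderiv_apply_eq_zero {E : Type*} [NormedAddCommGroup E] [NormedSpace ℝ E]
    [FiniteDimensional ℝ E] [MeasurableSpace E] [BorelSpace E] {ν : Measure E} [ν.IsAddHaarMeasure]
    {b : E → ℂ} (hb : ContDiff ℝ 1 b) (hc : HasCompactSupport b) (v : E) :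
    Integrable (fun y => fderiv ℝ b y v) ν ∧ ∫ y, fderiv ℝ b y v ∂ν = 0 := by
  have h1 : Continuous fun y => fderiv ℝ b y v :=
    (hb.continuous_fderiv (by simp)).clm_apply continuous_const
  have h2 : Integrable (fun y => fderiv ℝ b y v) ν :=
    h1.integrable_of_hasCompactSupport (hc.fderiv_apply ℝ v)
  refine ⟨h2, ?_⟩
  have h3 := integral_mul_fderiv_eq_neg_fderiv_mul_of_integrable (μ := ν) (𝕜 := ℂ)
    (f := fun _ : E => (1 : ℂ)) (g := b) (v := v) (by simp) (by simpa using h2)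
    (by simpa using hb.continuous.integrable_of_hasCompactSupport hc)
    (fun _ _ => differentiableAt_const _) (fun y _ => hb.differentiable (by simp) y)
  simpa using h3

/-- Stokes' theorem for compactly supported forms on Euclidean space. -/
theorem integral_extDeriv_eq_zero
    {B : EuclideanSpace ℝ (Fin (k + 1)) → EuclideanSpace ℝ (Fin (k + 1)) [⋀^Fin k]→L[ℝ] ℂ}
    (hB : ContDiff ℝ 1 B) (hc : HasCompactSupport B) :
    ∫ y, extDeriv B y (fun i => EuclideanSpace.single i (1 : ℝ)) = 0 := by
  set v : Fin (k + 1) → EuclideanSpace ℝ (Fin (k + 1)) := fun i => EuclideanSpace.single i 1 with hv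
  let ev : ∀ u : Fin k → EuclideanSpace ℝ (Fin (k + 1)),
      (EuclideanSpace ℝ (Fin (k + 1)) [⋀^Fin k]→L[ℝ] ℂ) →L[ℝ] ℂ := fun u =>
    ContinuousAlternatingMap.apply ℝ (EuclideanSpace ℝ (Fin (k + 1))) ℂ u
  have h1 : ∀ y, extDeriv B y v = ∑ i : Fin (k + 1), (-1 : ℤ) ^ (i : ℕ) •
      fderiv ℝ (fun y => B y (i.removeNth v)) y (v i) := by
    intro y
    rw [extDeriv, ContinuousAlternatingMap.alternatizeUncurryFin_apply]
    refine Finset.sum_congr rfl fun i _ => ?_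
    have h2 : HasFDerivAt (fun y => B y (i.removeNth v)) ((ev (i.removeNth v)).comp (fderiv ℝ B y)) y :=
      (ev (i.removeNth v)).hasFDerivAt.comp y (hB.differentiable (by simp) y).hasFDerivAt
    rw [h2.fderiv]
    rfl
  have h3 : ∀ i : Fin (k + 1), ContDiff ℝ 1 fun y => B y (i.removeNth v) := fun i =>
    (ev (i.removeNth v)).contDiff.comp hB
  have h4 : ∀ i : Fin (k + 1), HasCompactSupport fun y => B y (i.removeNth v) := fun i =>
    hc.comp_left (g := ev (i.removeNth v)) (map_zero _)
  simp only [h1]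
  rw [integral_finsetSum]
  · refine Finset.sum_eq_zero fun i _ => ?_
    simp only [zsmul_eq_mul]
    rw [integral_const_mul, (integral_fderiv_apply_eq_zero (h3 i) (h4 i) (v i)).2, mul_zero]
  · intro i _
    simp only [zsmul_eq_mul]
    exact (integral_fderiv_apply_eq_zero (h3 i) (h4 i) (v i)).1.const_mul _

end EuclideanStokes

/-! ### Derivatives of singular forms -/

section SingularDerivative

variable {n k : ℕ} {X : Type*} [TopologicalSpace X] [ChartedSpace (EuclideanSpace ℝ (Fin n)) X]
  {Y : Set X} {μ : X → ℝ} {N : ℕ} {ψ : Form n X k}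

local notation "𝔼" => EuclideanSpace ℝ (Fin n)

/-- The form `dμ/μ ∧ ψ`. -/
noncomputable def dLogWedge (μ : X → ℝ) (ψ : Form n X k) : Form n X (k + 1) := fun x =>
  (μ x)⁻¹ • dWedge μ ψ x

theorem wedgeOne_dLog (μ : X → ℝ) (ψ : Form n X k) :
    wedgeOne ψ (dLog μ) = fun x => (-1 : ℝ) ^ k • dLogWedge μ ψ x := by
  funext x
  exact congrArg (fun θ : 𝔼 [⋀^Fin (k + 1)]→L[ℝ] ℂ => (-1 : ℝ) ^ k • θ)
    (oneWedge_smul_left (E := 𝔼) (μ x)⁻¹ (mfderiv (𝓡 n) 𝓘(ℝ, ℝ) μ x) (ψ x))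

theorem dWedge_eq_zero (g : X → ℝ) {x : X} (h : ψ x = 0) : dWedge g ψ x = 0 := by
  have h1 : formAt ψ x = 0 := h
  change oneWedge (E := 𝔼) (mfderiv (𝓡 n) 𝓘(ℝ, ℝ) g x) (formAt ψ x) = 0
  rw [h1]
  exact oneWedge_zero _

theorem extD_congr {V : Set X} (hV : IsOpen V) {ψ' : Form n X k} (h : ∀ z ∈ V, ψ z = ψ' z) {x : X}
    (hx : x ∈ V) : extD ψ x = extD ψ' x := by
  have h1 : inChart ψ x =ᶠ[𝓝 (chartAt 𝔼 x x)] inChart ψ' x := by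
    filter_upwards [((chartAt 𝔼 x).isOpen_inter_preimage_symm hV).mem_nhds
      (mem_chartAt_target_inter hx)] with y hy
    have h2 : formAt ψ ((chartAt 𝔼 x).symm y) = formAt ψ' ((chartAt 𝔼 x).symm y) := h _ hy.2
    rw [← formIn_chartAt, ← formIn_chartAt, formIn, formIn, h2]
  have h3 : extDeriv (inChart ψ x) (extChartAt (𝓡 n) x x) =
      extDeriv (inChart ψ' x) (extChartAt (𝓡 n) x x) := h1.extDeriv_eq
  unfold extD
  rw [h3]

theorem extD_eq_zero {V : Set X} (hV : IsOpen V) (h : ∀ z ∈ V, ψ z = 0) {x : X} (hx : x ∈ V) :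
    extD ψ x = 0 := by
  rw [extD_congr hV (ψ' := fun _ => 0) h hx]
  have h1 : inChart (fun _ : X => 0 : Form n X k) x = fun _ => 0 := rfl
  have h2 : extDeriv (inChart (fun _ : X => 0 : Form n X k) x) (extChartAt (𝓡 n) x x) = 0 := by
    rw [h1]
    ext v
    simp [extDeriv, ContinuousAlternatingMap.alternatizeUncurryFin_apply]
  unfold extD
  rw [h2]
  rfl

theorem support_extD_subset (hYc : IsClosed Y) :
    closure {x | x ∉ Y ∧ extD ψ x ≠ 0} ⊆ closure {x | x ∉ Y ∧ ψ x ≠ 0} := by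
  refine closure_minimal (fun x hx => ?_) isClosed_closure
  by_contra hxS
  refine hx.2 (extD_eq_zero (V := (closure {x | x ∉ Y ∧ ψ x ≠ 0})ᶜ ∩ Yᶜ)
    (isClosed_closure.isOpen_compl.inter hYc.isOpen_compl) (fun z hz => ?_) ⟨hxS, hx.1⟩)
  by_contra h
  exact hz.1 (mem_closure_of_form_ne_zero hz.2 h)

theorem support_dLogWedge_subset :
    closure {x | x ∉ Y ∧ dLogWedge μ ψ x ≠ 0} ⊆ closure {x | x ∉ Y ∧ ψ x ≠ 0} :=
  closure_mono fun x hx => ⟨hx.1, fun h => hx.2 (by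
    have h1 : dWedge μ ψ x = 0 := dWedge_eq_zero μ h
    exact real_smul_form_eq_zero (μ x)⁻¹ h1)⟩

theorem HadamardReg.RelCompactSupport.extD (hYc : IsClosed Y) (h : RelCompactSupport Y ψ) :
    RelCompactSupport Y (extD ψ) :=
  h.of_isClosed_subset isClosed_closure (support_extD_subset hYc)

theorem HadamardReg.RelCompactSupport.dLogWedge (h : RelCompactSupport Y ψ) :
    RelCompactSupport Y (dLogWedge μ ψ) :=
  h.of_isClosed_subset isClosed_closure support_dLogWedge_subset

variable [IsManifold (𝓡 n) (⊤ : ℕ∞) X]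

theorem HadamardReg.SingularOfOrder.dLogWedge (hμ : ContMDiff (𝓡 n) 𝓘(ℝ, ℝ) (⊤ : ℕ∞) μ)
    (hμY : ∀ x, μ x = 0 ↔ x ∈ Y) (h : SingularOfOrder Y μ N ψ) :
    SingularOfOrder Y μ (N + 1) (dLogWedge μ ψ) := by
  obtain ⟨h1, η, hη, hηψ⟩ := h
  refine ⟨smoothFormOn_of_formIn fun p => ?_, dWedge μ η, hη.dWedge hμ, fun x hx => ?_⟩
  · have he : chartAt 𝔼 p ∈ IsManifold.maximalAtlas (𝓡 n) (⊤ : ℕ∞) X :=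
      IsManifold.chart_mem_maximalAtlas p
    refine ContDiffOn.congr (f := fun y => ((μ ∘ (chartAt 𝔼 p).symm) y)⁻¹ •
      formIn (chartAt 𝔼 p) (dWedge μ ψ) y) ?_ fun y _ => rfl
    refine (((contDiffOn_comp_chart_symm hμ he).mono inter_subset_left).inv fun y hy h0 => ?_).smul
      ((h1.dWedge hμ).contDiffOn_formIn p)
    exact hy.2 ((hμY _).1 h0)
  · have hμx : μ x ≠ 0 := fun h => hx ((hμY x).1 h)
    have h2 : formAt η x = μ x ^ N • formAt ψ x := hηψ x hx
    have h3 : ∀ α : 𝔼 →L[ℝ] ℝ, oneWedge α (formAt η x) =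
        μ x ^ (N + 1) • ((μ x)⁻¹ • oneWedge α (formAt ψ x)) := fun α => by
      rw [h2, oneWedge_smul_right, smul_smul, pow_succ, mul_assoc, mul_inv_cancel₀ hμx, mul_one]
    exact h3 (mfderiv (𝓡 n) 𝓘(ℝ, ℝ) μ x)

theorem HadamardReg.SingularOfOrder.extD (hYc : IsClosed Y)
    (hμ : ContMDiff (𝓡 n) 𝓘(ℝ, ℝ) (⊤ : ℕ∞) μ) (h : SingularOfOrder Y μ N ψ) :
    SingularOfOrder Y μ (N + 1) (extD ψ) := by
  obtain ⟨h1, η, hη, hηψ⟩ := h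
  -- `μ ^ (N + 1) dψ = μ d(μ ^ N ψ) - N dμ ∧ (μ ^ N ψ)`
  refine ⟨h1.extD hYc.isOpen_compl, fun x => μ x • HadamardReg.extD η x + (-(N : ℝ)) • dWedge μ η x, ?_, ?_⟩
  · have g1 := (hη.extD isOpen_univ).smul hμ
    have g2 := (hη.dWedge hμ).smul (χ := fun _ => -(N : ℝ)) contMDiff_const
    exact fun p => (g1 p).add (g2 p)
  · intro x hx
    set e := chartAt 𝔼 x with hed
    have he : e ∈ IsManifold.maximalAtlas (𝓡 n) (⊤ : ℕ∞) X := IsManifold.chart_mem_maximalAtlas x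
    set y := e x with hyd
    have hy : y ∈ e.target ∩ e.symm ⁻¹' Yᶜ := mem_chartAt_target_inter hx
    set g := μ ∘ e.symm with hgd
    have hg : DifferentiableAt ℝ g y := ((contDiffOn_comp_chart_symm hμ he).contDiffAt
      (e.open_target.mem_nhds hy.1)).differentiableAt (by simp)
    have hβ : DifferentiableAt ℝ (formIn e ψ) y := ((h1.contDiffOn_formIn x).contDiffAt
      ((e.isOpen_inter_preimage_symm hYc.isOpen_compl).mem_nhds hy)).differentiableAt (by simp)
    have hP : HasDerivAt (fun t : ℝ => (t : ℂ) ^ N) (((N : ℝ) * g y ^ (N - 1) : ℝ) : ℂ) (g y) := by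
      have h3 := (hasDerivAt_pow N (g y)).ofReal_comp
      simpa using h3
    have hηe : ∀ z ∈ e.target ∩ e.symm ⁻¹' Yᶜ, formIn e η z = g z ^ N • formIn e ψ z := by
      intro z hz
      have h2 : formAt η (e.symm z) = μ (e.symm z) ^ N • formAt ψ (e.symm z) := hηψ _ hz.2
      rw [formIn, h2]
      rfl
    have hηe' : formIn e η =ᶠ[𝓝 y] fun z => (g z : ℂ) ^ N • formIn e ψ z := by
      filter_upwards [(e.isOpen_inter_preimage_symm hYc.isOpen_compl).mem_nhds hy] with z hz
      rw [hηe z hz, ← Complex.ofReal_pow, coe_smul_form]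
    refine form_ext_of_formIn_chartAt
      (ω := fun x => μ x • HadamardReg.extD η x + (-(N : ℝ)) • dWedge μ η x)
      (η := fun x => μ x ^ (N + 1) • HadamardReg.extD ψ x) ?_
    change g y • formIn e (HadamardReg.extD η) y + (-(N : ℝ)) • formIn e (dWedge μ η) y =
      g y ^ (N + 1) • formIn e (HadamardReg.extD ψ) y
    rw [formIn_extD he isOpen_univ hη ⟨hy.1, mem_univ _⟩, formIn_dWedge he hμ hy.1,
      formIn_extD he hYc.isOpen_compl h1 hy, hηe'.extDeriv_eq, extDeriv_comp_smul hP hg hβ,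
      hηe y hy, oneWedge_smul_right, ← Complex.ofReal_pow, coe_smul_form, coe_smul_form]
    rw [← hgd]
    generalize extDeriv (formIn e ψ) y = D
    generalize oneWedge (fderiv ℝ g y) (formIn e ψ y) = W
    ext v
    simp only [ContinuousAlternatingMap.add_apply, ContinuousAlternatingMap.smul_apply,
      Complex.real_smul]
    rcases Nat.eq_zero_or_pos N with rfl | hN
    · simp
    · obtain ⟨M, rfl⟩ := Nat.exists_eq_succ_of_ne_zero hN.ne'
      rw [Nat.succ_eq_add_one, Nat.add_sub_cancel]
      push_cast
      ring

end SingularDerivative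

/-! ### Stokes' theorem for singular forms -/

section Stokes

variable {k : ℕ} {X : Type*} [TopologicalSpace X] [ChartedSpace (EuclideanSpace ℝ (Fin (k + 1))) X]
  [SecondCountableTopology X] [MeasurableSpace X] [BorelSpace X]

local notation "𝔼" => EuclideanSpace ℝ (Fin (k + 1))

variable {o : ManifoldOrientation (k + 1) X} {Y : Set X} {μ : X → ℝ} {N : ℕ} {ψ : Form (k + 1) X k}

theorem formIntegral_sum {ι : Type*} {t : Finset ι} {ω : Form (k + 1) X (k + 1)}
    {ω' : ι → Form (k + 1) X (k + 1)} {A : Set X} (hA : MeasurableSet A)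
    (h : ∀ z ∈ A, ω z = ∑ i ∈ t, ω' i z) (hi : ∀ i ∈ t, FormIntegrableOn o (ω' i) A) :
    formIntegral o ω A = ∑ i ∈ t, formIntegral o (ω' i) A := by
  have hd : ∀ z ∈ A, density o ω z = ∑ i ∈ t, density o (ω' i) z := by
    intro z hz
    set e' := chartAt 𝔼 (chartSel (k + 1) X z) with he'd
    have hz' : z ∈ e'.source := (isChartSelection_chartSel (k + 1) X).mem_source z
    have h1 : ∀ η : Form (k + 1) X (k + 1), density o η z = (chartSign o e' (e' z) : ℂ) *
        formAt η (e'.symm (e' z)) fun i => chartFrame e' (e' z) (EuclideanSpace.single i 1) :=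
      fun _ => rfl
    have h2 : formAt ω z = ∑ i ∈ t, formAt (ω' i) z := h z hz
    simp only [h1, e'.left_inv hz']
    rw [h2, ContinuousAlternatingMap.sum_apply, Finset.mul_sum]
  rw [formIntegral, setIntegral_congr_fun hA hd]
  exact integral_finsetSum t hi

variable [T2Space X] [IsManifold (𝓡 (k + 1)) (⊤ : ℕ∞) X]

/-- Stokes' theorem for `μ^{s/2} ψ` in a chart. For `re s` large this form, extended by zero, is
continuously differentiable across `Y`. -/
theorem stokes_of_support_subset (hYc : IsClosed Y)
    (hμ : ContMDiff (𝓡 (k + 1)) 𝓘(ℝ, ℝ) (⊤ : ℕ∞) μ)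
    (hμY : ∀ x, μ x = 0 ↔ x ∈ Y) (hψ : SingularOfOrder Y μ N ψ) (hS : RelCompactSupport Y ψ)
    {p : X} {O : Set X} (hO : IsOpen O) (hOe : O ⊆ (chartAt 𝔼 p).source)
    {σ : ℝ} (hσ : σ ≠ 0) (hOs : ∀ z ∈ O, chartSign o (chartAt 𝔼 p) (chartAt 𝔼 p z) = σ)
    (hSO : closure {x | x ∉ Y ∧ ψ x ≠ 0} ⊆ O) {s : ℂ} (hs : 2 * (N : ℝ) + 2 < s.re)
    (h1 : FormIntegrableOn o (powForm μ s (extD ψ)) Yᶜ)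
    (h2 : FormIntegrableOn o (powForm μ s (dLogWedge μ ψ)) Yᶜ) :
    formIntegral o (powForm μ s (extD ψ)) Yᶜ =
      -(s / 2) * formIntegral o (powForm μ s (dLogWedge μ ψ)) Yᶜ := by
  set S := closure {x | x ∉ Y ∧ ψ x ≠ 0} with hSd
  set e := chartAt 𝔼 p with hed
  have he : e ∈ IsManifold.maximalAtlas (𝓡 (k + 1)) (⊤ : ℕ∞) X := IsManifold.chart_mem_maximalAtlas p
  obtain ⟨hψs, η, hη, hηψ⟩ := hψ
  set A := Yᶜ ∩ O with hAd
  have hAm : MeasurableSet A := hYc.measurableSet.compl.inter hO.measurableSet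
  set T := e.symm ⁻¹' A ∩ e.target with hTd
  have hred : ∀ ω : Form (k + 1) X (k + 1), (closure {x | x ∉ Y ∧ ω x ≠ 0} ⊆ S) →
      FormIntegrableOn o (powForm μ s ω) Yᶜ →
      IntegrableOn (coeffIn e (powForm μ s ω)) T ∧
        formIntegral o (powForm μ s ω) Yᶜ = σ * ∫ y in T, coeffIn e (powForm μ s ω) y := by
    intro ω hω hi
    obtain ⟨g1, g2⟩ := formIntegrableOn_inter_iff o (ω := powForm μ s ω) (O := O)
      hYc.measurableSet.compl fun z hz hzO => mulForm_eq_zero (fun x => (μ x : ℂ) ^ (s / 2)) (by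
        by_contra h
        exact hzO (hSO (hω (mem_closure_of_form_ne_zero hz h))))
    obtain ⟨g3, g4⟩ := formIntegrableOn_iff_coeffIn o he (powForm μ s ω) hAm
      (fun z hz => hOe hz.2) hσ fun z hz => hOs z hz.2
    exact ⟨g3.1 (g1.1 hi), g2.trans g4⟩
  obtain ⟨i1, e1⟩ := hred _ (support_extD_subset hYc) h1
  obtain ⟨i2, e2⟩ := hred _ support_dLogWedge_subset h2
  -- `μ^{s/2} ψ = μ^w η` off `Y`, with `η` the smooth extension of `μ^N ψ`. Since `re w > 1`, the form
  -- `μ^w η` is `C¹` across `Y`, and its derivative vanishes on `Y`.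
  set w : ℂ := s / 2 - N with hwd
  have hw : 1 < w.re := by
    have : w.re = s.re / 2 - N := by simp [hwd]
    rw [this]
    linarith
  have hs2 : 1 < (s / 2).re := by
    have : (s / 2).re = s.re / 2 := by simp
    rw [this]
    have : (0 : ℝ) ≤ N := Nat.cast_nonneg N
    linarith
  have hw0 : w ≠ 0 := fun h => by
    rw [h, Complex.zero_re] at hw
    linarith
  have hw1 : w - 1 ≠ 0 := fun h => by
    rw [sub_eq_zero.1 h, Complex.one_re] at hw
    exact lt_irrefl _ hw
  set g := μ ∘ e.symm with hgd
  have hg : ContDiffOn ℝ (⊤ : ℕ∞) g e.target := contDiffOn_comp_chart_symm hμ he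
  have hηs : ContDiffOn ℝ (⊤ : ℕ∞) (formIn e η) e.target := by
    have := hη.contDiffOn_formIn p
    rwa [preimage_univ, inter_univ] at this
  set B : 𝔼 → 𝔼 [⋀^Fin k]→L[ℝ] ℂ :=
    e.target.indicator fun y => (g y : ℂ) ^ w • formIn e η y with hBd
  set K := e '' S with hKd
  have hSe : S ⊆ e.source := hSO.trans hOe
  have hKc : IsCompact K := hS.image_of_continuousOn (e.continuousOn.mono hSe)
  have hηz : ∀ y ∈ e.target, e.symm y ∉ Y → formIn e η y = g y ^ N • formIn e ψ y := by
    intro y _ hyY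
    have h3 : formAt η (e.symm y) = μ (e.symm y) ^ N • formAt ψ (e.symm y) := hηψ _ hyY
    rw [formIn, h3]
    rfl
  have hBK : ∀ y ∉ K, B y = 0 := by
    intro y hy
    by_cases hyt : y ∈ e.target
    · rw [hBd, indicator_of_mem hyt]
      by_cases hyY : e.symm y ∈ Y
      · have : g y = 0 := (hμY _).2 hyY
        rw [this, Complex.ofReal_zero, Complex.zero_cpow hw0]
        ext v
        simp
      · have h3 : formAt ψ (e.symm y) = 0 := by
          by_contra h
          exact hy ⟨e.symm y, mem_closure_of_form_ne_zero hyY h, e.right_inv hyt⟩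
        rw [hηz y hyt hyY, formIn, h3]
        ext v
        simp
    · rw [hBd, indicator_of_notMem hyt]
  have hBK' : ∀ y ∉ K, B =ᶠ[𝓝 y] fun _ => 0 := fun y hy => by
    filter_upwards [hKc.isClosed.isOpen_compl.mem_nhds hy] with z hz using hBK z hz
  have hKt : K ⊆ e.target := by
    rintro _ ⟨z, hz, rfl⟩
    exact e.map_source (hSe hz)
  have hBt : ∀ y ∈ e.target, B =ᶠ[𝓝 y] fun y => (g y : ℂ) ^ w • formIn e η y := fun y hy => by
    filter_upwards [e.open_target.mem_nhds hy] with z hz using indicator_of_mem hz _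
  have hB1 : ContDiff ℝ 1 B := by
    rw [contDiff_iff_contDiffAt]
    intro y
    by_cases hy : y ∈ e.target
    · refine ContDiffAt.congr_of_eventuallyEq ?_ (hBt y hy)
      have g1 : ContDiffAt ℝ 1 g y :=
        (hg.contDiffAt (e.open_target.mem_nhds hy)).of_le (by exact_mod_cast le_top)
      have g2 : ContDiffAt ℝ 1 (formIn e η) y :=
        (hηs.contDiffAt (e.open_target.mem_nhds hy)).of_le (by exact_mod_cast le_top)
      exact ((contDiff_ofReal_cpow hw).contDiffAt.comp y g1).smul g2
    · exact contDiffAt_const.congr_of_eventuallyEq (hBK' y fun h => hy (hKt h))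
  have hBc : HasCompactSupport B := HasCompactSupport.intro hKc hBK
  have hstokes := integral_extDeriv_eq_zero hB1 hBc
  have hgd' : ∀ y ∈ e.target, DifferentiableAt ℝ g y := fun y hy =>
    (hg.contDiffAt (e.open_target.mem_nhds hy)).differentiableAt (by simp)
  have hoff : ∀ y ∉ T, extDeriv B y (fun i => EuclideanSpace.single i (1 : ℝ)) = 0 := by
    intro y hy
    by_cases hyK : y ∈ K
    · have hyt := hKt hyK
      obtain ⟨z, hz, rfl⟩ := hyK
      have hyY : e.symm (e z) ∈ Y := by
        by_contra hyY
        refine hy ⟨⟨hyY, ?_⟩, hyt⟩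
        rw [e.left_inv (hSe hz)]
        exact hSO hz
      have hg0 : g (e z) = 0 := (hμY _).2 hyY
      rw [(hBt _ hyt).extDeriv_eq, extDeriv_comp_smul (hasDerivAt_ofReal_cpow hw _) (hgd' _ hyt)
        ((hηs.contDiffAt (e.open_target.mem_nhds hyt)).differentiableAt (by simp)), hg0,
        Complex.ofReal_zero, Complex.zero_cpow hw0, Complex.zero_cpow hw1]
      simp
    · rw [(hBK' y hyK).extDeriv_eq]
      simp [extDeriv, ContinuousAlternatingMap.alternatizeUncurryFin_apply]
  have hon : ∀ y ∈ T, extDeriv B y (fun i => EuclideanSpace.single i (1 : ℝ)) =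
      coeffIn e (powForm μ s (extD ψ)) y + s / 2 * coeffIn e (powForm μ s (dLogWedge μ ψ)) y := by
    intro y hy
    have hyt := hy.2
    have hy' : y ∈ e.target ∩ e.symm ⁻¹' Yᶜ := ⟨hyt, hy.1.1⟩
    have hBψ : B =ᶠ[𝓝 y] fun y => (g y : ℂ) ^ (s / 2) • formIn e ψ y := by
      filter_upwards [(e.isOpen_inter_preimage_symm hYc.isOpen_compl).mem_nhds hy'] with z hz
      have hgz : (g z : ℂ) ≠ 0 := by
        exact_mod_cast fun h => hz.2 ((hμY _).1 h)
      rw [hBd, indicator_of_mem hz.1, hηz z hz.1 hz.2, ← coe_smul_form, smul_smul,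
        Complex.ofReal_pow, ← Complex.cpow_natCast, ← Complex.cpow_add _ _ hgz, hwd, sub_add_cancel]
    have hgy : (g y : ℂ) ≠ 0 := by
      exact_mod_cast fun h => hy'.2 ((hμY _).1 h)
    rw [hBψ.extDeriv_eq, extDeriv_comp_smul (hasDerivAt_ofReal_cpow hs2 _) (hgd' _ hyt)
      (((hψs.contDiffOn_formIn p).contDiffAt ((e.isOpen_inter_preimage_symm
        hYc.isOpen_compl).mem_nhds hy')).differentiableAt (by simp)),
      ← formIn_extD he hYc.isOpen_compl hψs hy', ← formIn_dWedge he hμ hyt]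
    have k1 : coeffIn e (powForm μ s (extD ψ)) y = (g y : ℂ) ^ (s / 2) *
        formIn e (extD ψ) y (fun i => EuclideanSpace.single i (1 : ℝ)) := rfl
    have k2 : coeffIn e (powForm μ s (dLogWedge μ ψ)) y = (g y : ℂ) ^ (s / 2) *
        (((g y)⁻¹ : ℝ) • formIn e (dWedge μ ψ) y (fun i => EuclideanSpace.single i (1 : ℝ))) := rfl
    rw [k1, k2, Complex.cpow_sub _ _ hgy, Complex.cpow_one, ContinuousAlternatingMap.add_apply,
      ContinuousAlternatingMap.smul_apply, ContinuousAlternatingMap.smul_apply, Complex.real_smul,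
      Complex.ofReal_inv, smul_eq_mul, smul_eq_mul]
    ring
  have hTm : MeasurableSet T := measurableSet_chart_preimage e hAm
  have h3 : ∫ y in T, (coeffIn e (powForm μ s (extD ψ)) y +
      s / 2 * coeffIn e (powForm μ s (dLogWedge μ ψ)) y) = 0 := by
    rw [← setIntegral_congr_fun hTm hon, setIntegral_eq_integral_of_forall_compl_eq_zero hoff]
    exact hstokes
  rw [integral_add i1 (Integrable.const_mul i2 _), integral_const_mul] at h3
  rw [e1, e2]
  linear_combination (σ : ℂ) * h3

variable {m : ℕ}

/-- Integration by parts: for `re s` large, `∫ μ^{s/2} dψ = -(s/2) ∫ μ^{s/2} dμ/μ ∧ ψ`. -/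
theorem formIntegral_powForm_extD (o : ManifoldOrientation (k + 1) X)
    (hY : IsClosedSubmanifold (k + 1) m Y) (hμ : IsMorseBott (k + 1) m Y μ)
    (hψ : SingularOfOrder Y μ N ψ) (hS : RelCompactSupport Y ψ) {s : ℂ}
    (hs : 2 * (N : ℝ) + 2 < s.re) :
    formIntegral o (powForm μ s (extD ψ)) Yᶜ =
      -(s / 2) * formIntegral o (powForm μ s (dLogWedge μ ψ)) Yᶜ := by
  have hYc := hY.2.1
  have hloc : ∀ x : X, ∃ O : Set X, IsOpen O ∧ x ∈ O ∧ O ⊆ (chartAt 𝔼 x).source ∧ ∀ z ∈ O,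
      chartSign o (chartAt 𝔼 x) (chartAt 𝔼 x z) = chartSign o (chartAt 𝔼 x) (chartAt 𝔼 x x) :=
    fun x => exists_open_chartSign_const o (IsManifold.chart_mem_maximalAtlas x)
      (mem_chart_source 𝔼 x)
  choose O hO hxO hOe hOs using hloc
  obtain ⟨t, f, hfs, hft, hf1⟩ := exists_finite_partition (n := k + 1) hS hO hxO
  have hψi := fun i => hψ.smul (hfs i)
  have hSi := fun i => hS.smul (f i)
  have hs' : ((2 * ((N + 1 : ℕ) : ℤ) - m : ℤ) : ℝ) < s.re := by
    push_cast
    have : (0 : ℝ) ≤ m := Nat.cast_nonneg m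
    linarith
  have i1 : ∀ i, FormIntegrableOn o (powForm μ s (extD fun x => f i x • ψ x)) Yᶜ := fun i =>
    (isRegularizable_of_singular o hY hμ ((hψi i).extD hYc hμ.smooth)
      ((hSi i).extD hYc)).integrable s hs'
  have i2 : ∀ i, FormIntegrableOn o (powForm μ s (dLogWedge μ fun x => f i x • ψ x)) Yᶜ := fun i =>
    (isRegularizable_of_singular o hY hμ ((hψi i).dLogWedge hμ.smooth hμ.zero_iff)
      ((hSi i).dLogWedge)).integrable s hs'
  have hsum : ∀ z ∉ Y, formAt ψ z = ∑ i ∈ t, f i z • formAt ψ z := by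
    intro z hz
    rw [← Finset.sum_smul]
    by_cases h : formAt ψ z = 0
    · rw [h, smul_zero]
    · rw [hf1 z (mem_closure_of_form_ne_zero hz h), one_smul]
  have d1 : ∀ z ∈ Yᶜ, powForm μ s (extD ψ) z =
      ∑ i ∈ t, powForm μ s (extD fun x => f i x • ψ x) z := by
    intro z hz
    have hev : inChart ψ z =ᶠ[𝓝 (chartAt 𝔼 z z)]
        fun y => ∑ i ∈ t, inChart (fun x => f i x • ψ x) z y := by
      filter_upwards [((chartAt 𝔼 z).isOpen_inter_preimage_symm hYc.isOpen_compl).mem_nhds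
        (mem_chartAt_target_inter hz)] with y hy
      ext v
      have h1 : ∀ u : Fin k → 𝔼, formAt ψ ((chartAt 𝔼 z).symm y) u =
          ∑ i ∈ t, (f i ((chartAt 𝔼 z).symm y) • formAt ψ ((chartAt 𝔼 z).symm y)) u := fun u => by
        conv_lhs => rw [hsum _ hy.2, ContinuousAlternatingMap.sum_apply]
      rw [ContinuousAlternatingMap.sum_apply]
      exact h1 fun i => chartFrame (chartAt 𝔼 z) y (v i)
    have hder : extDeriv (inChart ψ z) (chartAt 𝔼 z z) =
        ∑ i ∈ t, extDeriv (inChart (fun x => f i x • ψ x) z) (chartAt 𝔼 z z) := by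
      rw [hev.extDeriv_eq]
      refine extDeriv_fun_sum t fun i _ => ?_
      exact (((hψi i).1.contDiffOn_formIn z).contDiffAt (((chartAt 𝔼 z).isOpen_inter_preimage_symm
        hYc.isOpen_compl).mem_nhds (mem_chartAt_target_inter hz))).differentiableAt (by simp)
    have hD : formAt (extD ψ) z = ∑ i ∈ t, formAt (extD fun x => f i x • ψ x) z := by
      ext v
      have h1 : ∀ u : Fin (k + 1) → 𝔼, extDeriv (inChart ψ z) (chartAt 𝔼 z z) u =
          ∑ i ∈ t, extDeriv (inChart (fun x => f i x • ψ x) z) (chartAt 𝔼 z z) u := fun u => by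
        rw [hder, ContinuousAlternatingMap.sum_apply]
      rw [ContinuousAlternatingMap.sum_apply]
      exact h1 fun i => mfderiv (𝓡 (k + 1)) 𝓘(ℝ, 𝔼) (extChartAt (𝓡 (k + 1)) z) z (v i)
    change (μ z : ℂ) ^ (s / 2) • formAt (extD ψ) z =
      ∑ i ∈ t, (μ z : ℂ) ^ (s / 2) • formAt (extD fun x => f i x • ψ x) z
    rw [hD, Finset.smul_sum]
  have d2 : ∀ z ∈ Yᶜ, powForm μ s (dLogWedge μ ψ) z =
      ∑ i ∈ t, powForm μ s (dLogWedge μ fun x => f i x • ψ x) z := by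
    intro z hz
    have h1 : ∀ α : 𝔼 →L[ℝ] ℝ, (μ z : ℂ) ^ (s / 2) • ((μ z)⁻¹ • oneWedge α (formAt ψ z)) =
        ∑ i ∈ t, (μ z : ℂ) ^ (s / 2) • ((μ z)⁻¹ • oneWedge α (f i z • formAt ψ z)) := by
      intro α
      rw [← Finset.smul_sum, ← Finset.smul_sum, ← oneWedge_sum, ← hsum z hz]
    exact h1 (mfderiv (𝓡 (k + 1)) 𝓘(ℝ, ℝ) μ z)
  rw [formIntegral_sum hYc.measurableSet.compl d1 fun i _ => i1 i,
    formIntegral_sum hYc.measurableSet.compl d2 fun i _ => i2 i, Finset.mul_sum]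
  refine Finset.sum_congr rfl fun i _ => ?_
  exact stokes_of_support_subset hYc hμ.smooth hμ.zero_iff (hψi i) (hSi i) (hO i) (hOe i)
    (chartSign_ne_zero o (IsManifold.chart_mem_maximalAtlas i)
      ((chartAt 𝔼 i).map_source (mem_chart_source 𝔼 i))) (hOs i)
    ((support_smul_form_subset (f i) ψ).trans (inter_subset_right.trans (hft i))) hs (i1 i) (i2 i)

/-- The regularized integrals of an exact form. The sign comes from
`ψ ∧ dμ/μ = (-1)^k dμ/μ ∧ ψ`. -/
theorem finitePart_extD (o : ManifoldOrientation (k + 1) X)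
    (hY : IsClosedSubmanifold (k + 1) m Y) (hμ : IsMorseBott (k + 1) m Y μ)
    (hψ : SingularOfOrder Y μ N ψ) (hS : RelCompactSupport Y ψ) :
    finitePart o μ (extD ψ) =
        (-1) ^ (k + 1) * (1 / 2) * logCoeff o μ (wedgeOne ψ (dLog μ)) ∧
      logCoeff o μ (extD ψ) = 0 := by
  have hYc := hY.2.1
  have hθs : SingularOfOrder Y μ (N + 1) (wedgeOne ψ (dLog μ)) := by
    rw [wedgeOne_dLog]
    exact (hψ.dLogWedge hμ.smooth hμ.zero_iff).smul (χ := fun _ => (-1 : ℝ) ^ k) contMDiff_const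
  have hθS : RelCompactSupport Y (wedgeOne ψ (dLog μ)) := by
    rw [wedgeOne_dLog]
    exact (hS.dLogWedge).smul fun _ => (-1 : ℝ) ^ k
  obtain ⟨b', A', hb'⟩ := (isRegularizable_of_singular o hY hμ (hψ.extD hYc hμ.smooth)
    (hS.extD hYc)).expansion
  obtain ⟨b, A, hb⟩ := (isRegularizable_of_singular o hY hμ hθs hθS).expansion
  have hJ : ∀ s : ℂ, 2 * (N : ℝ) + 2 < s.re → formIntegral o (powForm μ s (extD ψ)) Yᶜ =
      (-1) ^ (k + 1) * (1 / 2) * s * formIntegral o (powForm μ s (wedgeOne ψ (dLog μ))) Yᶜ := by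
    intro s hs
    have h1 : formIntegral o (powForm μ s (wedgeOne ψ (dLog μ))) Yᶜ =
        (-1) ^ k * formIntegral o (powForm μ s (dLogWedge μ ψ)) Yᶜ := by
      rw [wedgeOne_dLog, ← real_smul_powForm, formIntegral, formIntegral, ← integral_const_mul]
      refine integral_congr_ae (Eventually.of_forall fun z => ?_)
      simp only [density_real_smul]
      push_cast
      rfl
    rw [formIntegral_powForm_extD o hY hμ hψ hS hs, h1]
    have h2 : ((-1 : ℂ) ^ k) * (-1) ^ k = 1 := by
      rw [← mul_pow]
      norm_num
    rw [pow_succ]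
    linear_combination ((1 / 2) * s * formIntegral o (powForm μ s (dLogWedge μ ψ)) Yᶜ) * h2
  obtain ⟨h1, h2⟩ := hb.eq_zero_of_eq_mul hb' hJ
  rw [hb'.finitePart_eq, hb'.logCoeff_eq, hb.logCoeff_eq]
  exact ⟨h2, h1⟩

end Stokes

/-! ### Conformal classes -/

section ConformalClass

variable {n : ℕ} {X : Type*} [TopologicalSpace X] [ChartedSpace (EuclideanSpace ℝ (Fin n)) X]

theorem HadamardReg.ConformallyEquivalent.exists_exp {μ μ' : X → ℝ}
    (h : ConformallyEquivalent n μ μ') :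
    ∃ φ : X → ℝ, ContMDiff (𝓡 n) 𝓘(ℝ, ℝ) (⊤ : ℕ∞) φ ∧
      μ' = fun x => Real.exp (2 * φ x) * μ x := by
  obtain ⟨f, hf, hf0, hfμ⟩ := h
  refine ⟨fun x => Real.log (f x) / 2, fun x => ?_, funext fun x => ?_⟩
  · have h1 : ContDiffAt ℝ (⊤ : ℕ∞) (fun t : ℝ => Real.log t / 2) (f x) :=
      (Real.contDiffAt_log.2 (hf0 x).ne').div_const 2
    exact h1.contMDiffAt.comp x (hf x)
  · rw [hfμ x, mul_div_cancel₀ _ (two_ne_zero' ℝ), Real.exp_log (hf0 x)]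

end ConformalClass

theorem theorem1 {n : ℕ} {X : Type*} [TopologicalSpace X] [T2Space X] [SecondCountableTopology X]
    [ChartedSpace (EuclideanSpace ℝ (Fin n)) X] [IsManifold (𝓡 n) (⊤ : ℕ∞) X]
    [MeasurableSpace X] [BorelSpace X]
    (o : ManifoldOrientation n X) (m : ℕ) (Y : Set X) (hY : IsClosedSubmanifold n m Y)
    (μ : X → ℝ) (hμ : IsMorseBott n m Y μ) :
    -- zeta function, expansion of the cutoff integral, residues, and part (i)
    (∀ (N : ℕ) (ω : Form n X n), SingularOfOrder Y μ N ω → RelCompactSupport Y ω →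
      (∃ ζ : ℂ → ℂ,
        (∀ s : ℂ, 2 * (N : ℝ) - m < s.re →
          FormIntegrableOn o (powForm μ s ω) Yᶜ ∧ ζ s = formIntegral o (powForm μ s ω) Yᶜ) ∧
        (∀ s₀ : ℂ, (∀ j : ℕ, s₀ ≠ 2 * (N : ℂ) - m - 2 * j) → AnalyticAt ℂ ζ s₀) ∧
        (∀ j : ℕ, MeromorphicAt ζ (2 * (N : ℂ) - m - 2 * j) ∧
          ((-1 : ℤ) : WithTop ℤ) ≤ meromorphicOrderAt ζ (2 * (N : ℂ) - m - 2 * j)) ∧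
        (∀ k ∈ Finset.Icc 1 (2 * N - m),
          Tendsto (fun s : ℂ => (1 / (k : ℂ)) * ((s - k) * ζ s)) (𝓝[≠] (k : ℂ))
            (𝓝 (polarCoeff o μ ω k))) ∧
        Tendsto (fun s : ℂ => s * ζ s) (𝓝[≠] 0) (𝓝 (logCoeff o μ ω)) ∧
        Tendsto (fun s : ℂ => ζ s - logCoeff o μ ω / s) (𝓝[≠] 0) (𝓝 (finitePart o μ ω))) ∧
      (∀ ε : ℝ, 0 < ε → FormIntegrableOn o ω {x | ε ^ 2 ≤ μ x}) ∧
      HasHadamardExpansion (cutoffIntegral o μ ω) (2 * N - m) (polarCoeff o μ ω)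
        (logCoeff o μ ω) (finitePart o μ ω) ∧
      (∀ k ∈ Finset.Icc 1 (2 * N - m), ¬ k ≡ m [MOD 2] → polarCoeff o μ ω k = 0) ∧
      (∀ μ' : X → ℝ, IsMorseBott n m Y μ' → ConformallyEquivalent n μ μ' →
        logCoeff o μ' ω = logCoeff o μ ω) ∧
      (Odd m → logCoeff o μ ω = 0)) ∧
    -- part (ii)
    (∀ ω : Form n X n, IsSingularForm Y μ ω → RelCompactSupport Y ω →
      ∀ φ : X → ℝ, ContMDiff (𝓡 n) 𝓘(ℝ, ℝ) (⊤ : ℕ∞) φ →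
        finitePart o (fun x => Real.exp (2 * φ x) * μ x) ω =
          finitePart o μ ω + logCoeff o μ (fun x => φ x • ω x)) ∧
    -- part (iii)
    (∀ (k : ℕ) (hk : k + 1 = n) (ψ : Form n X k), IsSingularForm Y μ ψ → RelCompactSupport Y ψ →
      finitePart o μ (castDeg hk (extD ψ)) =
          (-1) ^ n * (1 / 2) * logCoeff o μ (castDeg hk (wedgeOne ψ (dLog μ))) ∧
      logCoeff o μ (castDeg hk (extD ψ)) = 0) := by
  refine ⟨fun N ω hω hS => ?_, fun ω hω hS φ hφ => ?_, fun k hk ψ hψ hS => ?_⟩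
  · obtain ⟨hint, b, A, hbA⟩ := isRegularizable_of_singular o hY hμ hω hS
    obtain ⟨ζ, hζ⟩ := hbA.exists_zeta
    have ha : ((2 * N - m : ℤ) : ℂ) = 2 * (N : ℂ) - m := by push_cast; ring
    have har : ((2 * N - m : ℤ) : ℝ) = 2 * (N : ℝ) - m := by push_cast; ring
    have haN : (2 * (N : ℤ) - m).toNat = 2 * N - m := by omega
    have hlog := hbA.logCoeff_eq
    have hfin := hbA.finitePart_eq
    have hexp := hbA.expansion
    have hpol : ∀ k ∈ Finset.Icc 1 (2 * N - m), polarCoeff o μ ω k = b k / k := fun k hk =>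
      hexp.polarCoeff_eq (haN.symm ▸ hk)
    have hk0 : ∀ k ∈ Finset.Icc 1 (2 * N - m), ∀ s : ℂ, (1 / (k : ℂ)) * ((s - k) * ζ s) =
        (1 / (k : ℂ)) * ((s - ((k : ℤ) : ℂ)) * ζ s) := fun k _ s => by rw [Int.cast_natCast]
    refine ⟨⟨ζ, fun s hs => ?_, fun s₀ hs₀ => ?_, fun j => ?_, fun k hk => ?_, ?_, ?_⟩,
      fun ε hε => formIntegrableOn_cutoff o hY.2.1 hμ.smooth.continuous hμ.zero_iff hω.1 hS hε,
      ?_, fun k hk hkm => ?_, fun μ' _ hμμ' => ?_, fun hm => ?_⟩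
    · rw [← har] at hs
      exact ⟨hint s hs, hζ.eq s hs⟩
    · exact hζ.analyticAt fun j => by rw [ha]; exact hs₀ j
    · have hj : 2 * (N : ℂ) - m - 2 * j = ((2 * N - m - 2 * j : ℤ) : ℂ) := by push_cast; ring
      rw [hj]
      exact ⟨hζ.meromorphicAt _, hζ.neg_one_le_order _⟩
    · simp only [hk0 k hk]
      have := (hζ.tendsto_residue k).const_mul (1 / (k : ℂ))
      rw [hpol k hk, show b k / k = 1 / (k : ℂ) * b k by ring]
      rwa [Int.cast_natCast] at this ⊢
    · have := hζ.tendsto_residue 0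
      simp only [Int.cast_zero, sub_zero] at this
      rwa [hlog]
    · rw [hlog, hfin]
      exact hζ.tendsto_constant
    · rw [hlog, hfin]
      rw [haN] at hexp
      exact hexp.congr EventuallyEq.rfl fun k hk => (hpol k hk).symm
    · rw [hpol k hk]
      have : b k = 0 := by
        by_contra h
        obtain ⟨j, hj⟩ := hbA.supp k h
        refine hkm ?_
        unfold Nat.ModEq
        omega
      rw [this, zero_div]
    · obtain ⟨φ, hφ, rfl⟩ := hμμ'.exists_exp
      exact (finitePart_conformal o hY hμ hω hS hφ).1
    · rw [hlog]
      by_contra h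
      obtain ⟨j, hj⟩ := hbA.supp 0 h
      obtain ⟨i, hi⟩ := hm
      omega
  · obtain ⟨N, hω⟩ := hω
    exact (finitePart_conformal o hY hμ hω hS hφ).2
  · subst hk
    obtain ⟨N, hψ⟩ := hψ
    exact finitePart_extD o hY hμ hψ hS
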